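/- Let $R$ be a real closed field with algebraic closure $C=R[i]$. Let $X=\operatorname{Spec}B$ and $Y=\operatorname{Spec}A$ be affine $R$-varieties (schemes of finite type over $R$, not necessarily reduced or irreducible), and let $\pi:X\to Y$ be a projection of relative dimension 1: a dominant $R$-morphism together with closed immersions $i_X:X\hookrightarrow\mathbb{A}^{n+1}_R$ and $i_Y:Y\hookrightarrow\mathbb{A}^n_R$ such that $i_Y\circ\pi=\pi_n\circ i_X$, where $\pi_n:\mathbb{A}^{n+1}_R\to\mathbb{A}^n_R$ forgets the last coordinate. Via $i_X$ and $i_Y$, regard $X(R)\subseteq R^{n+1}$ and $Y(R)\subseteq R^n$, with the Euclidean topology. Let $W=D(w)$, $w\in A$, be a distinguished open subscheme of $Y$ such that $X\times_Y W\to W$ is finite and free, i.e. $A_w\otimes_A B$ is a finite free $A_w$-module. Let $h\in\Gamma(X,\mathcal{O}_X)=B$, and let $S\subseteq W(R)$ be a semi-algebraic set that is semi-algebraically connected (not a disjoint union of two non-empty semi-algebraic subsets closed in $S$). Suppose that the cardinality $\#(D(h))_{\overline{y}}$ of the geometric fiber $D(h)\times_Y\operatorname{Spec}\overline{\kappa_y}$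 is the same for all $y\in S$. Then there are an integer $l\ge 0$ and semi-algebraic continuous maps $\xi_1,\ldots,\xi_l:S\to X(R)$ such that $\pi\circ\xi_i=\mathrm{id}_S$ for all $i$ and, for every $y\in S$, $$\{\xi_1(y),\ldots,\xi_l(y)\}=\{x\in X(R)\mid \pi(x)=y,\ h(x)\neq 0\}.$$ Moreover, $D(h)\subseteq X$ is geometrically delineable over $S$. That is, let $I\subseteq R[x_1,\ldots,x_{n+1}]$ be the ideal of $i_X(X)$, let $\tilde h\in R[x_1,\ldots,x_{n+1}]$ be any polynomial restricting to $h$ on $X$, and let $T=V(I)\cap D(\tilde h)\subseteq\mathbb{A}^{n+1}_R$. Then: 1. The number of $c\in C$ with $f(a,c)=0$ for all $f\in I$ and $\tilde h(a,c)\ne 0$ is finite and the same for all $a\in S$. 2. There are an integer $k\ge 0$ and semi-algebraic continuous maps $\zeta_1,\ldots,\zeta_k:S\to T(R)$ that are sections of the projection $R^{n+1}\to R^n$ and whose last coordinates satisfy $\zeta_1<\cdots<\zeta_k$ at every point of $S$. 3. Every $t\in T(R)$ lying over a point $a\in S$ equals $\zeta_i(a)$ for exactly one $i$. -/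

import Mathlib

open scoped TensorProduct Topology

section RealGeometry

variable {R : Type*} [Field R] [LinearOrder R]

/-- A basic semi-algebraic set: finitely many polynomial equations and strict inequalities. -/
def IsBasicSemialgebraic {ι : Type*} (S : Set (ι → R)) : Prop :=
  ∃ F H : Finset (MvPolynomial ι R),
    S = {x | (∀ f ∈ F, MvPolynomial.eval x f = 0) ∧ ∀ h ∈ H, 0 < MvPolynomial.eval x h}

/-- A semi-algebraic set: a finite union of basic semi-algebraic sets. -/
def IsSemialgebraic {ι : Type*} (S : Set (ι → R)) : Prop :=
  ∃ 𝒯 : Set (Set (ι → R)), 𝒯.Finite ∧ (∀ T ∈ 𝒯, IsBasicSemialgebraic T) ∧ S = ⋃₀ 𝒯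

/-- The open ball of radius `r` for the Euclidean norm (stated without square roots, `r > 0`). -/
def euclideanBall {ι : Type*} [Fintype ι] (x : ι → R) (r : R) : Set (ι → R) :=
  {x' | ∑ i, (x' i - x i) ^ 2 < r ^ 2}

/-- The Euclidean topology on `R ^ ι`, with the open balls as a basis. -/
@[reducible] def euclideanTopology (R : Type*) [Field R] [LinearOrder R] (ι : Type*) [Fintype ι] :
    TopologicalSpace (ι → R) :=
  TopologicalSpace.generateFrom {U | ∃ (x : ι → R) (r : R), 0 < r ∧ U = euclideanBall x r}

/-- `S` is not a disjoint union of two non-empty semi-algebraic subsets that are closed in `S`. -/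
def IsSemialgebraicallyConnected {ι : Type*} [Fintype ι] (S : Set (ι → R)) : Prop :=
  ¬ ∃ S₁ S₂ : Set (ι → R),
    IsSemialgebraic S₁ ∧ IsSemialgebraic S₂ ∧ S₁.Nonempty ∧ S₂.Nonempty ∧
    (∃ Z, IsClosed[euclideanTopology R ι] Z ∧ S₁ = S ∩ Z) ∧
    (∃ Z, IsClosed[euclideanTopology R ι] Z ∧ S₂ = S ∩ Z) ∧
    Disjoint S₁ S₂ ∧ S₁ ∪ S₂ = S

/-- `f : P → Q` is semi-algebraic and continuous, where `P` and `Q` are regarded as subsets of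
`R ^ ι` and `R ^ κ` through `e` and `e'`: its graph is a semi-algebraic subset of
`R ^ ι × R ^ κ`, and it is continuous for the topologies inherited from the Euclidean ones. -/
def IsSemialgebraicContinuous {ι κ P Q : Type*} [Fintype ι] [Fintype κ]
    (e : P → ι → R) (e' : Q → κ → R) (f : P → Q) : Prop :=
  IsSemialgebraic (Set.range fun p : P => (Sum.elim (e p) (e' (f p)) : ι ⊕ κ → R)) ∧
  Continuous[(euclideanTopology R ι).induced e, (euclideanTopology R κ).induced e'] f

/-- The basic constructible set `T = V(I) ∩ D(h)` of affine `(n+1)`-space is geometrically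
delineable over `S ⊆ R ^ n`. -/
def GeometricallyDelineable {n : ℕ} (I : Ideal (MvPolynomial (Fin (n + 1)) R))
    (h : MvPolynomial (Fin (n + 1)) R) (S : Set (Fin n → R)) : Prop :=
  -- the number of distinct solutions in the algebraic closure is finite and invariant
  (∃ m : ℕ, ∀ a ∈ S,
    {c : AlgebraicClosure R |
      (∀ f ∈ I, MvPolynomial.aeval
        (Fin.snoc (α := fun _ => AlgebraicClosure R)
          (fun i => algebraMap R (AlgebraicClosure R) (a i)) c) f = 0) ∧
      MvPolynomial.aeval
        (Fin.snoc (α := fun _ => AlgebraicClosure R)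
          (fun i => algebraMap R (AlgebraicClosure R) (a i)) c) h ≠ 0}.encard = m) ∧
  ∃ (k : ℕ) (ξ : Fin k → S → Fin (n + 1) → R),
    -- the sections are semi-algebraic and continuous, with values in `T(R)`
    (∀ i, IsSemialgebraicContinuous (Subtype.val : S → Fin n → R) id (ξ i)) ∧
    (∀ i a, (∀ f ∈ I, MvPolynomial.eval (ξ i a) f = 0) ∧ MvPolynomial.eval (ξ i a) h ≠ 0) ∧
    (∀ i a, Fin.init (ξ i a) = a.1) ∧
    -- they are arranged in strictly ascending order in the last coordinate
    (∀ a, StrictMono fun i => ξ i a (Fin.last n)) ∧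
    -- every real point of `T` over `S` lies on exactly one section
    (∀ (a : S) (t : Fin (n + 1) → R), Fin.init t = a.1 →
      (∀ f ∈ I, MvPolynomial.eval t f = 0) → MvPolynomial.eval t h ≠ 0 → ∃! i, t = ξ i a)

end RealGeometry

section Varieties

/-- The `R`-rational points of `Spec A`. -/
abbrev RationalPoint (R A : Type*) [CommRing R] [CommRing A] [Algebra R A] : Type _ :=
  A →ₐ[R] R

/-- The underlying point of the scheme `Spec A` of an `R`-rational point. -/
def RationalPoint.toPrime {R A : Type*} [Field R] [CommRing A] [Algebra R A]
    (y : RationalPoint R A) : PrimeSpectrum A :=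
  ⟨RingHom.ker y, RingHom.ker_isPrime y⟩

/-- The map on `R`-rational points induced by the `R`-morphism `Spec B → Spec A`. -/
def RationalPoint.map {R A B : Type*} [CommRing R] [CommRing A] [CommRing B] [Algebra R A]
    [Algebra R B] [Algebra A B] [IsScalarTower R A B] (x : RationalPoint R B) :
    RationalPoint R A :=
  x.comp (IsScalarTower.toAlgHom R A B)

/-- The map on `R`-rational points, from `(Spec A)(R)` to `R ^ ι`, induced by the `R`-morphism
from `Spec A` to affine space given by the ring map `φ`. -/
noncomputable def RationalPoint.coords {R A ι : Type*} [CommRing R] [CommRing A] [Algebra R A]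
    (φ : MvPolynomial ι R →ₐ[R] A) (y : RationalPoint R A) : ι → R :=
  fun i => y (φ (MvPolynomial.X i))

/-- The morphism `Spec B → Spec A` of affine `R`-varieties is a projection of relative
dimension 1, as witnessed by the closed immersions of `Spec B` into affine `(n+1)`-space and of
`Spec A` into affine `n`-space given by the surjective ring maps `iX` and `iY`: the morphism is
dominant and is induced by the projection forgetting the last coordinate. -/
structure IsProjectionOfRelDimOne {R A B : Type*} [CommRing R] [CommRing A] [CommRing B]
    [Algebra R A] [Algebra R B] [Algebra A B] [IsScalarTower R A B] {n : ℕ}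
    (iX : MvPolynomial (Fin (n + 1)) R →ₐ[R] B) (iY : MvPolynomial (Fin n) R →ₐ[R] A) :
    Prop where
  surjective_iX : Function.Surjective iX
  surjective_iY : Function.Surjective iY
  comm : iX.comp (MvPolynomial.rename Fin.castSucc) = (IsScalarTower.toAlgHom R A B).comp iY
  dominant : DenseRange (PrimeSpectrum.comap (algebraMap A B))

/-- The geometric fiber of `D(h) ⊆ Spec B` over the point `p` of `Spec A`: the distinguished open
defined by `h` in `Spec B ×_{Spec A} Spec K`, `K` the algebraic closure of the residue field. -/
def geometricFiber {A B : Type*} [CommRing A] [CommRing B] [Algebra A B]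
    (h : B) (p : PrimeSpectrum A) :
    Set (PrimeSpectrum (AlgebraicClosure p.asIdeal.ResidueField ⊗[A] B)) :=
  PrimeSpectrum.basicOpen ((1 : AlgebraicClosure p.asIdeal.ResidueField) ⊗ₜ[A] h)

end Varieties

/-!
Let `x` be the last coordinate on `X`. Since `A_w ⊗ B` is generated over `A_w` by `x` and is finite
and free, `X` is over `D(w)` the zero set of the minimal polynomial `P` of `x`
(`exists_isOver_iff_aeval_minpoly`), and the geometric fibre of `D(h)` at a rational point `y` is
the set of those roots `c` of `P_y` in the algebraic closure at which `h` does not vanish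
(`encard_geometricFiber`, `encard_setOf_aeval_snocPoint`). Their number `m` is constant on `S`, but
the number of all roots of `P_y` need not be, so the roots counted by `m` have to be separated from
the others. The weighted power sums `s_k = ∑ h(c) ^ 2 * c ^ k` over the roots of `P_y` with
multiplicity are polynomials in the coefficients of `P_y` and `h`, and only the `m` wanted roots
contribute. By Prony's method the monic polynomial `Q_y` whose simple roots are these `m` numbers
is the solution of an invertible Hankel system in the `s_k`; hence its coefficients are rational
functions without poles on `S` (`exists_separable_family`).

It remains to delineate the real roots of a family `Q` of squarefree monic polynomials of constant
degree. By Hermite's theorem (`ComplexCoordinates.hasPosIndex_hermite`) the number of real roots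
satisfying a linear inequality is determined by the positive indices of trace forms whose entries
are polynomials in the coefficients. Lagrange's reduction of quadratic forms, carried out with
parameters (`hasSemialgebraicPosIndex`), shows that the index of such a form depends
semi-algebraically on the parameters. So the set where `Q` has `k` real roots, and the graph of the
`i`-th root in ascending order, are semi-algebraic; no general quantifier elimination is needed. A
simple root moves continuously with the coefficients, and none appears from nowhere because the
roots stay bounded and a polynomial is bounded away from zero at a distance from its roots
(`eventually_strictMono_roots`). Hence the number of real roots is locally constant, so constant on
the semi-algebraically connected set `S` (`exists_card_roots_eq`), and the ordered roots are
continuous sections (`isSemialgebraicContinuous_orderedRoots`).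

Compactness arguments and the topological intermediate value theorem fail over `R`. The substitute
is the factorization of polynomials over `R` into linear and positive definite quadratic ones
(`IsRealClosed.irreducible_cases`), which rests on the algebraic closure being `R[i]`
(`IsRealClosed.exists_eq_add_mul_I`).
-/

/-! ### The algebraic closure of a real closed field -/

section RealClosed

open Polynomial IntermediateField

theorem IsRealClosed.finrank_eq_one_of_odd {R F : Type*} [Field R] [IsRealClosed R] [CharZero R]
    [Field F] [Algebra R F] [FiniteDimensional R F] (h : Odd (Module.finrank R F)) :
    Module.finrank R F = 1 := by
  obtain ⟨α, hα⟩ := Field.exists_primitive_element R F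
  have hint : IsIntegral R α := IsIntegral.of_finite R α
  have hdeg : (minpoly R α).natDegree = Module.finrank R F := by
    rw [← IntermediateField.adjoin.finrank hint, hα, IntermediateField.finrank_top']
  obtain ⟨x, hx⟩ := IsRealClosed.exists_isRoot_of_odd_natDegree (f := minpoly R α) (hdeg ▸ h)
  rw [← hdeg]
  exact natDegree_eq_of_degree_eq_some
    (degree_eq_one_of_irreducible_of_root (minpoly.irreducible hint) hx)

/-- The fixed field of a Sylow 2-subgroup has odd degree over `R`, so the Galois group is a
2-group. -/
theorem IsRealClosed.exists_finrank_eq_two_pow {R L : Type*} [Field R] [IsRealClosed R] [CharZero R]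
    [Field L] [Algebra R L] [FiniteDimensional R L] [IsGalois R L] :
    ∃ n, Module.finrank R L = 2 ^ n := by
  have : Fact (Nat.Prime 2) := ⟨Nat.prime_two⟩
  obtain ⟨P⟩ : Nonempty (Sylow 2 Gal(L/R)) := inferInstance
  have h1 : ¬ 2 ∣ (P : Subgroup Gal(L/R)).index := P.not_dvd_index
  have h2 := IntermediateField.finrank_eq_fixingSubgroup_index L
    (fixedField (P : Subgroup Gal(L/R)))
  rw [fixingSubgroup_fixedField] at h2
  have h3 := IsRealClosed.finrank_eq_one_of_odd (R := R)
    (F := fixedField (P : Subgroup Gal(L/R)))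
    (by rw [h2]; exact Nat.not_even_iff_odd.1 (fun h => h1 h.two_dvd))
  rw [h3] at h2
  refine ⟨(Nat.card Gal(L/R)).factorization 2, ?_⟩
  rw [← IsGalois.card_aut_eq_finrank, ← P.card_eq_multiplicity,
    ← Subgroup.index_mul_card (P : Subgroup Gal(L/R)), ← h2, one_mul]

/-- A field in which every element is a square has no Galois extension whose degree is a
nontrivial power of two, since such an extension contains a quadratic one. -/
theorem finrank_eq_one_of_isSquare {K L : Type*} [Field K] [CharZero K]
    [Field L] [Algebra K L] [FiniteDimensional K L] [IsGalois K L]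
    (hsq : ∀ x : K, IsSquare x) {n : ℕ} (hn : Module.finrank K L = 2 ^ n) :
    Module.finrank K L = 1 := by
  rcases n with _ | n
  · simpa using hn
  exfalso
  have : Fact (Nat.Prime 2) := ⟨Nat.prime_two⟩
  have hc : Nat.card Gal(L/K) = 2 ^ (n + 1) := by rw [IsGalois.card_aut_eq_finrank, hn]
  obtain ⟨N, hN⟩ := Sylow.exists_subgroup_card_pow_prime (G := Gal(L/K)) 2 (n := n)
    (by rw [hc]; exact pow_dvd_pow _ (Nat.le_succ n))
  have h2 : Module.finrank K (fixedField N) = 2 := by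
    rw [IntermediateField.finrank_eq_fixingSubgroup_index L, fixingSubgroup_fixedField]
    have := Subgroup.index_mul_card N
    rw [hc, hN, pow_succ, mul_comm] at this
    exact Nat.eq_of_mul_eq_mul_left (by positivity) this
  obtain ⟨α, hα⟩ := Field.exists_primitive_element K (fixedField N)
  have hint : IsIntegral K α := IsIntegral.of_finite K α
  have hdeg : (minpoly K α).natDegree = 2 := by
    rw [← IntermediateField.adjoin.finrank hint, hα, IntermediateField.finrank_top', h2]
  have hm := minpoly.monic hint
  set p := minpoly K α
  obtain ⟨s, hs⟩ := hsq (discrim 1 (p.coeff 1) (p.coeff 0))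
  have hp : p = X ^ 2 + C (p.coeff 1) * X + C (p.coeff 0) := by
    conv_lhs => rw [p.as_sum_range_C_mul_X_pow, hdeg]
    have : p.coeff 2 = 1 := hdeg ▸ hm.coeff_natDegree
    simp [Finset.sum_range_succ, this]
    ring
  have hroot : p.IsRoot ((-(p.coeff 1) + s) / (2 * 1)) := by
    have := (quadratic_eq_zero_iff (one_ne_zero (α := K)) hs
      ((-(p.coeff 1) + s) / (2 * 1))).2 (Or.inl rfl)
    rw [IsRoot, congrArg (eval _) hp]
    simp only [eval_add, eval_pow, eval_X, eval_mul, eval_C]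
    linear_combination this
  have := natDegree_eq_of_degree_eq_some
    (degree_eq_one_of_irreducible_of_root (minpoly.irreducible hint) hroot)
  change p.natDegree = 1 at this
  omega

variable {R : Type*} [Field R] [LinearOrder R] [IsStrictOrderedRing R] [IsRealClosed R]

/-- The formula for the square root of a complex number works over any real closed field. -/
theorem IsRealClosed.exists_sq_eq_add_mul_I {K : Type*} [Field K] [Algebra R K] {i : K}
    (hi : i ^ 2 = -1) (a b : R) :
    ∃ c d : R, (algebraMap R K c + algebraMap R K d * i) ^ 2 =
      algebraMap R K a + algebraMap R K b * i := by
  obtain ⟨r, hr0, hr⟩ : ∃ r : R, 0 ≤ r ∧ r ^ 2 = a ^ 2 + b ^ 2 := by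
    obtain ⟨r, hr⟩ := IsRealClosed.exists_eq_pow_of_nonneg (x := a ^ 2 + b ^ 2) (by positivity)
      two_ne_zero
    exact ⟨|r|, abs_nonneg _, by rw [sq_abs, hr]⟩
  have har : |a| ≤ r := abs_le_of_sq_le_sq (by nlinarith [sq_nonneg b]) hr0
  obtain ⟨c, hc⟩ := IsRealClosed.exists_eq_pow_of_nonneg (x := (r + a) / 2)
    (by linarith [neg_abs_le a]) two_ne_zero
  obtain ⟨d, hd⟩ := IsRealClosed.exists_eq_pow_of_nonneg (x := (r - a) / 2)
    (by linarith [le_abs_self a]) two_ne_zero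
  have hcd : (2 * (c * d)) ^ 2 = b ^ 2 := by
    have : (2 * (c * d)) ^ 2 = 4 * (c ^ 2 * d ^ 2) := by ring
    rw [this, ← hc, ← hd]; linear_combination hr
  rcases sq_eq_sq_iff_eq_or_eq_neg.1 hcd with h | h
  · refine ⟨c, d, ?_⟩
    have h1 : a = c ^ 2 - d ^ 2 := by rw [← hc, ← hd]; ring
    rw [h1, ← h]
    simp only [map_sub, map_mul, map_pow, map_ofNat]
    linear_combination (algebraMap R K d) ^ 2 * hi
  · refine ⟨c, -d, ?_⟩
    have h1 : a = c ^ 2 - d ^ 2 := by rw [← hc, ← hd]; ring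
    have h2 : b = - (2 * (c * d)) := by rw [h]; ring
    rw [h1, h2]
    simp only [map_sub, map_mul, map_pow, map_ofNat, map_neg]
    linear_combination (algebraMap R K d) ^ 2 * hi

theorem IsRealClosed.exists_eq_add_mul_I_of_isGalois {L : Type*} [Field L] [Algebra R L]
    [FiniteDimensional R L] [IsGalois R L] {i : L} (hi : i ^ 2 = -1) (z : L) :
    ∃ a b : R, z = algebraMap R L a + algebraMap R L b * i := by
  have hmem : ∀ z ∈ R⟮i⟯, ∃ a b : R, z = algebraMap R L a + algebraMap R L b * i := by
    intro z hz
    rw [← mem_toSubalgebra,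
      adjoin_simple_toSubalgebra_of_isAlgebraic (Algebra.IsAlgebraic.isAlgebraic i)] at hz
    induction hz using Algebra.adjoin_induction with
    | mem x hx => rw [Set.mem_singleton_iff] at hx; exact ⟨0, 1, by simp [hx]⟩
    | algebraMap r => exact ⟨r, 0, by simp⟩
    | add x y _ _ hx hy =>
      obtain ⟨a, b, rfl⟩ := hx
      obtain ⟨c, d, rfl⟩ := hy
      exact ⟨a + c, b + d, by simp only [map_add]; ring⟩
    | mul x y _ _ hx hy =>
      obtain ⟨a, b, rfl⟩ := hx
      obtain ⟨c, d, rfl⟩ := hy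
      refine ⟨a * c - b * d, a * d + b * c, ?_⟩
      simp only [map_add, map_sub, map_mul]
      linear_combination (algebraMap R L b) * (algebraMap R L d) * hi
  have hsq : ∀ x : R⟮i⟯, IsSquare x := by
    intro x
    obtain ⟨a, b, hab⟩ := hmem x.1 x.2
    obtain ⟨c, d, hcd⟩ := IsRealClosed.exists_sq_eq_add_mul_I hi a b
    refine ⟨algebraMap R R⟮i⟯ c + algebraMap R R⟮i⟯ d * AdjoinSimple.gen R i, ?_⟩
    apply Subtype.ext
    rw [hab, ← hcd, pow_two]
    rfl
  obtain ⟨n, hn⟩ := IsRealClosed.exists_finrank_eq_two_pow (R := R) (L := L)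
  obtain ⟨k, -, hk⟩ := (Nat.dvd_prime_pow Nat.prime_two).1
    (hn ▸ (Dvd.intro_left _ (Module.finrank_mul_finrank R R⟮i⟯ L)))
  have h1 := finrank_eq_one_of_isSquare hsq hk
  obtain ⟨y, hy⟩ : ∃ y : R⟮i⟯, algebraMap R⟮i⟯ L y = z := by
    have := (finrank_eq_one_iff_of_nonzero' (1 : L) one_ne_zero).1 h1 z
    obtain ⟨c, hc⟩ := this
    exact ⟨c, by rw [← hc, Algebra.smul_def, mul_one]⟩
  obtain ⟨a, b, h⟩ := hmem _ y.2
  exact ⟨a, b, by rw [← h, ← hy]; rfl⟩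

/-- The algebraic closure of a real closed field `R` is `R[i]`. -/
theorem IsRealClosed.exists_eq_add_mul_I {C : Type*} [Field C] [Algebra R C]
    [Algebra.IsAlgebraic R C] [IsAlgClosed C] {i : C} (hi : i ^ 2 = -1) (z : C) :
    ∃ a b : R, z = algebraMap R C a + algebraMap R C b * i := by
  let p : R[X] := minpoly R z * minpoly R i
  have hint : ∀ z : C, IsIntegral R z := fun z => Algebra.IsIntegral.isIntegral z
  have hp : p ≠ 0 := mul_ne_zero (minpoly.ne_zero (hint z)) (minpoly.ne_zero (hint i))
  let L : IntermediateField R C := adjoin R (p.rootSet C)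
  have : p.IsSplittingField R L := adjoin_rootSet_isSplittingField (IsAlgClosed.splits _)
  have : FiniteDimensional R L := IsSplittingField.finiteDimensional L p
  have : Normal R L := Normal.of_isSplittingField p
  have : IsGalois R L := {}
  have hz : z ∈ L := subset_adjoin _ _ (by
    rw [mem_rootSet]; exact ⟨hp, by simp [p, minpoly.aeval]⟩)
  have hi' : i ∈ L := subset_adjoin _ _ (by
    rw [mem_rootSet]; exact ⟨hp, by simp [p, minpoly.aeval]⟩)
  obtain ⟨a, b, h⟩ := IsRealClosed.exists_eq_add_mul_I_of_isGalois (R := R) (L := L) (i := ⟨i, hi'⟩)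
    (Subtype.ext (by simpa using hi)) ⟨z, hz⟩
  exact ⟨a, b, congrArg Subtype.val h⟩

end RealClosed

/-! ### Real and imaginary parts -/

section ComplexCoordinates

open Polynomial

/-- Coordinates on a quadratic extension `C = R[i]`: a square root `i` of `-1`, the real and
imaginary parts with respect to it, and complex conjugation. -/
structure ComplexCoordinates (R C : Type*) [Field R] [Field C] [Algebra R C] where
  /-- the imaginary unit -/
  i : C
  /-- the real part -/
  re : C →ₗ[R] R
  /-- the imaginary part -/
  im : C →ₗ[R] R
  /-- complex conjugation -/
  conj : C →ₐ[R] C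
  i_sq : i ^ 2 = -1
  eq_re_add_im (z : C) : z = algebraMap R C (re z) + algebraMap R C (im z) * i
  conj_eq (z : C) : conj z = algebraMap R C (re z) - algebraMap R C (im z) * i

namespace ComplexCoordinates

variable {R C : Type*} [Field R] [Field C] [Algebra R C] (κ : ComplexCoordinates R C)

include κ in
theorem ext_re_im {z w : C} (h1 : κ.re z = κ.re w) (h2 : κ.im z = κ.im w) : z = w := by
  rw [κ.eq_re_add_im z, κ.eq_re_add_im w, h1, h2]

theorem aeval_conj (p : R[X]) (z : C) : aeval (κ.conj z) p = κ.conj (aeval z p) :=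
  aeval_algHom_apply κ.conj z p

end ComplexCoordinates

variable {R C : Type*} [Field R] [LinearOrder R] [IsStrictOrderedRing R] [Field C] [Algebra R C]

theorem add_mul_I_injective {i : C} (hi : i ^ 2 = -1) {a b c d : R}
    (h : algebraMap R C a + algebraMap R C b * i = algebraMap R C c + algebraMap R C d * i) :
    a = c ∧ b = d := by
  have h1 : algebraMap R C (a - c) = algebraMap R C (d - b) * i := by
    simp only [map_sub]; linear_combination h
  have h2 : algebraMap R C ((a - c) ^ 2 + (d - b) ^ 2) = 0 := by
    simp only [map_add, map_pow, h1]
    linear_combination (algebraMap R C (d - b)) ^ 2 * hi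
  have h3 := (map_eq_zero_iff _ (algebraMap R C).injective).1 h2
  constructor <;> nlinarith [sq_nonneg (a - c), sq_nonneg (d - b)]

theorem IsRealClosed.nonempty_complexCoordinates [IsRealClosed R]
    [Algebra.IsAlgebraic R C] [IsAlgClosed C] : Nonempty (ComplexCoordinates R C) := by
  obtain ⟨i, hi⟩ := IsAlgClosed.exists_pow_nat_eq (-1 : C) two_pos
  choose re im h using fun z : C => IsRealClosed.exists_eq_add_mul_I (R := R) hi z
  have huniq : ∀ (z : C) (a b : R), z = algebraMap R C a + algebraMap R C b * i →
      re z = a ∧ im z = b := fun z a b hz => add_mul_I_injective hi ((h z).symm.trans hz)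
  have hadd : ∀ x y, re (x + y) = re x + re y ∧ im (x + y) = im x + im y := fun x y =>
    huniq _ _ _ (by conv_lhs => rw [h x, h y]
                    simp only [map_add]; ring)
  have hsmul : ∀ (a : R) x, re (a • x) = a * re x ∧ im (a • x) = a * im x := fun a x =>
    huniq _ _ _ (by conv_lhs => rw [h x]
                    simp only [map_mul, Algebra.smul_def]; ring)
  have hmul : ∀ x y, re (x * y) = re x * re y - im x * im y ∧
      im (x * y) = re x * im y + im x * re y := fun x y =>
    huniq _ _ _ (by
      conv_lhs => rw [h x, h y]
      simp only [map_mul, map_add, map_sub]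
      linear_combination (algebraMap R C (im x)) * (algebraMap R C (im y)) * hi)
  have halg : ∀ a, re (algebraMap R C a) = a ∧ im (algebraMap R C a) = 0 := fun a =>
    huniq _ _ _ (by simp)
  exact ⟨{
    i := i
    re :=
      { toFun := re
        map_add' := fun x y => (hadd x y).1
        map_smul' := fun a x => (hsmul a x).1 }
    im :=
      { toFun := im
        map_add' := fun x y => (hadd x y).2
        map_smul' := fun a x => (hsmul a x).2 }
    conj :=
      { toFun := fun z => algebraMap R C (re z) - algebraMap R C (im z) * i
        map_one' := by
          have := halg 1
          rw [map_one] at this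
          simp [this.1, this.2]
        map_zero' := by
          have := halg 0
          rw [map_zero] at this
          simp [this.1, this.2]
        map_add' := fun x y => by simp only [(hadd x y).1, (hadd x y).2, map_add]; ring
        map_mul' := fun x y => by
          simp only [(hmul x y).1, (hmul x y).2, map_add, map_sub, map_mul]
          linear_combination (-(algebraMap R C (im x)) * (algebraMap R C (im y))) * hi
        commutes' := fun a => by simp [(halg a).1, (halg a).2] }
    i_sq := hi
    eq_re_add_im := h
    conj_eq := fun z => rfl }⟩

namespace ComplexCoordinates

variable (κ : ComplexCoordinates R C)

theorem re_im_eq {z : C} {a b : R} (h : z = algebraMap R C a + algebraMap R C b * κ.i) :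
    κ.re z = a ∧ κ.im z = b :=
  add_mul_I_injective κ.i_sq ((κ.eq_re_add_im z).symm.trans h)

theorem re_mul_im_mul (x y : C) : κ.re (x * y) = κ.re x * κ.re y - κ.im x * κ.im y ∧
    κ.im (x * y) = κ.re x * κ.im y + κ.im x * κ.re y :=
  κ.re_im_eq (by
    conv_lhs => rw [κ.eq_re_add_im x, κ.eq_re_add_im y]
    simp only [map_mul, map_add, map_sub]
    linear_combination (algebraMap R C (κ.im x)) * (algebraMap R C (κ.im y)) * κ.i_sq)

@[simp] theorem re_algebraMap (a : R) : κ.re (algebraMap R C a) = a :=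
  (κ.re_im_eq (a := a) (b := 0) (by simp)).1

@[simp] theorem im_algebraMap (a : R) : κ.im (algebraMap R C a) = 0 :=
  (κ.re_im_eq (a := a) (b := 0) (by simp)).2

@[simp] theorem re_conj (z : C) : κ.re (κ.conj z) = κ.re z :=
  (κ.re_im_eq (b := - κ.im z) (by rw [κ.conj_eq, map_neg]; ring)).1

@[simp] theorem im_conj (z : C) : κ.im (κ.conj z) = - κ.im z :=
  (κ.re_im_eq (a := κ.re z) (by rw [κ.conj_eq, map_neg]; ring)).2

@[simp] theorem conj_conj (z : C) : κ.conj (κ.conj z) = z :=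
  κ.ext_re_im (by simp) (by simp)

theorem eq_algebraMap_of_im_eq_zero {z : C} (h : κ.im z = 0) : z = algebraMap R C (κ.re z) :=
  κ.ext_re_im (by simp) (by simp [h])

end ComplexCoordinates

end ComplexCoordinates

/-! ### The intermediate value theorem for polynomials -/

section IntermediateValue

open Polynomial

variable {R : Type*} [Field R] [LinearOrder R] [IsStrictOrderedRing R] [IsRealClosed R]

/-- Irreducible polynomials over a real closed field are linear or positive definite quadratic. -/
theorem IsRealClosed.irreducible_cases {p : R[X]} (hp : Irreducible p) :
    ∃ u : R, u ≠ 0 ∧ ((∃ c, p = C u * (X - C c)) ∨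
      ∃ a b, b ≠ 0 ∧ p = C u * ((X - C a) ^ 2 + C (b ^ 2))) := by
  obtain ⟨κ⟩ := IsRealClosed.nonempty_complexCoordinates (R := R) (C := AlgebraicClosure R)
  obtain ⟨z, hz⟩ := IsAlgClosed.exists_aeval_eq_zero (AlgebraicClosure R) p
    (degree_pos_of_irreducible hp).ne'
  have key : ∀ q : R[X], ¬ IsUnit q → q ∣ p → ∃ u : R, u ≠ 0 ∧ p = C u * q := by
    rintro q hq ⟨r, hr⟩
    obtain ⟨u, hu, rfl⟩ := isUnit_iff.1 ((hp.isUnit_or_isUnit hr).resolve_left hq)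
    exact ⟨u, hu.ne_zero, by rw [hr, mul_comm]⟩
  by_cases him : κ.im z = 0
  · rw [κ.eq_algebraMap_of_im_eq_zero him, aeval_algebraMap_apply,
      map_eq_zero_iff _ (algebraMap R _).injective] at hz
    obtain ⟨u, hu, h⟩ := key (X - C (κ.re z)) (not_isUnit_X_sub_C _) (dvd_iff_isRoot.2 hz)
    exact ⟨u, hu, Or.inl ⟨_, h⟩⟩
  · set q : R[X] := (X - C (κ.re z)) ^ 2 + C (κ.im z ^ 2) with hq
    have hqz : aeval z q = 0 := by
      have h1 : z - algebraMap R _ (κ.re z) = algebraMap R _ (κ.im z) * κ.i := by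
        linear_combination κ.eq_re_add_im z
      simp only [hq, map_add, map_pow, map_sub, aeval_X, aeval_C, h1]
      linear_combination (algebraMap R (AlgebraicClosure R) (κ.im z)) ^ 2 * κ.i_sq
    have hqm : q.natDegree = 2 := by rw [hq]; compute_degree!
    have hqd : q.degree = 2 := (degree_eq_iff_natDegree_eq_of_pos two_pos).2 hqm
    have hqirr : Irreducible q := by
      rw [irreducible_iff_roots_eq_zero_of_degree_le_three (by omega) (by omega)]
      refine Multiset.eq_zero_of_forall_notMem fun x hx => ?_
      have := isRoot_of_mem_roots hx
      simp only [hq, IsRoot, eval_add, eval_pow, eval_sub, eval_X, eval_C] at this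
      have := sq_nonneg (x - κ.re z)
      have := sq_pos_of_ne_zero him
      linarith
    -- two irreducible polynomials with a common root are associated
    have hdvd : q ∣ p := by
      by_contra hnd
      obtain ⟨a, b, hab⟩ := (hqirr.coprime_iff_not_dvd).2 hnd
      have := congrArg (aeval z) hab
      simp [hqz, hz] at this
    obtain ⟨u, hu, h⟩ := key q hqirr.not_isUnit hdvd
    exact ⟨u, hu, Or.inr ⟨_, _, him, h⟩⟩

theorem IsRealClosed.eval_mul_eval_pos (p : R[X]) {a b : R} (hab : a ≤ b) :
    (∀ x ∈ Set.Icc a b, p.eval x ≠ 0) → 0 < p.eval a * p.eval b := by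
  induction p using WfDvdMonoid.induction_on_irreducible with
  | zero => intro h; exact absurd (eval_zero) (h a ⟨le_rfl, hab⟩)
  | unit u hu =>
    obtain ⟨r, hr, rfl⟩ := isUnit_iff.1 hu
    intro _
    simpa using mul_self_pos.2 hr.ne_zero
  | mul q p _ hp ih =>
    intro h
    have hq := ih (fun x hx h0 => h x hx (by rw [eval_mul, h0, mul_zero]))
    suffices 0 < p.eval a * p.eval b by
      rw [eval_mul, eval_mul]
      nlinarith
    have hp0 : ∀ x ∈ Set.Icc a b, p.eval x ≠ 0 := fun x hx h0 =>
      h x hx (by rw [eval_mul, h0, zero_mul])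
    obtain ⟨u, hu, ⟨c, rfl⟩ | ⟨c, d, hd, rfl⟩⟩ := IsRealClosed.irreducible_cases hp
    · have hc : ¬ (a ≤ c ∧ c ≤ b) := fun h => hp0 c h (by simp)
      have h1 : 0 < (a - c) * (b - c) := by
        rcases lt_or_ge c a with h | h
        · exact mul_pos (by linarith) (by linarith)
        · have : b < c := not_le.1 fun h' => hc ⟨h, h'⟩
          exact mul_pos_of_neg_of_neg (by linarith) (by linarith)
      have h2 : 0 < u * u := mul_self_pos.2 hu
      have := mul_pos h2 h1
      simp only [eval_mul, eval_C, eval_sub, eval_X]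
      linarith
    · have h2 : 0 < u * u := mul_self_pos.2 hu
      have hd2 := sq_pos_of_ne_zero hd
      have := mul_pos h2 (mul_pos (add_pos_of_nonneg_of_pos (sq_nonneg (a - c)) hd2)
        (add_pos_of_nonneg_of_pos (sq_nonneg (b - c)) hd2))
      simp only [eval_mul, eval_C, eval_sub, eval_X, eval_add, eval_pow]
      linarith

/-- The intermediate value theorem for polynomials over a real closed field. -/
theorem IsRealClosed.exists_root_of_eval_mul_eval_neg (p : R[X]) {a b : R} (hab : a < b)
    (h : p.eval a * p.eval b < 0) : ∃ x ∈ Set.Ioo a b, p.eval x = 0 := by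
  by_contra! hne
  refine absurd (IsRealClosed.eval_mul_eval_pos p hab.le fun x hx h0 => ?_) (not_lt.2 h.le)
  rcases eq_or_lt_of_le hx.1 with rfl | h1
  · simp [h0] at h
  rcases eq_or_lt_of_le hx.2 with rfl | h2
  · simp [h0] at h
  exact hne x ⟨h1, h2⟩ h0

/-- A polynomial without roots is a product of positive definite quadratic ones, so it is bounded
away from zero, even without compactness. -/
theorem IsRealClosed.exists_pos_le_abs_eval (p : R[X]) :
    (∀ x, p.eval x ≠ 0) → ∃ γ > 0, ∀ x, γ ≤ |p.eval x| := by
  induction p using WfDvdMonoid.induction_on_irreducible with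
  | zero => intro h; exact absurd (eval_zero) (h 0)
  | unit u hu =>
    obtain ⟨r, hr, rfl⟩ := isUnit_iff.1 hu
    intro _
    exact ⟨|r|, abs_pos.2 hr.ne_zero, fun x => by simp⟩
  | mul q p _ hp ih =>
    intro h
    obtain ⟨γ, hγ, hq⟩ := ih (fun x h0 => h x (by rw [eval_mul, h0, mul_zero]))
    have hp0 : ∀ x, p.eval x ≠ 0 := fun x h0 => h x (by rw [eval_mul, h0, zero_mul])
    obtain ⟨u, hu, ⟨c, rfl⟩ | ⟨c, d, hd, rfl⟩⟩ := IsRealClosed.irreducible_cases hp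
    · exact absurd (by simp) (hp0 c)
    · have hd2 := sq_pos_of_ne_zero hd
      refine ⟨|u| * d ^ 2 * γ, mul_pos (mul_pos (abs_pos.2 hu) hd2) hγ, fun x => ?_⟩
      rw [eval_mul, abs_mul]
      refine mul_le_mul ?_ (hq x) hγ.le (abs_nonneg _)
      simp only [eval_mul, eval_C, eval_sub, eval_X, eval_add, eval_pow, abs_mul]
      refine mul_le_mul_of_nonneg_left ?_ (abs_nonneg _)
      rw [abs_of_nonneg (by positivity)]
      linarith [sq_nonneg (x - c)]

end IntermediateValue

/-! ### Semi-algebraic sets -/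

section Semialgebraic

variable {R ι κ : Type*} [Field R] [LinearOrder R]

theorem IsBasicSemialgebraic.isSemialgebraic {S : Set (ι → R)} (h : IsBasicSemialgebraic S) :
    IsSemialgebraic S :=
  ⟨{S}, Set.finite_singleton S, by simpa using h, by simp⟩

theorem isSemialgebraic_empty : IsSemialgebraic (∅ : Set (ι → R)) :=
  ⟨∅, Set.finite_empty, by simp, by simp⟩

theorem isSemialgebraic_univ : IsSemialgebraic (Set.univ : Set (ι → R)) :=
  IsBasicSemialgebraic.isSemialgebraic ⟨∅, ∅, by ext; simp⟩

theorem isSemialgebraic_eval_eq_zero (f : MvPolynomial ι R) :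
    IsSemialgebraic {x : ι → R | MvPolynomial.eval x f = 0} :=
  IsBasicSemialgebraic.isSemialgebraic ⟨{f}, ∅, by ext; simp⟩

theorem isSemialgebraic_eval_pos (f : MvPolynomial ι R) :
    IsSemialgebraic {x : ι → R | 0 < MvPolynomial.eval x f} :=
  IsBasicSemialgebraic.isSemialgebraic ⟨∅, {f}, by ext; simp⟩

theorem IsSemialgebraic.union {S T : Set (ι → R)} (hS : IsSemialgebraic S)
    (hT : IsSemialgebraic T) : IsSemialgebraic (S ∪ T) := by
  obtain ⟨𝒮, h1, h2, rfl⟩ := hS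
  obtain ⟨𝒯, h3, h4, rfl⟩ := hT
  refine ⟨𝒮 ∪ 𝒯, h1.union h3, ?_, by rw [Set.sUnion_union]⟩
  rintro U (hU | hU)
  exacts [h2 U hU, h4 U hU]

theorem IsBasicSemialgebraic.inter {S T : Set (ι → R)} (hS : IsBasicSemialgebraic S)
    (hT : IsBasicSemialgebraic T) : IsBasicSemialgebraic (S ∩ T) := by
  classical
  obtain ⟨F, H, rfl⟩ := hS
  obtain ⟨F', H', rfl⟩ := hT
  refine ⟨F ∪ F', H ∪ H', ?_⟩
  ext x
  simp only [Set.mem_inter_iff, Set.mem_ofPred_eq, Finset.mem_union, or_imp, forall_and]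
  tauto

theorem IsSemialgebraic.inter {S T : Set (ι → R)} (hS : IsSemialgebraic S)
    (hT : IsSemialgebraic T) : IsSemialgebraic (S ∩ T) := by
  obtain ⟨𝒮, h1, h2, rfl⟩ := hS
  obtain ⟨𝒯, h3, h4, rfl⟩ := hT
  refine ⟨Set.image2 (· ∩ ·) 𝒮 𝒯, h1.image2 _ h3, ?_, ?_⟩
  · rintro _ ⟨U, hU, V, hV, rfl⟩
    exact (h2 U hU).inter (h4 V hV)
  · ext x
    simp only [Set.mem_inter_iff, Set.mem_sUnion, Set.mem_image2]
    constructor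
    · rintro ⟨⟨U, hU, hx⟩, V, hV, hx'⟩
      exact ⟨_, ⟨U, hU, V, hV, rfl⟩, hx, hx'⟩
    · rintro ⟨_, ⟨U, hU, V, hV, rfl⟩, hx, hx'⟩
      exact ⟨⟨U, hU, hx⟩, V, hV, hx'⟩

theorem isSemialgebraic_biUnion {α : Type*} {s : Set α} (hs : s.Finite) {f : α → Set (ι → R)}
    (h : ∀ a ∈ s, IsSemialgebraic (f a)) : IsSemialgebraic (⋃ a ∈ s, f a) := by
  induction s, hs using Set.Finite.induction_on with
  | empty => simpa using isSemialgebraic_empty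
  | insert _ _ ih =>
    rw [Set.biUnion_insert]
    exact (h _ (Set.mem_insert _ _)).union (ih fun a ha => h a (Set.mem_insert_of_mem _ ha))

theorem isSemialgebraic_biInter {α : Type*} {s : Set α} (hs : s.Finite) {f : α → Set (ι → R)}
    (h : ∀ a ∈ s, IsSemialgebraic (f a)) : IsSemialgebraic (⋂ a ∈ s, f a) := by
  induction s, hs using Set.Finite.induction_on with
  | empty => simpa using isSemialgebraic_univ
  | insert _ _ ih =>
    rw [Set.biInter_insert]
    exact (h _ (Set.mem_insert _ _)).inter (ih fun a ha => h a (Set.mem_insert_of_mem _ ha))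

theorem IsSemialgebraic.preimage {S : Set (κ → R)} (hS : IsSemialgebraic S)
    (g : κ → MvPolynomial ι R) :
    IsSemialgebraic {x : ι → R | (fun j => MvPolynomial.eval x (g j)) ∈ S} := by
  classical
  obtain ⟨𝒮, h1, h2, rfl⟩ := hS
  have : {x : ι → R | (fun j => MvPolynomial.eval x (g j)) ∈ ⋃₀ 𝒮} =
      ⋃ U ∈ 𝒮, {x : ι → R | (fun j => MvPolynomial.eval x (g j)) ∈ U} := by
    ext x; simp
  rw [this]
  refine isSemialgebraic_biUnion h1 fun U hU => ?_
  obtain ⟨F, H, rfl⟩ := h2 U hU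
  refine IsBasicSemialgebraic.isSemialgebraic
    ⟨F.image (MvPolynomial.bind₁ g), H.image (MvPolynomial.bind₁ g), ?_⟩
  have key : ∀ (x : ι → R) (f : MvPolynomial κ R), MvPolynomial.eval x (MvPolynomial.bind₁ g f) =
      MvPolynomial.eval (fun j => MvPolynomial.eval x (g j)) f := fun x f => by
    exact MvPolynomial.aeval_bind₁ x g f
  ext x
  simp [key]

variable [IsStrictOrderedRing R]

theorem IsSemialgebraic.compl {S : Set (ι → R)} (hS : IsSemialgebraic S) :
    IsSemialgebraic Sᶜ := by
  obtain ⟨𝒮, h1, h2, rfl⟩ := hS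
  rw [Set.compl_sUnion, Set.sInter_image]
  refine isSemialgebraic_biInter h1 fun U hU => ?_
  obtain ⟨F, H, rfl⟩ := h2 U hU
  have : {x : ι → R | (∀ f ∈ F, MvPolynomial.eval x f = 0) ∧
        ∀ h ∈ H, 0 < MvPolynomial.eval x h}ᶜ =
      (⋃ f ∈ (F : Set (MvPolynomial ι R)), ({x | 0 < MvPolynomial.eval x f} ∪
        {x | 0 < MvPolynomial.eval x (-f)})) ∪
      (⋃ h ∈ (H : Set (MvPolynomial ι R)), ({x | MvPolynomial.eval x h = 0} ∪
        {x | 0 < MvPolynomial.eval x (-h)})) := by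
    ext x
    simp only [Set.mem_compl_iff, Set.mem_ofPred_eq, Set.mem_union, Set.mem_iUnion, map_neg,
      neg_pos, Finset.mem_coe, not_and_or, not_forall, not_lt, exists_prop]
    refine or_congr ?_ ?_
    · exact exists_congr fun f => and_congr_right fun _ => by rw [or_comm]; exact ne_iff_lt_or_gt
    · exact exists_congr fun f => and_congr_right fun _ => by rw [le_iff_eq_or_lt]
  rw [this]
  exact (isSemialgebraic_biUnion F.finite_toSet fun f _ =>
      (isSemialgebraic_eval_pos f).union (isSemialgebraic_eval_pos (-f))).union
    (isSemialgebraic_biUnion H.finite_toSet fun f _ =>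
      (isSemialgebraic_eval_eq_zero f).union (isSemialgebraic_eval_pos (-f)))

theorem IsSemialgebraic.diff {S T : Set (ι → R)} (hS : IsSemialgebraic S)
    (hT : IsSemialgebraic T) : IsSemialgebraic (S \ T) :=
  hS.inter hT.compl

end Semialgebraic

/-! ### Functions regular on a set -/

section Regular

variable {R ι κ : Type*} [Field R]

/-- A function on `R ^ ι` is regular on `S` if it is a quotient of two polynomials whose
denominator vanishes nowhere on `S`. -/
def IsRegularOn (S : Set (ι → R)) (f : (ι → R) → R) : Prop :=
  ∃ N D : MvPolynomial ι R, ∀ a ∈ S, MvPolynomial.eval a D ≠ 0 ∧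
    f a = MvPolynomial.eval a N / MvPolynomial.eval a D

namespace IsRegularOn

variable {S T : Set (ι → R)} {f g : (ι → R) → R}

theorem mono (hf : IsRegularOn S f) (h : T ⊆ S) : IsRegularOn T f := by
  obtain ⟨N, D, hD⟩ := hf
  exact ⟨N, D, fun a ha => hD a (h ha)⟩

theorem congr (hf : IsRegularOn S f) (h : ∀ a ∈ S, f a = g a) : IsRegularOn S g := by
  obtain ⟨N, D, hD⟩ := hf
  exact ⟨N, D, fun a ha => ⟨(hD a ha).1, (h a ha) ▸ (hD a ha).2⟩⟩

theorem eval (p : MvPolynomial ι R) : IsRegularOn S fun a => MvPolynomial.eval a p :=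
  ⟨p, 1, fun a _ => by simp⟩

theorem const (c : R) : IsRegularOn S fun _ => c := by
  simpa using eval (S := S) (MvPolynomial.C c)

theorem add (hf : IsRegularOn S f) (hg : IsRegularOn S g) :
    IsRegularOn S fun a => f a + g a := by
  obtain ⟨N, D, hD⟩ := hf
  obtain ⟨N', D', hD'⟩ := hg
  refine ⟨N * D' + D * N', D * D', fun a ha => ?_⟩
  obtain ⟨h1, h2⟩ := hD a ha
  obtain ⟨h3, h4⟩ := hD' a ha
  refine ⟨by simp [h1, h3], ?_⟩
  simp only [h2, h4, div_add_div _ _ h1 h3, map_add, map_mul]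

theorem mul (hf : IsRegularOn S f) (hg : IsRegularOn S g) :
    IsRegularOn S fun a => f a * g a := by
  obtain ⟨N, D, hD⟩ := hf
  obtain ⟨N', D', hD'⟩ := hg
  refine ⟨N * N', D * D', fun a ha => ?_⟩
  obtain ⟨h1, h2⟩ := hD a ha
  obtain ⟨h3, h4⟩ := hD' a ha
  refine ⟨by simp [h1, h3], ?_⟩
  simp only [h2, h4, div_mul_div_comm, map_mul]

theorem neg (hf : IsRegularOn S f) : IsRegularOn S fun a => - f a := by
  simpa using (const (-1)).mul hf

theorem sub (hf : IsRegularOn S f) (hg : IsRegularOn S g) :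
    IsRegularOn S fun a => f a - g a := by
  simpa [sub_eq_add_neg] using hf.add hg.neg

theorem inv (hf : IsRegularOn S f) (h : ∀ a ∈ S, f a ≠ 0) : IsRegularOn S fun a => (f a)⁻¹ := by
  obtain ⟨N, D, hD⟩ := hf
  refine ⟨D, N, fun a ha => ?_⟩
  obtain ⟨h1, h2⟩ := hD a ha
  refine ⟨fun h0 => h a ha (by rw [h2, h0, zero_div]), by simp only [h2, inv_div]⟩

theorem div (hf : IsRegularOn S f) (hg : IsRegularOn S g) (h : ∀ a ∈ S, g a ≠ 0) :
    IsRegularOn S fun a => f a / g a := by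
  simpa [div_eq_mul_inv] using hf.mul (hg.inv h)

theorem sum {α : Type*} (s : Finset α) {f : α → (ι → R) → R} (h : ∀ i ∈ s, IsRegularOn S (f i)) :
    IsRegularOn S fun a => ∑ i ∈ s, f i a := by
  classical
  induction s using Finset.induction_on with
  | empty => simpa using const 0
  | insert i s hi ih =>
    simp only [Finset.sum_insert hi]
    exact (h i (Finset.mem_insert_self _ _)).add (ih fun j hj => h j (Finset.mem_insert_of_mem hj))

theorem prod {α : Type*} (s : Finset α) {f : α → (ι → R) → R} (h : ∀ i ∈ s, IsRegularOn S (f i)) :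
    IsRegularOn S fun a => ∏ i ∈ s, f i a := by
  classical
  induction s using Finset.induction_on with
  | empty => simpa using const 1
  | insert i s hi ih =>
    simp only [Finset.prod_insert hi]
    exact (h i (Finset.mem_insert_self _ _)).mul (ih fun j hj => h j (Finset.mem_insert_of_mem hj))

theorem pow (hf : IsRegularOn S f) (k : ℕ) : IsRegularOn S fun a => f a ^ k := by
  simpa using prod (Finset.range k) (f := fun _ => f) fun _ _ => hf

theorem eval_comp (p : MvPolynomial κ R) {g : κ → (ι → R) → R} (hg : ∀ j, IsRegularOn S (g j)) :
    IsRegularOn S fun a => MvPolynomial.eval (fun j => g j a) p := by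
  induction p using MvPolynomial.induction_on with
  | C c => simpa using const c
  | add p q hp hq => simpa using hp.add hq
  | mul_X p j hp => simpa using hp.mul (hg j)

theorem comp {T : Set (κ → R)} {f : (κ → R) → R} (hf : IsRegularOn T f)
    {g : κ → MvPolynomial ι R} (hg : ∀ a ∈ S, (fun j => MvPolynomial.eval a (g j)) ∈ T) :
    IsRegularOn S fun a => f fun j => MvPolynomial.eval a (g j) := by
  obtain ⟨N, D, hD⟩ := hf
  have hN := eval_comp (S := S) N fun j => eval (g j)
  have hD' := eval_comp (S := S) D fun j => eval (g j)
  exact (hN.div hD' fun a ha => (hD _ (hg a ha)).1).congr fun a ha => (hD _ (hg a ha)).2.symm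

theorem det {m : Type*} [Fintype m] [DecidableEq m] {M : (ι → R) → Matrix m m R}
    (h : ∀ i j, IsRegularOn S fun a => M a i j) : IsRegularOn S fun a => (M a).det := by
  simp only [Matrix.det_apply']
  exact sum _ fun σ _ => (const _).mul (prod _ fun i _ => h _ _)

theorem inv_apply {m : Type*} [Fintype m] [DecidableEq m] {M : (ι → R) → Matrix m m R}
    (h : ∀ i j, IsRegularOn S fun a => M a i j) (h0 : ∀ a ∈ S, (M a).det ≠ 0) (i j : m) :
    IsRegularOn S fun a => (M a)⁻¹ i j := by
  have hadj : IsRegularOn S fun a => (M a).adjugate i j := by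
    simp only [Matrix.adjugate_apply]
    refine det fun k l => ?_
    by_cases hk : k = j
    · subst hk
      simpa using const _
    · simpa [Matrix.updateRow_ne hk] using h k l
  refine (hadj.div (det h) h0).congr fun a ha => ?_
  rw [Matrix.inv_def, Matrix.smul_apply, Ring.inverse_eq_inv', smul_eq_mul, div_eq_inv_mul]

variable [LinearOrder R] [IsStrictOrderedRing R]

theorem isSemialgebraic_pos (hf : IsRegularOn S f) (hS : IsSemialgebraic S) :
    IsSemialgebraic {a ∈ S | 0 < f a} := by
  obtain ⟨N, D, hD⟩ := hf
  have : {a ∈ S | 0 < f a} = S ∩ {a | 0 < MvPolynomial.eval a (N * D)} := by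
    ext a
    simp only [Set.mem_ofPred_eq, Set.mem_inter_iff, map_mul]
    refine and_congr_right fun ha => ?_
    rw [(hD a ha).2, div_pos_iff, mul_pos_iff]
  rw [this]
  exact hS.inter (isSemialgebraic_eval_pos _)

theorem isSemialgebraic_eq_zero (hf : IsRegularOn S f) (hS : IsSemialgebraic S) :
    IsSemialgebraic {a ∈ S | f a = 0} := by
  have : {a ∈ S | f a = 0} = (S \ {a ∈ S | 0 < f a}) \ {a ∈ S | 0 < - f a} := by
    ext a
    simp only [Set.mem_ofPred_eq, Set.mem_sdiff, neg_pos, not_and, not_lt]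
    constructor
    · rintro ⟨h1, h2⟩; exact ⟨⟨h1, fun _ => h2.le⟩, fun _ => h2.ge⟩
    · rintro ⟨⟨h1, h2⟩, h3⟩; exact ⟨h1, le_antisymm (h2 h1) (h3 h1)⟩
  rw [this]
  exact (hS.diff (hf.isSemialgebraic_pos hS)).diff (hf.neg.isSemialgebraic_pos hS)

end IsRegularOn

end Regular

/-! ### The positive index of inertia -/

section PosIndex

variable {R : Type*} [Field R] [LinearOrder R]

/-- The symmetric bilinear form `B` has positive index of inertia `p`: it is positive definite on a
subspace of dimension at least `p`, and negative semidefinite on one of codimension at most `p`. -/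
def HasPosIndex {E : Type*} [AddCommGroup E] [Module R E] (B : LinearMap.BilinForm R E) (p : ℕ) :
    Prop :=
  ∃ V W : Submodule R E, p ≤ Module.finrank R V ∧
    Module.finrank R E ≤ Module.finrank R W + p ∧
    (∀ x ∈ V, x ≠ 0 → 0 < B x x) ∧ ∀ x ∈ W, B x x ≤ 0

variable {E : Type*} [AddCommGroup E] [Module R E]

theorem hasPosIndex_zero : HasPosIndex (0 : LinearMap.BilinForm R E) 0 :=
  ⟨⊥, ⊤, by simp, by simp, by simp, by simp⟩

variable [FiniteDimensional R E]

theorem HasPosIndex.le {B : LinearMap.BilinForm R E} {p p' : ℕ} (h : HasPosIndex B p)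
    (h' : HasPosIndex B p') : p ≤ p' := by
  obtain ⟨V, -, hV, -, hVpos, -⟩ := h
  obtain ⟨-, W, -, hW, -, hWneg⟩ := h'
  have hd : Disjoint V W := by
    rw [Submodule.disjoint_def]
    intro x hx hx'
    by_contra h0
    exact absurd (hVpos x hx h0) (not_lt.2 (hWneg x hx'))
  have := Submodule.finrank_add_finrank_le_of_disjoint hd
  omega

/-- Sylvester's law of inertia. -/
theorem HasPosIndex.unique {B : LinearMap.BilinForm R E} {p p' : ℕ} (h : HasPosIndex B p)
    (h' : HasPosIndex B p') : p = p' :=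
  le_antisymm (h.le h') (h'.le h)

variable [IsStrictOrderedRing R] {E' : Type*} [AddCommGroup E'] [Module R E']
  [FiniteDimensional R E']

omit [LinearOrder R] [IsStrictOrderedRing R] in
theorem finrank_submodule_prod (V : Submodule R E) (W : Submodule R E') :
    Module.finrank R (V.prod W) = Module.finrank R V + Module.finrank R W := by
  have h : V.prod W = LinearMap.range (V.subtype.prodMap W.subtype) := by
    rw [LinearMap.range_prodMap, Submodule.range_subtype, Submodule.range_subtype]
  rw [h, LinearMap.finrank_range_of_inj, Module.finrank_prod]
  exact Prod.map_injective.2 ⟨V.subtype_injective, W.subtype_injective⟩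

omit [FiniteDimensional R E] in
/-- Splitting off a nonisotropic vector changes the positive index by zero or one. -/
theorem HasPosIndex.of_orthogonal {B : LinearMap.BilinForm R E} (hB : B.IsSymm) {v : E}
    (hv : B v v ≠ 0) {L : E' →ₗ[R] E} (hL : Function.Injective L) (hvL : ∀ x, B v (L x) = 0)
    (hdim : Module.finrank R E = Module.finrank R E' + 1) {p : ℕ}
    (h : HasPosIndex (B.compl₁₂ L L) p) :
    HasPosIndex B (if 0 < B v v then p + 1 else p) := by
  obtain ⟨V, W, hV, hW, hVpos, hWneg⟩ := h
  let φ : R × E' →ₗ[R] E := (LinearMap.toSpanSingleton R E v).coprod L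
  have hφ : ∀ t x, φ (t, x) = t • v + L x := fun t x => by simp [φ]
  have hLv : ∀ x, B (L x) v = 0 := fun x => by rw [hB.eq]; exact hvL x
  have hBφ : ∀ t x, B (φ (t, x)) (φ (t, x)) = t * t * B v v + B (L x) (L x) := fun t x => by
    rw [hφ]
    simp only [map_add, map_smul, LinearMap.add_apply, LinearMap.smul_apply, smul_eq_mul, hvL, hLv]
    ring
  have hinj : Function.Injective φ := by
    rw [injective_iff_map_eq_zero]
    rintro ⟨t, x⟩ h0
    rw [hφ] at h0
    have h1 : B v (t • v + L x) = 0 := by rw [h0, map_zero]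
    rw [map_add, map_smul, hvL, add_zero, smul_eq_mul] at h1
    have ht := (mul_eq_zero.1 h1).resolve_right hv
    rw [ht, zero_smul, zero_add] at h0
    rw [ht, hL (h0.trans (map_zero L).symm)]
    rfl
  have hfr : ∀ U : Submodule R (R × E'), Module.finrank R (U.map φ) = Module.finrank R U :=
    fun U => (Submodule.equivMapOfInjective φ hinj U).finrank_eq.symm
  split_ifs with hpos
  · refine ⟨((⊤ : Submodule R R).prod V).map φ, ((⊥ : Submodule R R).prod W).map φ, ?_, ?_, ?_, ?_⟩
    · rw [hfr, finrank_submodule_prod, finrank_top, Module.finrank_self]; omega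
    · rw [hfr, finrank_submodule_prod, finrank_bot]; omega
    · rintro _ ⟨⟨t, x⟩, ⟨-, hx⟩, rfl⟩ h0
      rw [hBφ]
      by_cases hx0 : x = 0
      · have ht : t ≠ 0 := by rintro rfl; apply h0; rw [hx0]; exact map_zero φ
        have := mul_pos (mul_self_pos.2 ht) hpos
        simpa [hx0] using this
      · have := hVpos x hx hx0
        have h2 := mul_nonneg (mul_self_nonneg t) hpos.le
        simp only [LinearMap.compl₁₂_apply] at this
        linarith
    · rintro _ ⟨⟨t, x⟩, ⟨ht, hx⟩, rfl⟩
      have := hWneg x hx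
      obtain rfl : t = 0 := ht
      rw [hBφ]
      simpa using this
  · have hneg := lt_of_le_of_ne (not_lt.1 hpos) hv
    refine ⟨((⊥ : Submodule R R).prod V).map φ, ((⊤ : Submodule R R).prod W).map φ, ?_, ?_, ?_, ?_⟩
    · rw [hfr, finrank_submodule_prod, finrank_bot]; omega
    · rw [hfr, finrank_submodule_prod, finrank_top, Module.finrank_self]; omega
    · rintro _ ⟨⟨t, x⟩, ⟨ht, hx⟩, rfl⟩ h0
      obtain rfl : t = 0 := ht
      rw [hBφ]
      have hx0 : x ≠ 0 := by rintro rfl; exact h0 (map_zero φ)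
      simpa using hVpos x hx hx0
    · rintro _ ⟨⟨t, x⟩, ⟨-, hx⟩, rfl⟩
      have := hWneg x hx
      have h2 := mul_nonpos_of_nonneg_of_nonpos (mul_self_nonneg t) hneg.le
      rw [hBφ]
      simp only [LinearMap.compl₁₂_apply] at this
      linarith

end PosIndex

/-! ### Orthogonal complements with parameters -/

section OrthogonalParam

variable {R ι : Type*} [Field R]

/-- The map `x ↦ ∑ k, x k • (e k - (B (e k) v / B v v) • v)`, the sum being over the indices other
than `i`. If `v i ≠ 0`, it parametrizes the orthogonal complement of `v`. -/
def orthogonalParam {m : ℕ} (B : LinearMap.BilinForm R (Fin (m + 1) → R)) (v : Fin (m + 1) → R)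
    (i : Fin (m + 1)) : (Fin m → R) →ₗ[R] (Fin (m + 1) → R) :=
  Fintype.linearCombination R fun k =>
    Pi.single (i.succAbove k) 1 - (B v (Pi.single (i.succAbove k) 1) / B v v) • v

theorem orthogonalParam_single {m : ℕ} (B : LinearMap.BilinForm R (Fin (m + 1) → R))
    (v : Fin (m + 1) → R) (i : Fin (m + 1)) (k : Fin m) :
    orthogonalParam B v i (Pi.single k 1) =
      Pi.single (i.succAbove k) 1 - (B v (Pi.single (i.succAbove k) 1) / B v v) • v := by
  simp [orthogonalParam, Fintype.linearCombination_apply_single]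

theorem orthogonalParam_orthogonal {m : ℕ} (B : LinearMap.BilinForm R (Fin (m + 1) → R))
    {v : Fin (m + 1) → R} (hv : B v v ≠ 0) (i : Fin (m + 1)) (x : Fin m → R) :
    B v (orthogonalParam B v i x) = 0 := by
  simp only [orthogonalParam, Fintype.linearCombination_apply, map_sum, map_smul, map_sub]
  refine Finset.sum_eq_zero fun k _ => ?_
  rw [smul_eq_mul, smul_eq_mul, div_mul_cancel₀ _ hv, sub_self, mul_zero]

theorem orthogonalParam_injective {m : ℕ} (B : LinearMap.BilinForm R (Fin (m + 1) → R))
    {v : Fin (m + 1) → R} {i : Fin (m + 1)} (hi : v i ≠ 0) :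
    Function.Injective (orthogonalParam B v i) := by
  rw [injective_iff_map_eq_zero]
  intro x hx
  set s : R := ∑ k, x k * (B v (Pi.single (i.succAbove k) 1) / B v v)
  have key : ∀ j, orthogonalParam B v i x j =
      ∑ k, x k * (Pi.single (i.succAbove k) 1 : Fin (m + 1) → R) j - s * v j := by
    intro j
    simp only [orthogonalParam, Fintype.linearCombination_apply, Finset.sum_apply, Pi.smul_apply,
      Pi.sub_apply, smul_eq_mul, s, Finset.sum_mul, ← Finset.sum_sub_distrib]
    exact Finset.sum_congr rfl fun k _ => by ring
  have h1 := key i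
  have h2 : ∀ k, (Pi.single (i.succAbove k) 1 : Fin (m + 1) → R) i = 0 := fun k =>
    Pi.single_eq_of_ne (Fin.succAbove_ne i k).symm _
  simp only [hx, Pi.zero_apply, h2, mul_zero, Finset.sum_const_zero, zero_sub] at h1
  have hs : s = 0 := by
    rcases mul_eq_zero.1 (neg_eq_zero.1 h1.symm) with h | h
    exacts [h, absurd h hi]
  ext k
  have h3 := key (i.succAbove k)
  rw [hx, hs, zero_mul, sub_zero, Finset.sum_eq_single k, Pi.single_eq_same, mul_one] at h3
  · exact h3.symm
  · intro l _ hl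
    rw [Pi.single_eq_of_ne, mul_zero]
    exact fun h => hl (Fin.succAbove_right_injective h).symm
  · simp

theorem IsRegularOn.toBilin' {m : ℕ} {S : Set (ι → R)} {M : (ι → R) → Matrix (Fin m) (Fin m) R}
    (hM : ∀ i j, IsRegularOn S fun a => M a i j) {x y : (ι → R) → Fin m → R}
    (hx : ∀ i, IsRegularOn S fun a => x a i) (hy : ∀ i, IsRegularOn S fun a => y a i) :
    IsRegularOn S fun a => Matrix.toBilin' (M a) (x a) (y a) := by
  simp only [Matrix.toBilin'_apply]
  exact .sum _ fun i _ => .sum _ fun j _ => ((hx i).mul (hM i j)).mul (hy j)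

theorem isRegularOn_orthogonalParam {m : ℕ} {S : Set (ι → R)}
    {M : (ι → R) → Matrix (Fin (m + 1)) (Fin (m + 1)) R}
    (hM : ∀ i j, IsRegularOn S fun a => M a i j) {v : Fin (m + 1) → R}
    (hv : ∀ a ∈ S, Matrix.toBilin' (M a) v v ≠ 0) (i : Fin (m + 1)) (k : Fin m)
    (l : Fin (m + 1)) :
    IsRegularOn S fun a =>
      orthogonalParam (Matrix.toBilin' (M a)) v i (Pi.single k 1) l := by
  have h1 : ∀ x : Fin (m + 1) → R, IsRegularOn S fun a => Matrix.toBilin' (M a) v x := fun x =>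
    .toBilin' hM (x := fun _ => v) (y := fun _ => x) (fun i => .const (v i)) fun i => .const (x i)
  simp only [orthogonalParam_single, Pi.sub_apply, Pi.smul_apply, smul_eq_mul]
  exact (IsRegularOn.const _).sub (((h1 _).div (h1 v) hv).mul (.const (v l)))

end OrthogonalParam

/-! ### Semi-algebraicity of the positive index -/

section SemialgebraicPosIndex

variable {R ι : Type*} [Field R] [LinearOrder R]

/-- `S` is covered by semi-algebraic subsets on which the symmetric matrices `M a` have constant
positive index. -/
def HasSemialgebraicPosIndex {m : ℕ} (S : Set (ι → R))
    (M : (ι → R) → Matrix (Fin m) (Fin m) R) : Prop :=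
  ∃ T : ℕ → Set (ι → R), (∀ p, IsSemialgebraic (T p)) ∧ (∀ a ∈ S, ∃ p, a ∈ T p) ∧
    ∀ p, ∀ a ∈ T p, HasPosIndex (Matrix.toBilin' (M a)) p

theorem HasSemialgebraicPosIndex.of_cover {m : ℕ} {S : Set (ι → R)}
    {M : (ι → R) → Matrix (Fin m) (Fin m) R} {α : Type*} [Finite α] {U : α → Set (ι → R)}
    (hU : S ⊆ ⋃ i, U i) (h : ∀ i, HasSemialgebraicPosIndex (U i) M) :
    HasSemialgebraicPosIndex S M := by
  choose T h1 h2 h3 using h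
  refine ⟨fun p => ⋃ i ∈ (Set.univ : Set α), T i p,
    fun p => isSemialgebraic_biUnion Set.finite_univ fun i _ => h1 i p, fun a ha => ?_,
    fun p a ha => ?_⟩
  · obtain ⟨i, hi⟩ := Set.mem_iUnion.1 (hU ha)
    obtain ⟨p, hp⟩ := h2 i a hi
    exact ⟨p, Set.mem_biUnion (Set.mem_univ i) hp⟩
  · simp only [Set.mem_univ, Set.iUnion_true, Set.mem_iUnion] at ha
    obtain ⟨i, hi⟩ := ha
    exact h3 i p a hi

variable [IsStrictOrderedRing R]

/-- The vectors `e i` and `e i + e j`: if a quadratic form vanishes on all of them, it is zero. -/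
def testVector (R : Type*) [Field R] {m : ℕ} (i j : Fin m) : Fin m → R :=
  Pi.single i 1 + if i = j then 0 else Pi.single j 1

theorem eq_zero_of_testVector {m : ℕ} {M : Matrix (Fin m) (Fin m) R} (hM : M.IsSymm)
    (h : ∀ i j, Matrix.toBilin' M (testVector R i j) (testVector R i j) = 0) : M = 0 := by
  have hd : ∀ i, M i i = 0 := fun i => by
    simpa [testVector, Matrix.toBilin'_single] using h i i
  ext i j
  by_cases hij : i = j
  · rw [hij, hd]; rfl
  · have := h i j
    simp only [testVector, hij, if_false, map_add, LinearMap.add_apply, Matrix.toBilin'_single,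
      hd, hM.apply i j] at this
    rw [Matrix.zero_apply]
    linarith

/-- Lagrange's reduction of a quadratic form, carried out with parameters: a symmetric matrix whose
entries are regular functions on a semi-algebraic set has an index of inertia depending
semi-algebraically on the point. -/
theorem hasSemialgebraicPosIndex {m : ℕ} {S : Set (ι → R)} (hS : IsSemialgebraic S)
    {M : (ι → R) → Matrix (Fin m) (Fin m) R} (hM : ∀ i j, IsRegularOn S fun a => M a i j)
    (hsymm : ∀ a, (M a).IsSymm) : HasSemialgebraicPosIndex S M := by
  induction m generalizing S with
  | zero =>
    refine ⟨fun p => if p = 0 then S else ∅, fun p => ?_, fun a ha => ⟨0, by simpa using ha⟩,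
      fun p a ha => ?_⟩
    · dsimp only
      split_ifs
      exacts [hS, isSemialgebraic_empty]
    · dsimp only at ha
      split_ifs at ha with hp
      · subst hp
        rw [Subsingleton.elim (M a) 0, map_zero]
        exact hasPosIndex_zero
      · exact absurd ha (Set.notMem_empty a)
  | succ m ih =>
    let v := fun i j : Fin (m + 1) => testVector R i j
    let β := fun (i j : Fin (m + 1)) (a : ι → R) => Matrix.toBilin' (M a) (v i j) (v i j)
    have hβ : ∀ i j, IsRegularOn S (β i j) := fun i j =>
      .toBilin' hM (x := fun _ => v i j) (y := fun _ => v i j) (fun k => .const (v i j k))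
        fun k => .const (v i j k)
    have hBsymm : ∀ a, (Matrix.toBilin' (M a)).IsSymm := fun a =>
      ⟨fun x y => by
        simp only [Matrix.toBilin'_apply']
        rw [Matrix.dotProduct_mulVec, ← Matrix.mulVec_transpose, (hsymm a).eq, dotProduct_comm]⟩
    -- the restriction of the form to the orthogonal complement of a nonisotropic test vector
    have step : ∀ (i j : Fin (m + 1)) (U : Set (ι → R)), IsSemialgebraic U → U ⊆ S →
        (∀ a ∈ U, β i j a ≠ 0) → HasSemialgebraicPosIndex U
          fun a => LinearMap.BilinForm.toMatrix' ((Matrix.toBilin' (M a)).compl₁₂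
            (orthogonalParam (Matrix.toBilin' (M a)) (v i j) i)
            (orthogonalParam (Matrix.toBilin' (M a)) (v i j) i)) := by
      intro i j U hU hUS h0
      have hMU := fun i j => (hM i j).mono hUS
      have hreg := isRegularOn_orthogonalParam hMU h0 i
      refine ih hU (fun k l => ?_) fun a => ?_
      · simp only [LinearMap.BilinForm.toMatrix'_apply, LinearMap.compl₁₂_apply]
        exact IsRegularOn.toBilin' hMU (hreg k) (hreg l)
      · ext k l
        simp only [Matrix.transpose_apply, LinearMap.BilinForm.toMatrix'_apply,
          LinearMap.compl₁₂_apply]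
        exact (hBsymm a).eq _ _
    have hv : ∀ i j, v i j i ≠ 0 := by
      intro i j
      by_cases hij : i = j <;> simp [v, testVector, hij]
    have back : ∀ (i j : Fin (m + 1)) (a : ι → R) (p : ℕ), β i j a ≠ 0 →
        HasPosIndex (Matrix.toBilin' (LinearMap.BilinForm.toMatrix' ((Matrix.toBilin' (M a)).compl₁₂
            (orthogonalParam (Matrix.toBilin' (M a)) (v i j) i)
            (orthogonalParam (Matrix.toBilin' (M a)) (v i j) i)))) p →
        HasPosIndex (Matrix.toBilin' (M a)) (if 0 < β i j a then p + 1 else p) := by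
      intro i j a p h0 h
      rw [Matrix.toBilin'_toMatrix'] at h
      exact h.of_orthogonal (hBsymm a) h0 (orthogonalParam_injective _ (hv i j))
        (orthogonalParam_orthogonal _ h0 i) (by simp)
    -- either the form vanishes on all test vectors, so that it is zero, or it is positive or
    -- negative on one of them
    let U : Option (Bool × Fin (m + 1) × Fin (m + 1)) → Set (ι → R)
      | none => ⋂ ij ∈ (Set.univ : Set (Fin (m + 1) × Fin (m + 1))), {a ∈ S | β ij.1 ij.2 a = 0}
      | some (true, i, j) => {a ∈ S | 0 < β i j a}
      | some (false, i, j) => {a ∈ S | 0 < - β i j a}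
    refine HasSemialgebraicPosIndex.of_cover (U := U) (fun a ha => ?_) ?_
    · rw [Set.mem_iUnion]
      by_cases h : ∀ i j, β i j a = 0
      · exact ⟨none, by simp only [U, Set.mem_iInter]; exact fun ij _ => ⟨ha, h _ _⟩⟩
      · push Not at h
        obtain ⟨i, j, h⟩ := h
        rcases lt_or_gt_of_ne h with h | h
        · exact ⟨some (false, i, j), ha, neg_pos.2 h⟩
        · exact ⟨some (true, i, j), ha, h⟩
    · rintro (_ | ⟨_ | _, i, j⟩)
      · refine ⟨fun p => if p = 0 then U none else ∅, fun p => ?_,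
          fun a ha => ⟨0, by simpa using ha⟩, fun p a ha => ?_⟩
        · dsimp only
          split_ifs
          · exact isSemialgebraic_biInter Set.finite_univ fun ij _ =>
              (hβ ij.1 ij.2).isSemialgebraic_eq_zero hS
          · exact isSemialgebraic_empty
        · dsimp only at ha
          split_ifs at ha with hp
          · subst hp
            have : M a = 0 := by
              refine eq_zero_of_testVector (hsymm a) fun i j => ?_
              simp only [U, Set.mem_iInter] at ha
              exact (ha (i, j) (Set.mem_univ _)).2
            rw [this, map_zero]
            exact hasPosIndex_zero
          · exact absurd ha (Set.notMem_empty a)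
      · have hU : IsSemialgebraic (U (some (false, i, j))) := (hβ i j).neg.isSemialgebraic_pos hS
        obtain ⟨T, h1, h2, h3⟩ := step i j _ hU (Set.sep_subset _ _)
          fun a ha => (neg_pos.1 ha.2).ne
        refine ⟨fun p => T p ∩ U (some (false, i, j)), fun p => (h1 p).inter hU, fun a ha => ?_,
          fun p a ha => ?_⟩
        · obtain ⟨p, hp⟩ := h2 a ha
          exact ⟨p, hp, ha⟩
        · have hneg : β i j a < 0 := neg_pos.1 ha.2.2
          have := back i j a p hneg.ne (h3 p a ha.1)
          rwa [if_neg (not_lt.2 hneg.le)] at this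
      · have hU : IsSemialgebraic (U (some (true, i, j))) := (hβ i j).isSemialgebraic_pos hS
        obtain ⟨T, h1, h2, h3⟩ := step i j _ hU (Set.sep_subset _ _) fun a ha => ha.2.ne'
        refine ⟨fun p => ⋃ r ∈ {r : ℕ | r + 1 = p}, T r ∩ U (some (true, i, j)), fun p => ?_,
          fun a ha => ?_, fun p a ha => ?_⟩
        · refine isSemialgebraic_biUnion ?_ fun r _ => (h1 r).inter hU
          exact (Set.finite_le_nat p).subset fun r hr => by
            have : r + 1 = p := hr
            change r ≤ p
            omega
        · obtain ⟨p, hp⟩ := h2 a ha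
          exact ⟨p + 1, Set.mem_biUnion (show p + 1 = p + 1 from rfl) ⟨hp, ha⟩⟩
        · obtain ⟨r, hr, ha'⟩ := Set.mem_iUnion₂.1 ha
          obtain rfl : r + 1 = p := hr
          have hpos : 0 < β i j a := ha'.2.2
          have := back i j a r hpos.ne' (h3 r a ha'.1)
          rwa [if_pos hpos] at this

theorem isSemialgebraic_hasPosIndex {m : ℕ} {S : Set (ι → R)} (hS : IsSemialgebraic S)
    {M : (ι → R) → Matrix (Fin m) (Fin m) R} (hM : ∀ i j, IsRegularOn S fun a => M a i j)
    (hsymm : ∀ a, (M a).IsSymm) (p : ℕ) :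
    IsSemialgebraic {a ∈ S | HasPosIndex (Matrix.toBilin' (M a)) p} := by
  obtain ⟨T, h1, h2, h3⟩ := hasSemialgebraicPosIndex hS hM hsymm
  have : {a ∈ S | HasPosIndex (Matrix.toBilin' (M a)) p} = S ∩ T p := by
    ext a
    refine and_congr_right fun ha => ⟨fun h => ?_, h3 p a⟩
    obtain ⟨r, hr⟩ := h2 a ha
    rwa [h.unique (h3 r a hr)]
  rw [this]
  exact hS.inter (h1 p)

end SemialgebraicPosIndex

/-! ### Hermite's theorem on the signature of trace forms -/

section Hermite

open Polynomial

theorem finrank_le_finrank_ker_add_card {R E ι : Type*} [Field R] [AddCommGroup E] [Module R E]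
    [FiniteDimensional R E] [Fintype ι] (l : ι → E →ₗ[R] R) :
    Module.finrank R E ≤ Module.finrank R (LinearMap.ker (LinearMap.pi l)) + Fintype.card ι := by
  have h1 := LinearMap.finrank_range_add_finrank_ker (LinearMap.pi l)
  have h2 := Submodule.finrank_le (LinearMap.range (LinearMap.pi l))
  rw [Module.finrank_fintype_fun_eq_card] at h2
  omega

/-- The value at `z` of the polynomial with coefficients `x`, as a linear function of `x`. -/
def evalCoeffs {R C : Type*} [Field R] [Field C] [Algebra R C] (m : ℕ) (z : C) :
    (Fin m → R) →ₗ[R] C :=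
  Fintype.linearCombination R fun j : Fin m => z ^ (j : ℕ)

theorem evalCoeffs_apply {R C : Type*} [Field R] [Field C] [Algebra R C] {m : ℕ} (z : C)
    (x : Fin m → R) : evalCoeffs m z x = ∑ j, algebraMap R C (x j) * z ^ (j : ℕ) := by
  simp [evalCoeffs, Fintype.linearCombination_apply, Algebra.smul_def]

theorem exists_evalCoeffs_ne_zero {R C : Type*} [Field R] [Field C] [Algebra R C] {m : ℕ}
    {c : Fin m → C} (hc : Function.Injective c) {x : Fin m → R} (hx : x ≠ 0) :
    ∃ k, evalCoeffs m (c k) x ≠ 0 := by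
  by_contra! h
  apply hx
  have h1 : (fun j => algebraMap R C (x j)) = 0 := by
    refine Matrix.eq_zero_of_mulVec_eq_zero (Matrix.det_vandermonde_ne_zero_iff.2 hc) ?_
    ext k
    have := h k
    rw [evalCoeffs_apply] at this
    simpa [Matrix.mulVec, dotProduct, Matrix.vandermonde_apply, mul_comm] using this
  ext j
  exact (map_eq_zero_iff _ (algebraMap R C).injective).1 (congrFun h1 j)

variable {R C : Type*} [Field R] [LinearOrder R] [IsStrictOrderedRing R] [Field C] [Algebra R C]
  (κ : ComplexCoordinates R C) {m : ℕ} {c : Fin m → C}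

omit [LinearOrder R] [IsStrictOrderedRing R] in
theorem ComplexCoordinates.evalCoeffs_conj (z : C) (x : Fin m → R) :
    evalCoeffs m (κ.conj z) x = κ.conj (evalCoeffs m z x) := by
  simp [evalCoeffs_apply]

omit [LinearOrder R] [IsStrictOrderedRing R] in
theorem algebraMap_toBilin'_eq_sum {H : Matrix (Fin m) (Fin m) R} {γ : Fin m → C}
    (hH : ∀ i j, algebraMap R C (H i j) = ∑ k, γ k * c k ^ (i + j : ℕ)) (x : Fin m → R) :
    algebraMap R C (Matrix.toBilin' H x x) = ∑ k, γ k * evalCoeffs m (c k) x ^ 2 := by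
  simp only [Matrix.toBilin'_apply, map_sum, map_mul, hH, evalCoeffs_apply, pow_two,
    Finset.mul_sum, Finset.sum_mul]
  rw [Finset.sum_comm' (t' := Finset.univ) (s' := fun _ => Finset.univ) (by simp)]
  conv_rhs => rw [Finset.sum_comm]
  rw [Finset.sum_comm]
  refine Finset.sum_congr rfl fun i _ => ?_
  rw [Finset.sum_comm]
  refine Finset.sum_congr rfl fun k _ => Finset.sum_congr rfl fun j _ => ?_
  rw [pow_add]
  ring

/-- A conjugation-invariant family without repetitions consists of real elements and of pairs of
conjugates. -/
theorem ComplexCoordinates.card_real_add (hc : Function.Injective c)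
    (hconj : ∀ k, ∃ k', c k' = κ.conj (c k)) :
    Fintype.card {k // κ.im (c k) = 0} + 2 * Fintype.card {k // 0 < κ.im (c k)} = m := by
  choose σ hσ using hconj
  have h1 : Fintype.card {k // κ.im (c k) < 0} = Fintype.card {k // 0 < κ.im (c k)} := by
    have hσσ : ∀ k, σ (σ k) = k := fun k => hc (by rw [hσ, hσ, κ.conj_conj])
    refine Fintype.card_congr ⟨fun k => ⟨σ k.1, ?_⟩, fun k => ⟨σ k.1, ?_⟩, fun k => ?_, fun k => ?_⟩
    · rw [hσ, κ.im_conj]; exact neg_pos.2 k.2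
    · rw [hσ, κ.im_conj]; exact neg_neg_iff_pos.2 k.2
    · exact Subtype.ext (hσσ _)
    · exact Subtype.ext (hσσ _)
  have h2 : Fintype.card {k // ¬ κ.im (c k) = 0} =
      Fintype.card {k // κ.im (c k) < 0} + Fintype.card {k // 0 < κ.im (c k)} := by
    rw [← Fintype.card_subtype_or_disjoint]
    · exact Fintype.card_congr (Equiv.subtypeEquivRight fun k => by
        rw [← ne_eq, lt_or_lt_iff_ne])
    · rw [Pi.disjoint_iff]
      intro k
      rw [Prop.disjoint_iff]
      rintro ⟨h1, h2⟩
      exact lt_asymm h1 h2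
  have h3 := Fintype.card_subtype_compl fun k : Fin m => κ.im (c k) = 0
  have h4 := Fintype.card_subtype_le fun k : Fin m => κ.im (c k) = 0
  rw [Fintype.card_fin] at h3 h4
  omega

/-- Hermite's theorem: the trace form `∑ k, g (c k) * f (c k) ^ 2` on polynomials `f`, summed over
a conjugation-invariant set of points `c k`, has one positive square for every real point with
`g (c k) > 0` and one for every pair of conjugate points. -/
theorem ComplexCoordinates.hasPosIndex_hermite [IsAlgClosed C] (hc : Function.Injective c)
    (hconj : ∀ k, ∃ k', c k' = κ.conj (c k)) {g : R[X]}
    (hg : ∀ k, κ.im (c k) ≠ 0 → aeval (c k) g ≠ 0) {H : Matrix (Fin m) (Fin m) R}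
    (hH : ∀ i j, algebraMap R C (H i j) = ∑ k, aeval (c k) g * c k ^ (i + j : ℕ)) :
    HasPosIndex (Matrix.toBilin' H)
      (Fintype.card {k // κ.im (c k) = 0 ∧ 0 < κ.re (aeval (c k) g)} +
        Fintype.card {k // 0 < κ.im (c k)}) := by
  have hcard := κ.card_real_add hc hconj
  choose σ hσ using hconj
  -- `g (c k) * f (c k) ^ 2 = (w k * f (c k)) ^ 2`, so that for a pair of conjugate points the form
  -- is a difference of two squares
  choose w hw using fun k => IsAlgClosed.exists_pow_nat_eq (aeval (c k) g) two_pos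
  let F := fun k => evalCoeffs (R := R) m (c k)
  let τ : Fin m → (Fin m → R) → R := fun k x => κ.re (aeval (c k) g * F k x ^ 2)
  have hB : ∀ x, Matrix.toBilin' H x x = ∑ k, τ k x := fun x => by
    rw [← κ.re_algebraMap (Matrix.toBilin' H x x), algebraMap_toBilin'_eq_sum hH, map_sum]
  have hτσ : ∀ k x, τ (σ k) x = τ k x := fun k x => by
    simp only [τ, F, hσ, κ.aeval_conj, κ.evalCoeffs_conj, ← map_pow, ← map_mul, κ.re_conj]
  have hFσ : ∀ k x, F (σ k) x = κ.conj (F k x) := fun k x => by simp only [F, hσ, κ.evalCoeffs_conj]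
  have hτ : ∀ k x, τ k x = κ.re (w k * F k x) ^ 2 - κ.im (w k * F k x) ^ 2 := fun k x => by
    simp only [τ, ← hw, ← mul_pow]
    rw [pow_two (w k * F k x), (κ.re_mul_im_mul _ _).1]
    ring
  have hFreal : ∀ k x, κ.im (c k) = 0 → κ.im (F k x) = 0 := fun k x h => by
    simp only [F]
    rw [κ.eq_algebraMap_of_im_eq_zero h, evalCoeffs_apply]
    simp only [← map_pow, ← map_mul, ← map_sum, κ.im_algebraMap]
  have hτreal : ∀ k x, κ.im (c k) = 0 → τ k x = κ.re (aeval (c k) g) * κ.re (F k x) ^ 2 :=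
    fun k x h => by
      simp only [τ]
      rw [κ.eq_algebraMap_of_im_eq_zero (hFreal k x h), κ.re_algebraMap, ← map_pow,
        (κ.re_mul_im_mul _ _).1, κ.re_algebraMap, κ.im_algebraMap, mul_zero, sub_zero]
  -- The form is positive definite where all `l k`, `k ∈ P`, vanish, and negative semidefinite where
  -- all `l' k`, `k ∈ P'`, vanish.
  let l : Fin m → (Fin m → R) →ₗ[R] R := fun k =>
    if κ.im (c k) = 0 then κ.re ∘ₗ F k else κ.im ∘ₗ (LinearMap.mulLeft R (w k)) ∘ₗ F k
  let l' : Fin m → (Fin m → R) →ₗ[R] R := fun k =>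
    if κ.im (c k) = 0 then κ.re ∘ₗ F k else κ.re ∘ₗ (LinearMap.mulLeft R (w k)) ∘ₗ F k
  let P : Fin m → Prop := fun k => (κ.im (c k) = 0 ∧ ¬ 0 < κ.re (aeval (c k) g)) ∨ 0 < κ.im (c k)
  let P' : Fin m → Prop := fun k => (κ.im (c k) = 0 ∧ 0 < κ.re (aeval (c k) g)) ∨ 0 < κ.im (c k)
  have hP : Fintype.card {k // P k} =
      Fintype.card {k // κ.im (c k) = 0 ∧ ¬ 0 < κ.re (aeval (c k) g)} +
        Fintype.card {k // 0 < κ.im (c k)} := by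
    rw [← Fintype.card_subtype_or_disjoint]
    rw [Pi.disjoint_iff]
    intro k
    rw [Prop.disjoint_iff]
    rintro ⟨h1, h2⟩
    exact h2.ne' h1.1
  have hP' : Fintype.card {k // P' k} =
      Fintype.card {k // κ.im (c k) = 0 ∧ 0 < κ.re (aeval (c k) g)} +
        Fintype.card {k // 0 < κ.im (c k)} := by
    rw [← Fintype.card_subtype_or_disjoint]
    rw [Pi.disjoint_iff]
    intro k
    rw [Prop.disjoint_iff]
    rintro ⟨h1, h2⟩
    exact h2.ne' h1.1
  have hreal : Fintype.card {k // κ.im (c k) = 0} =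
      Fintype.card {k // κ.im (c k) = 0 ∧ 0 < κ.re (aeval (c k) g)} +
      Fintype.card {k // κ.im (c k) = 0 ∧ ¬ 0 < κ.re (aeval (c k) g)} := by
    rw [← Fintype.card_subtype_or_disjoint]
    · exact Fintype.card_congr (Equiv.subtypeEquivRight fun k => by tauto)
    · rw [Pi.disjoint_iff]
      intro k
      rw [Prop.disjoint_iff]
      rintro ⟨h1, h2⟩
      exact h2.2 h1.2
  have hV := finrank_le_finrank_ker_add_card fun k : {k // P k} => l k
  have hW := finrank_le_finrank_ker_add_card fun k : {k // P' k} => l' k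
  rw [Module.finrank_fintype_fun_eq_card, Fintype.card_fin] at hV hW
  refine ⟨LinearMap.ker (LinearMap.pi fun k : {k // P k} => l k),
    LinearMap.ker (LinearMap.pi fun k : {k // P' k} => l' k), by omega, ?_, ?_, ?_⟩
  · rw [Module.finrank_fintype_fun_eq_card, Fintype.card_fin, ← hP']
    exact hW
  · intro x hx hx0
    rw [LinearMap.mem_ker, funext_iff] at hx
    have hx' : ∀ k, P k → l k x = 0 := fun k hk => hx ⟨k, hk⟩
    have hup : ∀ k, 0 < κ.im (c k) → 0 ≤ τ k x ∧ (F k x ≠ 0 → 0 < τ k x) := by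
      intro k hk
      have h1 : κ.im (w k * F k x) = 0 := by
        have := hx' k (Or.inr hk)
        simp only [l, if_neg hk.ne'] at this
        exact this
      rw [hτ, h1]
      refine ⟨by nlinarith [sq_nonneg (κ.re (w k * F k x))], fun hF => ?_⟩
      have hw0 : w k ≠ 0 := fun h => hg k hk.ne' (by rw [← hw, h]; simp)
      have : κ.re (w k * F k x) ≠ 0 := fun h =>
        mul_ne_zero hw0 hF (κ.ext_re_im (by rw [h, map_zero]) (by rw [h1, map_zero]))
      have := sq_pos_of_ne_zero this
      linarith
    have hall : ∀ k, 0 ≤ τ k x ∧ (F k x ≠ 0 → 0 < τ k x) := by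
      intro k
      rcases lt_trichotomy (κ.im (c k)) 0 with h | h | h
      · have := hup (σ k) (by rw [hσ, κ.im_conj]; exact neg_pos.2 h)
        rw [hτσ, hFσ] at this
        exact ⟨this.1, fun hF => this.2 ((map_ne_zero_iff _ κ.conj.injective).2 hF)⟩
      · rw [hτreal k x h]
        by_cases hpos : 0 < κ.re (aeval (c k) g)
        · refine ⟨by positivity, fun hF => mul_pos hpos (sq_pos_of_ne_zero fun h0 => hF ?_)⟩
          exact κ.ext_re_im (by rw [h0, map_zero]) (by rw [hFreal k x h, map_zero])
        · have h1 := hx' k (Or.inl ⟨h, hpos⟩)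
          have h2 : κ.re (F k x) = 0 := by
            simp only [l, if_pos h] at h1
            exact h1
          refine ⟨by simp [h2], fun hF => absurd ?_ hF⟩
          exact κ.ext_re_im (by rw [h2, map_zero]) (by rw [hFreal k x h, map_zero])
      · exact hup k h
    rw [hB]
    obtain ⟨k, hk⟩ := exists_evalCoeffs_ne_zero hc hx0
    exact Finset.sum_pos' (fun k _ => (hall k).1) ⟨k, Finset.mem_univ k, (hall k).2 hk⟩
  · intro x hx
    rw [LinearMap.mem_ker, funext_iff] at hx
    have hx' : ∀ k, P' k → l' k x = 0 := fun k hk => hx ⟨k, hk⟩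
    have hup : ∀ k, 0 < κ.im (c k) → τ k x ≤ 0 := by
      intro k hk
      have h1 : κ.re (w k * F k x) = 0 := by
        have := hx' k (Or.inr hk)
        simp only [l', if_neg hk.ne'] at this
        exact this
      rw [hτ, h1]
      nlinarith [sq_nonneg (κ.im (w k * F k x))]
    rw [hB]
    refine Finset.sum_nonpos fun k _ => ?_
    rcases lt_trichotomy (κ.im (c k)) 0 with h | h | h
    · rw [← hτσ]
      exact hup (σ k) (by rw [hσ, κ.im_conj]; exact neg_pos.2 h)
    · rw [hτreal k x h]
      by_cases hpos : 0 < κ.re (aeval (c k) g)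
      · have h1 := hx' k (Or.inl ⟨h, hpos⟩)
        have h2 : κ.re (F k x) = 0 := by
          simp only [l', if_pos h] at h1
          exact h1
        simp [h2]
      · exact mul_nonpos_of_nonpos_of_nonneg (not_lt.1 hpos) (sq_nonneg _)
    · exact hup k h

end Hermite

/-! ### Monic polynomials with given coefficients -/

section MonicPoly

open Polynomial

/-- The monic polynomial of degree `m` with lower coefficients `q`. -/
noncomputable def monicPoly {K : Type*} [Semiring K] {m : ℕ} (q : Fin m → K) : K[X] :=
  X ^ m + ∑ j : Fin m, C (q j) * X ^ (j : ℕ)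

section Semiring

variable {K L : Type*} [CommRing K] [CommRing L] {m : ℕ}

theorem monicPoly_monic (q : Fin m → K) : (monicPoly q).Monic :=
  monic_X_pow_add (degree_sum_fin_lt q)

theorem natDegree_monicPoly [Nontrivial K] (q : Fin m → K) : (monicPoly q).natDegree = m := by
  rw [monicPoly, natDegree_add_eq_left_of_degree_lt, natDegree_X_pow]
  rw [degree_X_pow]
  exact degree_sum_fin_lt q

theorem coeff_monicPoly (q : Fin m → K) (j : Fin m) : (monicPoly q).coeff j = q j := by
  rw [monicPoly, coeff_add, coeff_X_pow, if_neg j.2.ne, zero_add, finsetSum_coeff,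
    Finset.sum_eq_single j]
  · simp
  · intro b _ hb
    rw [coeff_C_mul, coeff_X_pow, if_neg (fun h => hb (Fin.ext h.symm)), mul_zero]
  · simp

theorem map_monicPoly (f : K →+* L) (q : Fin m → K) :
    (monicPoly q).map f = monicPoly fun j => f (q j) := by
  simp [monicPoly, Polynomial.map_sum]

theorem eval_monicPoly (q : Fin m → K) (x : K) :
    (monicPoly q).eval x = x ^ m + ∑ j, q j * x ^ (j : ℕ) := by
  simp [monicPoly, eval_finsetSum]

theorem Polynomial.Monic.eq_monicPoly {p : K[X]} (hp : p.Monic) (hm : p.natDegree = m) :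
    p = monicPoly fun j : Fin m => p.coeff j := by
  conv_lhs => rw [hp.as_sum, hm]
  rw [monicPoly, Finset.sum_range]

end Semiring

theorem exists_monicPoly_eq_prod {K : Type*} [Field K] [IsAlgClosed K] {m : ℕ} (q : Fin m → K) :
    ∃ c : Fin m → K, monicPoly q = ∏ k, (X - C (c k)) := by
  have hs := IsAlgClosed.splits (monicPoly q)
  have hcard : Multiset.card (monicPoly q).roots = m := by
    rw [← hs.natDegree_eq_card_roots, natDegree_monicPoly]
  obtain ⟨l, hl⟩ := Quot.exists_rep (monicPoly q).roots
  change (l : Multiset K) = _ at hl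
  have hlen : l.length = m := by rw [← hcard, ← hl, Multiset.coe_card]
  subst hlen
  refine ⟨l.get, ?_⟩
  rw [hs.eq_prod_roots_of_monic (monicPoly_monic q), ← hl, Multiset.map_coe, Multiset.prod_coe,
    ← List.prod_ofFn]
  congr 1
  conv_lhs => rw [← List.ofFn_get l, List.map_ofFn]
  rfl

/-! ### Power sums and trace forms -/

section PowerSums

universe u

variable (R : Type u) [Field R]

/-- Newton's theorem: the power sums of the roots of a monic polynomial are polynomials in its
coefficients. -/
theorem exists_powerSum_poly (m n : ℕ) : ∃ Φ : MvPolynomial (Fin m) R,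
    ∀ {C : Type u} [Field C] [Algebra R C] (q : Fin m → R) (c : Fin m → C),
      (monicPoly q).map (algebraMap R C) = ∏ k, (X - Polynomial.C (c k)) →
        algebraMap R C (MvPolynomial.eval q Φ) = ∑ k, c k ^ n := by
  obtain ⟨Ψ, hΨ⟩ := MvPolynomial.esymmAlgHom_surjective (σ := Fin m) R (n := m) (by simp)
    ⟨MvPolynomial.psum (Fin m) R n, MvPolynomial.psum_isSymmetric _ _ _⟩
  refine ⟨MvPolynomial.bind₁ (fun i : Fin m =>
    MvPolynomial.C ((-1) ^ ((i : ℕ) + 1)) * MvPolynomial.X i.rev) Ψ, ?_⟩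
  intro C _ _ q c h
  have he : ∀ i : Fin m, MvPolynomial.aeval c (MvPolynomial.esymm (Fin m) R (i + 1)) =
      algebraMap R C ((-1) ^ ((i : ℕ) + 1) * q i.rev) := by
    intro i
    rw [MvPolynomial.aeval_esymm_eq_multiset_esymm]
    have h1 := Multiset.prod_X_sub_C_coeff (Multiset.map c Finset.univ.val) (k := i.rev)
      (by simp)
    have h2 : (Multiset.map (fun t => X - Polynomial.C t) (Multiset.map c Finset.univ.val)).prod =
        (monicPoly q).map (algebraMap R C) := by
      rw [h, Multiset.map_map]; rfl
    have h3 : Multiset.card (Multiset.map c Finset.univ.val) - (i.rev : ℕ) = (i : ℕ) + 1 := by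
      simp only [Multiset.card_map, Finset.card_val, Finset.card_univ, Fintype.card_fin,
        Fin.val_rev]
      omega
    rw [h2, h3, coeff_map, coeff_monicPoly] at h1
    rw [map_mul, h1, ← mul_assoc]
    simp only [map_pow, map_neg, map_one]
    rw [← mul_pow]
    simp
  have h4 : MvPolynomial.aeval c (MvPolynomial.psum (Fin m) R n) = ∑ k, c k ^ n := by
    simp [MvPolynomial.psum]
  have h5 : MvPolynomial.psum (Fin m) R n =
      MvPolynomial.aeval (fun i : Fin m => MvPolynomial.esymm (Fin m) R (i + 1)) Ψ := by
    rw [← MvPolynomial.esymmAlgHom_apply, hΨ]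
  rw [← h4, h5, ← MvPolynomial.coe_aeval_eq_eval]
  change algebraMap R C (MvPolynomial.aeval q _) = _
  rw [MvPolynomial.aeval_bind₁, ← MvPolynomial.aeval_algebraMap_apply]
  rw [← AlgHom.comp_apply (MvPolynomial.aeval c), MvPolynomial.comp_aeval]
  congr 2
  ext i
  rw [he]
  simp

/-- The power sum of exponent `n` of the `m` roots of a monic polynomial, as a polynomial in its
coefficients. -/
noncomputable def powerSumPoly (m n : ℕ) : MvPolynomial (Fin m) R :=
  (exists_powerSum_poly R m n).choose

variable {R}

theorem algebraMap_eval_powerSumPoly {m : ℕ} (n : ℕ) {C : Type u} [Field C] [Algebra R C]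
    {q : Fin m → R} {c : Fin m → C}
    (h : (monicPoly q).map (algebraMap R C) = ∏ k, (X - Polynomial.C (c k))) :
    algebraMap R C (MvPolynomial.eval q (powerSumPoly R m n)) = ∑ k, c k ^ n :=
  (exists_powerSum_poly R m n).choose_spec q c h

/-- The matrix of the trace form `f ↦ ∑ (α + β z) f(z) ^ 2`, the sum being over the complex roots
`z` of the monic polynomial with lower coefficients `q`. -/
noncomputable def hermiteMatrix {m : ℕ} (α β : R) (q : Fin m → R) : Matrix (Fin m) (Fin m) R :=
  fun i j => α * MvPolynomial.eval q (powerSumPoly R m (i + j)) +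
    β * MvPolynomial.eval q (powerSumPoly R m (i + j + 1))

theorem hermiteMatrix_isSymm {m : ℕ} (α β : R) (q : Fin m → R) : (hermiteMatrix α β q).IsSymm := by
  ext i j
  simp only [Matrix.transpose_apply, hermiteMatrix, add_comm (i : ℕ)]

end PowerSums

/-! ### Semi-algebraicity of the number of real roots -/

section RootCount

variable {R : Type*} [Field R] {m : ℕ} {q : Fin m → R}

theorem injective_of_separable {C : Type*} [Field C] [Algebra R C] (hq : (monicPoly q).Separable)
    {c : Fin m → C} (h : (monicPoly q).map (algebraMap R C) = ∏ k, (X - Polynomial.C (c k))) :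
    Function.Injective c := by
  have := hq.map (f := algebraMap R C)
  rwa [h, separable_prod_X_sub_C_iff] at this

theorem aeval_eq_zero_iff_of_prod {C : Type*} [Field C] [Algebra R C] {p : R[X]}
    {c : Fin m → C} (h : p.map (algebraMap R C) = ∏ k, (X - Polynomial.C (c k))) (z : C) :
    aeval z p = 0 ↔ ∃ k, c k = z := by
  rw [aeval_def, ← eval_map, h, eval_prod, Finset.prod_eq_zero_iff]
  simp [sub_eq_zero, eq_comm]

variable [LinearOrder R] [IsStrictOrderedRing R]

/-- The real roots among the complex roots `c k`, counted with a side condition. -/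
theorem ComplexCoordinates.card_real_filter {C : Type*} [Field C] [Algebra R C]
    (κ : ComplexCoordinates R C) {c : Fin m → C} (hc : Function.Injective c)
    (h : (monicPoly q).map (algebraMap R C) = ∏ k, (X - Polynomial.C (c k)))
    (P : R → Prop) [DecidablePred P] :
    Fintype.card {k // κ.im (c k) = 0 ∧ P (κ.re (c k))} =
      ((monicPoly q).roots.toFinset.filter P).card := by
  have hroot : ∀ x : R, x ∈ (monicPoly q).roots ↔ ∃ k, c k = algebraMap R C x := fun x => by
    rw [mem_roots (monicPoly_monic q).ne_zero, ← aeval_eq_zero_iff_of_prod h,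
      aeval_algebraMap_apply, map_eq_zero_iff _ (algebraMap R C).injective]
    rfl
  rw [← Fintype.card_coe]
  refine Fintype.card_of_bijective
    (f := fun k => ⟨κ.re (c k.1), Finset.mem_filter.2 ⟨Multiset.mem_toFinset.2 ((hroot _).2 ⟨k.1,
      κ.eq_algebraMap_of_im_eq_zero k.2.1⟩), k.2.2⟩⟩) ⟨fun k l hkl => ?_, fun x => ?_⟩
  · have := congrArg Subtype.val hkl
    refine Subtype.ext (hc (κ.ext_re_im this ?_))
    rw [k.2.1, l.2.1]
  · obtain ⟨hx, hx'⟩ := Finset.mem_filter.1 x.2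
    obtain ⟨k, hk⟩ := (hroot _).1 (Multiset.mem_toFinset.1 hx)
    have h1 : κ.re (c k) = x.1 := by rw [hk, κ.re_algebraMap]
    exact ⟨⟨k, by rw [hk, κ.im_algebraMap], by rwa [h1]⟩, Subtype.ext h1⟩

/-- Hermite's theorem for the roots of a squarefree polynomial: the number of real roots satisfying
a linear inequality can be read off the positive index of a trace form. -/
theorem exists_hasPosIndex_hermiteMatrix [IsRealClosed R] (hq : (monicPoly q).Separable) :
    ∃ s, (monicPoly q).roots.toFinset.card + 2 * s = m ∧ ∀ α β : R, (α ≠ 0 ∨ β ≠ 0) →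
      HasPosIndex (Matrix.toBilin' (hermiteMatrix α β q))
        (((monicPoly q).roots.toFinset.filter fun x => 0 < α + β * x).card + s) := by
  classical
  obtain ⟨κ⟩ := IsRealClosed.nonempty_complexCoordinates (R := R) (C := AlgebraicClosure R)
  obtain ⟨c, hc⟩ := exists_monicPoly_eq_prod fun j => algebraMap R (AlgebraicClosure R) (q j)
  rw [← map_monicPoly] at hc
  have hinj := injective_of_separable hq hc
  have hconj : ∀ k, ∃ k', c k' = κ.conj (c k) := fun k => by
    rw [← aeval_eq_zero_iff_of_prod hc, κ.aeval_conj, (aeval_eq_zero_iff_of_prod hc _).2 ⟨k, rfl⟩,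
      map_zero]
  refine ⟨Fintype.card {k // 0 < κ.im (c k)}, ?_, fun α β hαβ => ?_⟩
  · have h1 := κ.card_real_filter hinj hc fun _ => True
    have h2 := κ.card_real_add hinj hconj
    simp only [and_true, Finset.filter_true] at h1
    rw [← h1, h2]
  · have hre : ∀ z, aeval z (C α + C β * X) =
        algebraMap R (AlgebraicClosure R) α + algebraMap R _ β * z := fun z => by simp
    have h1 := κ.hasPosIndex_hermite hinj hconj (g := C α + C β * X) (H := hermiteMatrix α β q)
      (fun k hk h0 => ?_) fun i j => ?_
    · rw [← κ.card_real_filter hinj hc fun x => 0 < α + β * x]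
      have h2 : ∀ k, κ.im (c k) = 0 ∧ 0 < κ.re (aeval (c k) (C α + C β * X)) ↔
          κ.im (c k) = 0 ∧ 0 < α + β * κ.re (c k) := fun k => by
        rw [hre, map_add, (κ.re_mul_im_mul _ _).1]
        simp
      rwa [Fintype.card_congr (Equiv.subtypeEquivRight h2)] at h1
    · have h2 := congrArg κ.im h0
      have h3 := congrArg κ.re h0
      rw [hre, map_add, (κ.re_mul_im_mul _ _).2] at h2
      rw [hre, map_add, (κ.re_mul_im_mul _ _).1] at h3
      simp only [κ.im_algebraMap, κ.re_algebraMap, map_zero, zero_mul, sub_zero, zero_add,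
        add_zero] at h2 h3
      have h4 := (mul_eq_zero.1 h2).resolve_right hk
      rw [h4, zero_mul, add_zero] at h3
      tauto
    · simp only [hermiteMatrix, map_add, map_mul, algebraMap_eval_powerSumPoly _ hc, hre, add_mul,
        Finset.sum_add_distrib, Finset.mul_sum]
      congr 1
      exact Finset.sum_congr rfl fun k _ => by rw [pow_succ]; ring

variable {ι : Type*} {S : Set (ι → R)} {q : (ι → R) → Fin m → R}

omit [LinearOrder R] [IsStrictOrderedRing R] in
theorem IsRegularOn.hermiteMatrix (hq : ∀ j, IsRegularOn S fun a => q a j) {α β : (ι → R) → R}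
    (hα : IsRegularOn S α) (hβ : IsRegularOn S β) (i j : Fin m) :
    IsRegularOn S fun a => hermiteMatrix (α a) (β a) (q a) i j :=
  (hα.mul (.eval_comp _ hq)).add (hβ.mul (.eval_comp _ hq))

/-- The number of real roots of a squarefree polynomial depends semi-algebraically on its
coefficients. -/
theorem isSemialgebraic_card_roots [IsRealClosed R] (hS : IsSemialgebraic S)
    (hq : ∀ j, IsRegularOn S fun a => q a j) (hsep : ∀ a ∈ S, (monicPoly (q a)).Separable) (r : ℕ) :
    IsSemialgebraic {a ∈ S | (monicPoly (q a)).roots.toFinset.card = r} := by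
  by_cases hr : ∃ s, r + 2 * s = m
  · obtain ⟨s, hs⟩ := hr
    have h := isSemialgebraic_hasPosIndex hS (M := fun a => hermiteMatrix 1 0 (q a))
      (IsRegularOn.hermiteMatrix hq (.const 1) (.const 0)) (fun a => hermiteMatrix_isSymm _ _ _)
      (r + s)
    convert h using 3 with a
    refine and_congr_right fun ha => ?_
    obtain ⟨s', hs', h'⟩ := exists_hasPosIndex_hermiteMatrix (hsep a ha)
    have h1 := h' 1 0 (Or.inl one_ne_zero)
    simp only [zero_mul, add_zero, zero_lt_one, Finset.filter_true] at h1
    constructor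
    · rintro rfl
      obtain rfl : s' = s := by omega
      exact h1
    · intro h2
      have := h1.unique h2
      omega
  · convert isSemialgebraic_empty using 1
    refine Set.eq_empty_of_forall_notMem fun a ha => hr ?_
    obtain ⟨s', hs', -⟩ := exists_hasPosIndex_hermiteMatrix (hsep a ha.1)
    exact ⟨s', by rw [← ha.2]; exact hs'⟩

/-- The number of real roots of a squarefree polynomial that are less than `t` depends
semi-algebraically on the coefficients and on `t`. -/
theorem isSemialgebraic_card_roots_lt [IsRealClosed R] (hS : IsSemialgebraic S)
    (hq : ∀ j, IsRegularOn S fun a => q a j) (hsep : ∀ a ∈ S, (monicPoly (q a)).Separable)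
    {t : (ι → R) → R} (ht : IsRegularOn S t) (l : ℕ) :
    IsSemialgebraic
      {a ∈ S | ((monicPoly (q a)).roots.toFinset.filter fun x => x < t a).card = l} := by
  -- The positive index determines the number of roots below `t` once the number `s` of pairs of
  -- conjugate roots is fixed.
  have hU : {a ∈ S | ((monicPoly (q a)).roots.toFinset.filter fun x => x < t a).card = l} =
      ⋃ s ∈ {s | s ≤ m}, {a ∈ S | (monicPoly (q a)).roots.toFinset.card = m - 2 * s} ∩
        {a ∈ S | 2 * s ≤ m ∧
          ((monicPoly (q a)).roots.toFinset.filter fun x => x < t a).card = l} := by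
    ext a
    simp only [Set.mem_iUnion, Set.mem_inter_iff, Set.mem_ofPred_eq, exists_prop]
    constructor
    · rintro ⟨ha, hl⟩
      obtain ⟨s, hs, -⟩ := exists_hasPosIndex_hermiteMatrix (hsep a ha)
      exact ⟨s, by omega, ⟨ha, by omega⟩, ha, by omega, hl⟩
    · rintro ⟨s, -, -, ha, -, hl⟩
      exact ⟨ha, hl⟩
  rw [hU]
  refine isSemialgebraic_biUnion (Set.finite_le_nat m) fun s _ => ?_
  have h1 := isSemialgebraic_card_roots hS hq hsep (m - 2 * s)
  have h2 := isSemialgebraic_hasPosIndex hS (M := fun a => hermiteMatrix (t a) (-1) (q a))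
    (IsRegularOn.hermiteMatrix hq ht (.const (-1))) (fun a => hermiteMatrix_isSymm _ _ _) (l + s)
  by_cases hs : 2 * s ≤ m
  · convert h1.inter h2 using 1
    ext a
    simp only [Set.mem_inter_iff, Set.mem_ofPred_eq, hs, true_and]
    refine and_congr_right fun ⟨ha, hN⟩ => and_congr_right fun _ => ?_
    obtain ⟨s', hs', h'⟩ := exists_hasPosIndex_hermiteMatrix (hsep a ha)
    obtain rfl : s' = s := by omega
    have h3 := h' (t a) (-1) (Or.inr (neg_ne_zero.2 one_ne_zero))
    simp only [neg_mul, one_mul, ← sub_eq_add_neg, sub_pos] at h3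
    constructor
    · rintro rfl
      exact h3
    · intro h4
      have := h3.unique h4
      omega
  · convert isSemialgebraic_empty using 1
    exact Set.eq_empty_of_forall_notMem fun a ha => hs ha.2.2.1

end RootCount

end MonicPoly

/-! ### The Euclidean topology -/

section EuclideanTopology

variable {R ι : Type*} [Field R] [LinearOrder R] [IsStrictOrderedRing R] [Fintype ι]
  [TopologicalSpace R] [OrderTopology R]

theorem isOpen_euclideanBall (x : ι → R) (r : R) : IsOpen (euclideanBall x r) :=
  isOpen_lt (by fun_prop) continuous_const

variable (R ι) in
/-- The Euclidean topology is the product of the order topologies. -/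
theorem euclideanTopology_eq_pi : euclideanTopology R ι = Pi.topologicalSpace := by
  refine le_antisymm ?_ (le_generateFrom ?_)
  · refine le_iInf fun i => ?_
    rw [← continuous_iff_le_induced, OrderTopology.topology_eq_generate_intervals (α := R),
      continuous_generateFrom_iff]
    have key : ∀ U : Set (ι → R),
        (∀ x ∈ U, ∃ r, 0 < r ∧ ∀ x', (x' i - x i) ^ 2 < r ^ 2 → x' ∈ U) →
        IsOpen[euclideanTopology R ι] U := by
      intro U hU
      let := euclideanTopology R ι
      rw [isOpen_iff_forall_mem_open]
      intro x hx
      obtain ⟨r, hr, h⟩ := hU x hx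
      refine ⟨euclideanBall x r, fun x' hx' => h x' ?_,
        TopologicalSpace.isOpen_generateFrom_of_mem ⟨x, r, hr, rfl⟩, ?_⟩
      · exact (Finset.single_le_sum (f := fun i => (x' i - x i) ^ 2) (fun _ _ => sq_nonneg _)
          (Finset.mem_univ i)).trans_lt hx'
      · simpa [euclideanBall] using pow_pos hr 2
    rintro _ ⟨a, rfl | rfl⟩
    · refine key _ fun x hx => ⟨x i - a, sub_pos.2 hx, fun x' hx' => ?_⟩
      have := abs_lt_of_sq_lt_sq hx' (sub_pos.2 hx).le
      have := (abs_lt.1 this).1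
      change a < x' i
      linarith
    · refine key _ fun x hx => ⟨a - x i, sub_pos.2 hx, fun x' hx' => ?_⟩
      have := abs_lt_of_sq_lt_sq hx' (sub_pos.2 hx).le
      have := (abs_lt.1 this).2
      change x' i < a
      linarith
  · rintro _ ⟨x, r, -, rfl⟩
    exact isOpen_euclideanBall x r

omit [LinearOrder R] [IsStrictOrderedRing R] [Fintype ι] [OrderTopology R] in
theorem IsRegularOn.continuousOn [IsTopologicalDivisionRing R] {S : Set (ι → R)}
    {f : (ι → R) → R} (hf : IsRegularOn S f) : ContinuousOn f S := by
  obtain ⟨N, D, h⟩ := hf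
  have h1 : ContinuousOn (fun a => MvPolynomial.eval a N / MvPolynomial.eval a D) S :=
    (MvPolynomial.continuous_eval N).continuousOn.div (MvPolynomial.continuous_eval D).continuousOn
      fun a ha => (h a ha).1
  exact h1.congr fun a ha => (h a ha).2

end EuclideanTopology

/-! ### Continuity of simple roots -/

section ContinuityOfRoots

open Polynomial Filter

variable {R : Type*} [Field R] {m : ℕ}

/-- The difference quotient `(Q x - Q y) / (x - y)` of the monic polynomial `Q` with lower
coefficients `q`. -/
def diffQuot (q : Fin m → R) (x y : R) : R :=
  ∑ k ∈ Finset.range m, x ^ k * y ^ (m - 1 - k) +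
    ∑ j : Fin m, q j * ∑ k ∈ Finset.range j, x ^ k * y ^ ((j : ℕ) - 1 - k)

theorem diffQuot_mul (q : Fin m → R) (x y : R) :
    diffQuot q x y * (x - y) = (monicPoly q).eval x - (monicPoly q).eval y := by
  have h : ∀ j : Fin m, q j * (∑ k ∈ Finset.range j, x ^ k * y ^ ((j : ℕ) - 1 - k)) * (x - y) =
      q j * x ^ (j : ℕ) - q j * y ^ (j : ℕ) := fun j => by
    rw [mul_assoc, geom_sum₂_mul, mul_sub]
  rw [diffQuot, add_mul, geom_sum₂_mul, Finset.sum_mul, Finset.sum_congr rfl fun j _ => h j,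
    Finset.sum_sub_distrib, eval_monicPoly, eval_monicPoly]
  ring

theorem diffQuot_self (q : Fin m → R) (x : R) :
    diffQuot q x x = (derivative (monicPoly q)).eval x := by
  have h : ∀ n, ∑ k ∈ Finset.range n, x ^ k * x ^ (n - 1 - k) = n * x ^ (n - 1) := fun n => by
    rw [Finset.sum_congr rfl (g := fun _ => x ^ (n - 1)), Finset.sum_const, Finset.card_range,
      nsmul_eq_mul]
    intro k hk
    rw [← pow_add]
    congr 1
    have := Finset.mem_range.1 hk
    omega
  simp [diffQuot, h, monicPoly, eval_finsetSum, derivative_X_pow]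

variable [LinearOrder R] [IsStrictOrderedRing R]

/-- Cauchy's bound for the roots of a monic polynomial. -/
theorem abs_le_of_eval_monicPoly_eq_zero {q : Fin m → R} {x : R}
    (h : (monicPoly q).eval x = 0) : |x| ≤ 1 + ∑ j, |q j| := by
  by_contra! hx
  have hs : 0 ≤ ∑ j, |q j| := Finset.sum_nonneg fun _ _ => abs_nonneg _
  have hx1 : 1 ≤ |x| := by linarith
  rcases m with _ | m
  · simp [eval_monicPoly] at h
  rw [eval_monicPoly] at h
  have h1 : |x| ^ (m + 1) ≤ (∑ j, |q j|) * |x| ^ m := by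
    rw [← abs_pow, eq_neg_of_add_eq_zero_left h, abs_neg, Finset.sum_mul]
    refine (Finset.abs_sum_le_sum_abs _ _).trans (Finset.sum_le_sum fun j _ => ?_)
    rw [abs_mul, abs_pow]
    exact mul_le_mul_of_nonneg_left (pow_le_pow_right₀ hx1 (by omega)) (abs_nonneg _)
  have h2 : (∑ j, |q j|) * |x| ^ m < |x| * |x| ^ m :=
    mul_lt_mul_of_pos_right (by linarith) (pow_pos (by linarith) m)
  rw [pow_succ'] at h1
  exact absurd (h1.trans_lt h2) (lt_irrefl _)

variable [TopologicalSpace R] [OrderTopology R]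

theorem continuous_eval_monicPoly (x : R) :
    Continuous fun q : Fin m → R => (monicPoly q).eval x := by
  simp only [eval_monicPoly]
  fun_prop

theorem continuous_diffQuot :
    Continuous fun p : (Fin m → R) × R × R => diffQuot p.1 p.2.1 p.2.2 := by
  unfold diffQuot
  fun_prop

variable [IsRealClosed R]

/-- A simple root persists, and remains alone, under small perturbations of the coefficients. -/
theorem exists_eventually_existsUnique_root {q₀ : Fin m → R} {c : R}
    (hc : (monicPoly q₀).eval c = 0) (hc' : (derivative (monicPoly q₀)).eval c ≠ 0) :
    ∀ᶠ δ in 𝓝[>] (0 : R), ∀ᶠ q in 𝓝 q₀, ∃! x, |x - c| < δ ∧ (monicPoly q).eval x = 0 := by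
  -- Near `(q₀, c, c)` the difference quotient has the sign of the derivative `g`: so the polynomial
  -- is strictly monotone near `c`, and it changes sign there.
  set g := diffQuot q₀ c c with hg
  have hg0 : g ≠ 0 := by rwa [hg, diffQuot_self]
  have h1 : ∀ᶠ p : (Fin m → R) × R × R in 𝓝 (q₀, c, c), 0 < diffQuot p.1 p.2.1 p.2.2 * g :=
    ((continuous_diffQuot.mul continuous_const).tendsto (q₀, c, c)).eventually
      (lt_mem_nhds (mul_self_pos.2 hg0))
  rw [nhds_prod_eq, nhds_prod_eq] at h1
  obtain ⟨U, hU, V, hV, hUV⟩ := eventually_prod_iff.1 h1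
  obtain ⟨V₁, hV₁, V₂, hV₂, hVV⟩ := eventually_prod_iff.1 hV
  obtain ⟨ε, hε, hεV⟩ := (nhds_basis_abs_sub_lt c).eventually_iff.1 (hV₁.and hV₂)
  have key : ∀ q x y, U q → |x - c| < ε → |y - c| < ε → 0 < diffQuot q x y * g :=
    fun q x y hq hx hy => hUV hq (hVV (hεV hx).1 (hεV hy).2)
  filter_upwards [Ioo_mem_nhdsGT hε] with δ ⟨hδ, hδε⟩
  have hcε : |c - c| < ε := by simpa using hε
  have hp : |c + δ - c| < ε := by rw [add_sub_cancel_left, abs_of_pos hδ]; exact hδε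
  have hm : |c - δ - c| < ε := by rw [sub_sub_cancel_left, abs_neg, abs_of_pos hδ]; exact hδε
  have hpos : 0 < (monicPoly q₀).eval (c + δ) * g := by
    have h2 := diffQuot_mul q₀ (c + δ) c
    rw [hc, sub_zero, add_sub_cancel_left] at h2
    rw [← h2]
    have := mul_pos (key q₀ _ _ hU.self_of_nhds hp hcε) hδ
    linarith
  have hneg : (monicPoly q₀).eval (c - δ) * g < 0 := by
    have h2 := diffQuot_mul q₀ (c - δ) c
    rw [hc, sub_zero, sub_sub_cancel_left] at h2
    rw [← h2]
    have := mul_pos (key q₀ _ _ hU.self_of_nhds hm hcε) hδ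
    linarith
  filter_upwards [hU,
    (((continuous_eval_monicPoly (c + δ)).mul continuous_const).tendsto q₀).eventually
      (lt_mem_nhds hpos),
    (((continuous_eval_monicPoly (c - δ)).mul continuous_const).tendsto q₀).eventually
      (gt_mem_nhds hneg)] with q hq hq1 hq2
  change 0 < (monicPoly q).eval (c + δ) * g at hq1
  change (monicPoly q).eval (c - δ) * g < 0 at hq2
  have hprod : (monicPoly q).eval (c - δ) * (monicPoly q).eval (c + δ) < 0 := by
    have h3 := mul_neg_of_neg_of_pos hq2 hq1
    have h4 := mul_self_pos.2 hg0
    by_contra! h5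
    have := mul_nonneg h5 h4.le
    linarith
  obtain ⟨x, ⟨hx1, hx2⟩, hx⟩ :=
    IsRealClosed.exists_root_of_eval_mul_eval_neg _ (by linarith) hprod
  refine ⟨x, ⟨abs_lt.2 ⟨by linarith, by linarith⟩, hx⟩, ?_⟩
  rintro y ⟨hy1, hy⟩
  have h2 := diffQuot_mul q y x
  rw [hx, hy, sub_zero] at h2
  have h3 := key q y x hq (hy1.trans hδε) (abs_lt.2 ⟨by linarith, by linarith⟩)
  have h4 : diffQuot q y x ≠ 0 := fun h => by rw [h, zero_mul] at h3; exact lt_irrefl _ h3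
  exact sub_eq_zero.1 ((mul_eq_zero.1 h2).resolve_left h4)

/-- Under small perturbations of the coefficients all real roots stay close to the old ones. -/
theorem eventually_root_near_root (q₀ : Fin m → R) {δ : R} (hδ : 0 < δ) :
    ∀ᶠ q in 𝓝 q₀, ∀ x, (monicPoly q).eval x = 0 →
      ∃ c, (monicPoly q₀).eval c = 0 ∧ |x - c| < δ := by
  -- `q₀ = ∏ (X - c) * P` with `P` bounded away from zero
  obtain ⟨P, hP, -, hP0⟩ := exists_prod_multiset_X_sub_C_mul (monicPoly q₀)
  have hne := (monicPoly_monic q₀).ne_zero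
  have hPne : P ≠ 0 := by rintro rfl; rw [mul_zero] at hP; exact hne hP.symm
  obtain ⟨γ, hγ, hPγ⟩ := IsRealClosed.exists_pos_le_abs_eval P fun x hx => by
    have := (mem_roots hPne).2 hx
    rw [hP0] at this
    exact Multiset.notMem_zero _ this
  set s := (monicPoly q₀).roots with hs
  have hfar : ∀ x, (∀ c ∈ s, δ ≤ |x - c|) → δ ^ Multiset.card s * γ ≤ |(monicPoly q₀).eval x| := by
    intro x hx
    rw [← hP, eval_mul, abs_mul]
    refine mul_le_mul ?_ (hPγ x) hγ.le (abs_nonneg _)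
    clear_value s
    clear hs hP
    induction s using Multiset.induction_on with
    | empty => simp
    | cons c s ih =>
      rw [Multiset.map_cons, Multiset.prod_cons, eval_mul, abs_mul, Multiset.card_cons, pow_succ']
      refine mul_le_mul ?_ (ih fun c hc => hx c (Multiset.mem_cons_of_mem hc)) (by positivity)
        (abs_nonneg _)
      simpa using hx c (Multiset.mem_cons_self c s)
  -- a bound for the roots of all `q` near `q₀`
  set B : R := 2 + ∑ j, |q₀ j| with hB
  have hB1 : 0 ≤ B := by
    have : 0 ≤ ∑ j, |q₀ j| := Finset.sum_nonneg fun _ _ => abs_nonneg _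
    linarith
  have hη : 0 < δ ^ Multiset.card s * γ := by positivity
  have hc1 : Continuous fun q : Fin m → R => ∑ j, |q j| := by fun_prop
  have hc2 : Continuous fun q : Fin m → R => ∑ j, |q₀ j - q j| * B ^ (j : ℕ) := by fun_prop
  filter_upwards [(hc1.tendsto q₀).eventually_lt_const (u := B - 1) (by rw [hB]; linarith),
    (hc2.tendsto q₀).eventually_lt_const (u := δ ^ Multiset.card s * γ) (by simpa using hη)]
    with q hq1 hq2 x hx
  by_contra! hcon
  have hxB : |x| ≤ B := (abs_le_of_eval_monicPoly_eq_zero hx).trans (by linarith)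
  have h1 := hfar x fun c hc => hcon c (isRoot_of_mem_roots hc)
  have h2 : |(monicPoly q₀).eval x| ≤ ∑ j, |q₀ j - q j| * B ^ (j : ℕ) := by
    have : (monicPoly q₀).eval x = ∑ j, (q₀ j - q j) * x ^ (j : ℕ) := by
      rw [← sub_zero ((monicPoly q₀).eval x), ← hx, eval_monicPoly, eval_monicPoly]
      simp only [sub_mul, Finset.sum_sub_distrib]
      ring
    rw [this]
    refine (Finset.abs_sum_le_sum_abs _ _).trans (Finset.sum_le_sum fun j _ => ?_)
    rw [abs_mul, abs_pow]
    exact mul_le_mul_of_nonneg_left (pow_le_pow_left₀ (abs_nonneg _) hxB _) (abs_nonneg _)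
  linarith

/-- The real roots of a squarefree polynomial, in ascending order, depend continuously on the
coefficients; in particular their number is locally constant. -/
theorem eventually_strictMono_roots {q₀ : Fin m → R} (hsep : (monicPoly q₀).Separable) {N : ℕ}
    {e₀ : Fin N → R} (he₀ : StrictMono e₀)
    (hroots : ∀ x, (monicPoly q₀).eval x = 0 ↔ x ∈ Set.range e₀) {ε : R} (hε : 0 < ε) :
    ∀ᶠ q in 𝓝 q₀, ∃ e : Fin N → R, StrictMono e ∧
      (∀ x, (monicPoly q).eval x = 0 ↔ x ∈ Set.range e) ∧ ∀ i, |e i - e₀ i| < ε := by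
  have h0 : ∀ i, (monicPoly q₀).eval (e₀ i) = 0 := fun i => (hroots _).2 ⟨i, rfl⟩
  have h1 : ∀ i, (derivative (monicPoly q₀)).eval (e₀ i) ≠ 0 := fun i h => by
    obtain ⟨a, b, hab⟩ := hsep
    have := congrArg (eval (e₀ i)) hab
    simp [h0, h] at this
  have h2 : ∀ᶠ δ in 𝓝[>] (0 : R), (0 < δ ∧ δ < ε) ∧
      (∀ i j, i < j → δ < (e₀ j - e₀ i) / 2) ∧
      ∀ i, ∀ᶠ q in 𝓝 q₀, ∃! x, |x - e₀ i| < δ ∧ (monicPoly q).eval x = 0 := by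
    have h3 : ∀ᶠ δ in 𝓝[>] (0 : R), 0 < δ ∧ δ < ε := Ioo_mem_nhdsGT hε
    refine h3.and (Eventually.and ?_ ?_)
    · refine eventually_all.2 fun i => eventually_all.2 fun j => ?_
      by_cases hij : i < j
      · filter_upwards [Ioo_mem_nhdsGT (half_pos (sub_pos.2 (he₀ hij)))] with δ hδ _
        exact hδ.2
      · exact Eventually.of_forall fun δ h => absurd h hij
    · exact eventually_all.2 fun i => exists_eventually_existsUnique_root (h0 i) (h1 i)
  obtain ⟨δ, ⟨hδ, hδε⟩, hδ2, hδ3⟩ := h2.exists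
  filter_upwards [eventually_all.2 hδ3, eventually_root_near_root q₀ hδ] with q hq hq'
  choose e he he' using hq
  refine ⟨e, fun i j hij => ?_, fun x => ⟨fun hx => ?_, ?_⟩, fun i => (he i).1.trans hδε⟩
  · have h3 := abs_lt.1 (he i).1
    have h4 := abs_lt.1 (he j).1
    have h5 := hδ2 i j hij
    linarith [h3.2, h4.1]
  · obtain ⟨c, hc, hxc⟩ := hq' x hx
    obtain ⟨i, rfl⟩ := (hroots c).1 hc
    exact ⟨i, (he' i x ⟨hxc, hx⟩).symm⟩
  · rintro ⟨i, rfl⟩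
    exact (he i).2

end ContinuityOfRoots

/-! ### Delineation of the real roots of a squarefree polynomial -/

section Delineation

open Polynomial Filter

theorem card_filter_lt_of_strictMono {R : Type*} [LinearOrder R] {k : ℕ} {e : Fin k → R}
    (he : StrictMono e) {s : Finset R} (hs : ∀ x, x ∈ s ↔ x ∈ Set.range e) (i : Fin k) :
    (s.filter fun x => x < e i).card = i := by
  have : s.filter (fun x => x < e i) = (Finset.Iio i).map ⟨e, he.injective⟩ := by
    ext x
    simp only [Finset.mem_filter, hs, Finset.mem_map, Finset.mem_Iio, Function.Embedding.coeFn_mk]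
    constructor
    · rintro ⟨⟨j, rfl⟩, h⟩
      exact ⟨j, he.lt_iff_lt.1 h, rfl⟩
    · rintro ⟨j, h, rfl⟩
      exact ⟨⟨j, rfl⟩, he h⟩
  rw [this, Finset.card_map, Fin.card_Iio]

theorem card_of_strictMono {R : Type*} [LinearOrder R] {k : ℕ} {e : Fin k → R}
    (he : StrictMono e) {s : Finset R} (hs : ∀ x, x ∈ s ↔ x ∈ Set.range e) : s.card = k := by
  have : s = Finset.univ.map ⟨e, he.injective⟩ := by
    ext x
    simp [hs]
  rw [this, Finset.card_map, Finset.card_fin]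

variable {R : Type*} [Field R] [LinearOrder R]

theorem mem_roots_monicPoly_toFinset {m : ℕ} (q : Fin m → R) (x : R) :
    x ∈ (monicPoly q).roots.toFinset ↔ (monicPoly q).eval x = 0 := by
  rw [Multiset.mem_toFinset, mem_roots (monicPoly_monic q).ne_zero, IsRoot]

/-- The real roots of a monic polynomial in ascending order. The value is junk if the number of
roots is not `k`. -/
noncomputable def orderedRoots {m : ℕ} (k : ℕ) (q : Fin m → R) : Fin k → R :=
  if h : (monicPoly q).roots.toFinset.card = k then
    (monicPoly q).roots.toFinset.orderEmbOfFin h else 0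

theorem orderedRoots_strictMono {m k : ℕ} {q : Fin m → R}
    (h : (monicPoly q).roots.toFinset.card = k) : StrictMono (orderedRoots k q) := by
  rw [orderedRoots, dif_pos h]
  exact OrderEmbedding.strictMono _

theorem eval_eq_zero_iff_mem_range_orderedRoots {m k : ℕ} {q : Fin m → R}
    (h : (monicPoly q).roots.toFinset.card = k) (x : R) :
    (monicPoly q).eval x = 0 ↔ x ∈ Set.range (orderedRoots k q) := by
  rw [orderedRoots, dif_pos h, Finset.range_orderEmbOfFin, Finset.mem_coe,
    mem_roots_monicPoly_toFinset]

theorem eq_orderedRoots {m k : ℕ} {q : Fin m → R} {e : Fin k → R} (he : StrictMono e)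
    (hroots : ∀ x, (monicPoly q).eval x = 0 ↔ x ∈ Set.range e) :
    (monicPoly q).roots.toFinset.card = k ∧ orderedRoots k q = e := by
  have h := card_of_strictMono he fun x => (mem_roots_monicPoly_toFinset q x).trans (hroots x)
  refine ⟨h, StrictMono.range_inj (orderedRoots_strictMono h) he |>.1 ?_⟩
  ext x
  rw [← hroots, eval_eq_zero_iff_mem_range_orderedRoots h]

variable [IsStrictOrderedRing R] [IsRealClosed R]

theorem eventually_orderedRoots [TopologicalSpace R] [OrderTopology R] {m k : ℕ} {q₀ : Fin m → R}
    (hsep : (monicPoly q₀).Separable) (hk : (monicPoly q₀).roots.toFinset.card = k) {ε : R}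
    (hε : 0 < ε) :
    ∀ᶠ q in 𝓝 q₀, (monicPoly q).roots.toFinset.card = k ∧
      ∀ i, |orderedRoots k q i - orderedRoots k q₀ i| < ε := by
  filter_upwards [eventually_strictMono_roots hsep (orderedRoots_strictMono hk)
    (eval_eq_zero_iff_mem_range_orderedRoots hk) hε] with q hq
  obtain ⟨e, he, hroots, h⟩ := hq
  obtain ⟨h1, h2⟩ := eq_orderedRoots he hroots
  exact ⟨h1, by rwa [h2]⟩

variable {n m : ℕ} {S : Set (Fin n → R)} {q : (Fin n → R) → Fin m → R}

/-- Over a semi-algebraically connected set, a squarefree polynomial whose degree does not drop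
has a constant number of real roots. -/
theorem exists_card_roots_eq (hS : IsSemialgebraic S) (hconn : IsSemialgebraicallyConnected S)
    (hq : ∀ j, IsRegularOn S fun a => q a j) (hsep : ∀ a ∈ S, (monicPoly (q a)).Separable) :
    ∃ k, ∀ a ∈ S, (monicPoly (q a)).roots.toFinset.card = k := by
  rcases S.eq_empty_or_nonempty with rfl | ⟨a₀, ha₀⟩
  · exact ⟨0, fun a ha => absurd ha (Set.notMem_empty a)⟩
  let : TopologicalSpace R := Preorder.topology R
  have : OrderTopology R := ⟨rfl⟩
  have hcont : Continuous fun a : S => q a :=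
    continuous_pi fun j => continuousOn_iff_continuous_domRestrict.1 (hq j).continuousOn
  have hloc : IsLocallyConstant fun a : S => (monicPoly (q a)).roots.toFinset.card := by
    rw [IsLocallyConstant.iff_eventually_eq]
    intro a
    filter_upwards [(hcont.tendsto a).eventually
      (eventually_orderedRoots (hsep a a.2) rfl one_pos)] with b hb
    exact hb.1
  set k := (monicPoly (q a₀)).roots.toFinset.card
  refine ⟨k, ?_⟩
  by_contra! h
  obtain ⟨b, hb, hbk⟩ := h
  have hclosed : ∀ P : ℕ → Prop, ∃ Z, IsClosed[euclideanTopology R (Fin n)] Z ∧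
      {a ∈ S | P (monicPoly (q a)).roots.toFinset.card} = S ∩ Z := by
    intro P
    rw [euclideanTopology_eq_pi]
    have h1 : IsClosed {a : S | P (monicPoly (q a)).roots.toFinset.card} :=
      ⟨hloc {r | ¬ P r}⟩
    obtain ⟨Z, hZ, hZ'⟩ := isClosed_induced_iff.1 h1
    refine ⟨Z, hZ, ?_⟩
    ext a
    refine and_congr_right fun ha => ?_
    exact (Set.ext_iff.1 hZ' ⟨a, ha⟩).symm
  have hsemi := isSemialgebraic_card_roots hS hq hsep k
  refine hconn ⟨{a ∈ S | (monicPoly (q a)).roots.toFinset.card = k},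
    {a ∈ S | (monicPoly (q a)).roots.toFinset.card ≠ k}, hsemi, ?_, ⟨a₀, ha₀, rfl⟩, ⟨b, hb, hbk⟩,
    hclosed (· = k), hclosed (· ≠ k), ?_, ?_⟩
  · convert hS.diff hsemi using 1
    ext a
    simp only [Set.mem_ofPred_eq, Set.mem_sdiff]
    tauto
  · rw [Set.disjoint_left]
    exact fun a h1 h2 => h2.2 h1.2
  · ext a
    simp only [Set.mem_ofPred_eq, Set.mem_union]
    tauto

/-- The `i`-th root is the one with `i` roots below it. -/
theorem isSemialgebraic_graph_orderedRoots (hS : IsSemialgebraic S)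
    (hq : ∀ j, IsRegularOn S fun a => q a j) (hsep : ∀ a ∈ S, (monicPoly (q a)).Separable) {k : ℕ}
    (hk : ∀ a ∈ S, (monicPoly (q a)).roots.toFinset.card = k) (i : Fin k) :
    IsSemialgebraic (Set.range fun a : S => (Sum.elim (a : Fin n → R)
      (Fin.snoc (α := fun _ => R) a.1 (orderedRoots k (q a) i)) : Fin n ⊕ Fin (n + 1) → R)) := by
  let U : Set (Fin n ⊕ Fin (n + 1) → R) := {x | (fun j => x (Sum.inl j)) ∈ S}
  have hU : IsSemialgebraic U := by
    simpa using hS.preimage fun j : Fin n =>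
      (MvPolynomial.X (Sum.inl j) : MvPolynomial (Fin n ⊕ Fin (n + 1)) R)
  have hreg : ∀ j, IsRegularOn U fun x => q (fun j => x (Sum.inl j)) j := fun j => by
    simpa using (hq j).comp (S := U) (g := fun j : Fin n =>
      (MvPolynomial.X (Sum.inl j) : MvPolynomial (Fin n ⊕ Fin (n + 1)) R)) (by simp [U])
  have hcoord : ∀ v, IsRegularOn U fun x => x v := fun v => by
    simpa using IsRegularOn.eval (S := U) (MvPolynomial.X v)
  have hroot : IsRegularOn U fun x => (monicPoly (q fun j => x (Sum.inl j))).eval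
      (x (Sum.inr (Fin.last n))) := by
    simp only [eval_monicPoly]
    exact ((hcoord _).pow _).add (.sum _ fun j _ => (hreg j).mul ((hcoord _).pow _))
  have h1 := isSemialgebraic_card_roots_lt hU hreg (fun x hx => hsep _ hx)
    (hcoord (Sum.inr (Fin.last n))) i
  have h2 := hroot.isSemialgebraic_eq_zero hU
  have h3 := isSemialgebraic_biInter Set.finite_univ fun (j : Fin n) _ =>
    ((hcoord (Sum.inr j.castSucc)).sub (hcoord (Sum.inl j))).isSemialgebraic_eq_zero hU
  convert (h1.inter h2).inter (h3.inter hU) using 1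
  ext x
  simp only [Set.mem_range, Set.mem_inter_iff, Set.mem_ofPred_eq, Set.mem_iInter, Set.mem_univ,
    forall_true_left, sub_eq_zero]
  constructor
  · rintro ⟨a, rfl⟩
    have ha : (Sum.elim (a : Fin n → R) (Fin.snoc (α := fun _ => R) a.1
        (orderedRoots k (q a) i)) : Fin n ⊕ Fin (n + 1) → R) ∈ U := a.2
    refine ⟨⟨⟨ha, ?_⟩, ha, ?_⟩, fun j => ⟨ha, ?_⟩, ha⟩
    · simpa using card_filter_lt_of_strictMono (orderedRoots_strictMono (hk a a.2))
        (fun x => (mem_roots_monicPoly_toFinset _ x).trans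
          (eval_eq_zero_iff_mem_range_orderedRoots (hk a a.2) x)) i
    · simpa using (eval_eq_zero_iff_mem_range_orderedRoots (hk a a.2) _).2 ⟨i, rfl⟩
    · simp
  · rintro ⟨⟨⟨ha, hcard⟩, -, hx⟩, hinit, -⟩
    refine ⟨⟨_, ha⟩, ?_⟩
    obtain ⟨j, hj⟩ := (eval_eq_zero_iff_mem_range_orderedRoots (hk _ ha) _).1 hx
    rw [← hj, card_filter_lt_of_strictMono (orderedRoots_strictMono (hk _ ha))
        (fun x => (mem_roots_monicPoly_toFinset _ x).trans
          (eval_eq_zero_iff_mem_range_orderedRoots (hk _ ha) x)) j] at hcard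
    obtain rfl : j = i := Fin.ext hcard
    funext v
    rcases v with v | v
    · rfl
    · induction v using Fin.lastCases with
      | last => simpa using hj
      | cast v => simpa using (hinit v).2.symm

theorem isSemialgebraicContinuous_orderedRoots (hS : IsSemialgebraic S)
    (hq : ∀ j, IsRegularOn S fun a => q a j) (hsep : ∀ a ∈ S, (monicPoly (q a)).Separable) {k : ℕ}
    (hk : ∀ a ∈ S, (monicPoly (q a)).roots.toFinset.card = k) (i : Fin k) :
    IsSemialgebraicContinuous (Subtype.val : S → Fin n → R) id fun a : S =>
      Fin.snoc (α := fun _ => R) a.1 (orderedRoots k (q a) i) := by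
  refine ⟨isSemialgebraic_graph_orderedRoots hS hq hsep hk i, ?_⟩
  let : TopologicalSpace R := Preorder.topology R
  have : OrderTopology R := ⟨rfl⟩
  rw [euclideanTopology_eq_pi, euclideanTopology_eq_pi, induced_id]
  have hcont : Continuous fun a : S => q a :=
    continuous_pi fun j => continuousOn_iff_continuous_domRestrict.1 (hq j).continuousOn
  have hroots : Continuous fun a : S => orderedRoots k (q a) i := by
    refine continuous_iff_continuousAt.2 fun a => ?_
    rw [ContinuousAt, (nhds_basis_abs_sub_lt _).tendsto_right_iff]
    intro ε hε
    filter_upwards [(hcont.tendsto a).eventually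
      (eventually_orderedRoots (hsep a a.2) (hk a a.2) hε)] with b hb
    exact hb.2 i
  change Continuous fun a : S => Fin.snoc (α := fun _ => R) a.1 (orderedRoots k (q a) i)
  refine continuous_pi fun v => ?_
  induction v using Fin.lastCases with
  | last => simpa using hroots
  | cast v =>
    simp only [Fin.snoc_castSucc]
    exact (continuous_apply v).comp continuous_subtype_val

end Delineation

/-! ### Hankel systems and the extraction of a factor of constant degree -/

section Hankel

open Polynomial

/-- The solution `q` of the Hankel system `∑ j, s (i + j) * q j = - s (i + m)`, `i < m`. -/
noncomputable def hankelSolution {K : Type*} [Field K] (m : ℕ) (s : ℕ → K) : Fin m → K :=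
  -((Matrix.of fun i j : Fin m => s (i + j))⁻¹.mulVec fun i => s (i + m))

/-- Prony's method: if `s k = ∑ j, μ j * z j ^ k` with distinct nodes and nonzero weights, then the
monic polynomial with roots `z j` is found by solving a nonsingular Hankel system. -/
theorem hankel_det_ne_zero_and_map_eq_prod {K C : Type*} [Field K] [Field C] [Algebra K C] {m : ℕ}
    {s : ℕ → K} {z μ : Fin m → C} (hz : Function.Injective z) (hμ : ∀ j, μ j ≠ 0)
    (hs : ∀ k, algebraMap K C (s k) = ∑ j, μ j * z j ^ k) :
    (Matrix.of fun i j : Fin m => s (i + j)).det ≠ 0 ∧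
      (monicPoly (hankelSolution m s)).map (algebraMap K C) = ∏ j, (X - Polynomial.C (z j)) := by
  set H : Matrix (Fin m) (Fin m) K := Matrix.of fun i j : Fin m => s (i + j) with hH
  set V := Matrix.vandermonde z with hV
  have hfac : H.map (algebraMap K C) = V.transpose * Matrix.diagonal μ * V := by
    ext i j
    rw [Matrix.mul_assoc, Matrix.mul_apply]
    simp only [Matrix.map_apply, hH, Matrix.of_apply, hs, Matrix.diagonal_mul,
      Matrix.transpose_apply, hV, Matrix.vandermonde_apply, pow_add]
    exact Finset.sum_congr rfl fun k _ => by ring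
  have hVdet : V.det ≠ 0 := Matrix.det_vandermonde_ne_zero_iff.2 hz
  have hdetC : (H.map (algebraMap K C)).det ≠ 0 := by
    rw [hfac, Matrix.det_mul, Matrix.det_mul, Matrix.det_transpose, Matrix.det_diagonal]
    exact mul_ne_zero (mul_ne_zero hVdet (Finset.prod_ne_zero_iff.2 fun j _ => hμ j)) hVdet
  have hdet : H.det ≠ 0 := by
    intro h
    apply hdetC
    have := RingHom.map_det (algebraMap K C) H
    rw [h, map_zero] at this
    exact this.symm
  refine ⟨hdet, ?_⟩
  have hmonic : (∏ j, (X - Polynomial.C (z j))).Monic :=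
    monic_prod_of_monic _ _ fun j _ => monic_X_sub_C _
  have hdeg : (∏ j, (X - Polynomial.C (z j))).natDegree = m := by
    rw [natDegree_prod_of_monic _ _ fun j _ => monic_X_sub_C _]
    simp
  set e : Fin m → C := fun j => (∏ j, (X - Polynomial.C (z j))).coeff j with he
  have hprod : ∏ j, (X - Polynomial.C (z j)) = monicPoly e := hmonic.eq_monicPoly hdeg
  rw [hprod, map_monicPoly]
  congr 1
  -- the coefficients of the product and the solution of the Hankel system solve the same system
  have h1 : (H.map (algebraMap K C)).mulVec e = fun i : Fin m => - algebraMap K C (s (i + m)) := by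
    ext i
    have hroot : ∀ k, ∑ j, e j * z k ^ (j : ℕ) = - z k ^ m := fun k => by
      have : (monicPoly e).eval (z k) = 0 := by
        rw [← hprod, eval_prod]
        exact Finset.prod_eq_zero (Finset.mem_univ k) (by simp)
      rw [eval_monicPoly] at this
      exact eq_neg_of_add_eq_zero_right this
    simp only [Matrix.mulVec, dotProduct, Matrix.map_apply, hH, Matrix.of_apply, hs,
      Finset.sum_mul]
    rw [Finset.sum_comm, ← Finset.sum_neg_distrib]
    refine Finset.sum_congr rfl fun k _ => ?_
    calc ∑ j : Fin m, μ k * z k ^ ((i : ℕ) + (j : ℕ)) * e j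
        = μ k * z k ^ (i : ℕ) * ∑ j, e j * z k ^ (j : ℕ) := by
          rw [Finset.mul_sum]
          exact Finset.sum_congr rfl fun j _ => by rw [pow_add]; ring
      _ = -(μ k * z k ^ ((i : ℕ) + m)) := by rw [hroot, pow_add]; ring
  have h2 : (H.map (algebraMap K C)).mulVec (fun j => algebraMap K C (hankelSolution m s j)) =
      fun i : Fin m => - algebraMap K C (s (i + m)) := by
    have h3 : H.mulVec (hankelSolution m s) = fun i : Fin m => - s (i + m) := by
      rw [hankelSolution, Matrix.mulVec_neg, Matrix.mulVec_mulVec, ← hH,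
        Matrix.mul_nonsing_inv _ (isUnit_iff_ne_zero.2 hdet), Matrix.one_mulVec]
      rfl
    ext i
    rw [← map_neg, ← congrFun h3 i, RingHom.map_mulVec]
    rfl
  have h4 := Matrix.eq_zero_of_mulVec_eq_zero hdetC
    (v := (fun j => algebraMap K C (hankelSolution m s j)) - e)
    (by rw [Matrix.mulVec_sub, h1, h2, sub_self])
  exact sub_eq_zero.1 h4

universe u

variable {R : Type u} [Field R] {d D : ℕ}

/-- The sum `∑ h(c) ^ 2 * c ^ k` over the complex roots `c`, with multiplicity, of the monic
polynomial with lower coefficients `p`, where `h` is the polynomial with coefficients `h`. -/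
noncomputable def weightedPowerSum (h : Fin D → R) (p : Fin d → R) (k : ℕ) : R :=
  ∑ l, ∑ l', h l * h l' * MvPolynomial.eval p (powerSumPoly R d (l + l' + k))

theorem algebraMap_weightedPowerSum {C : Type u} [Field C] [Algebra R C] (h : Fin D → R)
    {p : Fin d → R} {c : Fin d → C}
    (hc : (monicPoly p).map (algebraMap R C) = ∏ i, (X - Polynomial.C (c i))) (k : ℕ) :
    algebraMap R C (weightedPowerSum h p k) = ∑ i, evalCoeffs D (c i) h ^ 2 * c i ^ k := by
  simp only [weightedPowerSum, map_sum, map_mul, algebraMap_eval_powerSumPoly _ hc, pow_two,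
    evalCoeffs_apply, Finset.sum_mul, Finset.mul_sum]
  rw [Finset.sum_comm' (t' := Finset.univ) (s' := fun _ => Finset.univ) (by simp)]
  conv_rhs => rw [Finset.sum_comm]
  rw [Finset.sum_comm]
  refine Finset.sum_congr rfl fun l _ => ?_
  rw [Finset.sum_comm' (t' := Finset.univ) (s' := fun _ => Finset.univ) (by simp)]
  conv_rhs => rw [Finset.sum_comm]
  rw [Finset.sum_comm]
  refine Finset.sum_congr rfl fun l' _ => ?_
  refine Finset.sum_congr rfl fun i _ => ?_
  rw [pow_add, pow_add]
  ring

variable [CharZero R]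

/-- In the weighted power sums only the roots `c` with `h(c) ≠ 0` contribute. Each has the weight
`h(c) ^ 2` times its multiplicity, which is not zero in characteristic zero. -/
theorem exists_nodes_weights {C : Type u} [Field C] [Algebra R C] [IsAlgClosed C] (h : Fin D → R)
    (p : Fin d → R) {m : ℕ}
    (hm : {c : C | aeval c (monicPoly p) = 0 ∧ evalCoeffs D c h ≠ 0}.encard = m) :
    ∃ z μ : Fin m → C, Function.Injective z ∧ (∀ j, μ j ≠ 0) ∧
      Set.range z = {c : C | aeval c (monicPoly p) = 0 ∧ evalCoeffs D c h ≠ 0} ∧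
      ∀ k, algebraMap R C (weightedPowerSum h p k) = ∑ j, μ j * z j ^ k := by
  classical
  have : CharZero C := charZero_of_injective_algebraMap (algebraMap R C).injective
  obtain ⟨c, hc⟩ := exists_monicPoly_eq_prod fun j => algebraMap R C (p j)
  rw [← map_monicPoly] at hc
  set Z := {c : C | aeval c (monicPoly p) = 0 ∧ evalCoeffs D c h ≠ 0} with hZ
  have hfin : Z.Finite := Set.finite_of_encard_eq_coe hm
  have hcard : hfin.toFinset.card = m := by
    have := hfin.encard_eq_coe_toFinset_card
    rw [hm] at this
    exact_mod_cast this.symm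
  let ε := (Finset.equivFinOfCardEq hcard).symm
  have hmem : ∀ j, (ε j : C) ∈ Z := fun j => hfin.mem_toFinset.1 (ε j).2
  refine ⟨fun j => ε j, fun j => ((Finset.univ.filter fun i => c i = ε j).card : C) *
    evalCoeffs D (ε j : C) h ^ 2, fun j k hjk => ε.injective (Subtype.ext hjk), fun j => ?_, ?_,
    fun k => ?_⟩
  · refine mul_ne_zero (Nat.cast_ne_zero.2 ?_) (pow_ne_zero 2 (hmem j).2)
    obtain ⟨i, hi⟩ := (aeval_eq_zero_iff_of_prod hc _).1 (hmem j).1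
    exact Finset.card_ne_zero_of_mem (Finset.mem_filter.2 ⟨Finset.mem_univ i, hi⟩)
  · ext x
    constructor
    · rintro ⟨j, rfl⟩
      exact hmem j
    · intro hx
      exact ⟨ε.symm ⟨x, hfin.mem_toFinset.2 hx⟩, by simp⟩
  · rw [algebraMap_weightedPowerSum h hc]
    have h1 : ∑ i, evalCoeffs D (c i) h ^ 2 * c i ^ k =
        ∑ i ∈ Finset.univ.filter fun i => c i ∈ hfin.toFinset,
          evalCoeffs D (c i) h ^ 2 * c i ^ k := by
      refine (Finset.sum_filter_of_ne fun i _ hi => ?_).symm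
      rw [hfin.mem_toFinset]
      exact ⟨(aeval_eq_zero_iff_of_prod hc _).2 ⟨i, rfl⟩, fun h0 => hi (by rw [h0]; simp)⟩
    rw [h1, ← Finset.sum_fiberwise_of_maps_to (t := hfin.toFinset) (g := c)
      (fun i hi => (Finset.mem_filter.1 hi).2)]
    rw [← Finset.sum_coe_sort, ← ε.sum_comp]
    refine Finset.sum_congr rfl fun j _ => ?_
    rw [Finset.filter_filter]
    have h2 : (Finset.univ.filter fun i => c i ∈ hfin.toFinset ∧ c i = ε j) =
        Finset.univ.filter fun i => c i = ε j := by
      refine Finset.filter_congr fun i _ => ⟨fun h => h.2, fun h => ⟨?_, h⟩⟩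
      rw [h]
      exact (ε j).2
    rw [h2, Finset.sum_congr rfl (g := fun _ => evalCoeffs D (ε j : C) h ^ 2 * (ε j : C) ^ k),
      Finset.sum_const, nsmul_eq_mul, mul_assoc]
    intro i hi
    rw [(Finset.mem_filter.1 hi).2]

/-- If the number of distinct complex roots `c` of `p` with `h(c) ≠ 0` is constant on `S`, these
are the roots of a squarefree monic polynomial whose coefficients are regular on `S`. -/
theorem exists_separable_family {ι : Type*} {S : Set (ι → R)} {h : (ι → R) → Fin D → R}
    {p : (ι → R) → Fin d → R} (hh : ∀ l, IsRegularOn S fun a => h a l)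
    (hp : ∀ l, IsRegularOn S fun a => p a l) {m : ℕ}
    (hm : ∀ a ∈ S, {c : AlgebraicClosure R |
      aeval c (monicPoly (p a)) = 0 ∧ evalCoeffs D c (h a) ≠ 0}.encard = m) :
    ∃ q : (ι → R) → Fin m → R, (∀ j, IsRegularOn S fun a => q a j) ∧
      ∀ a ∈ S, (monicPoly (q a)).Separable ∧ ∀ c : AlgebraicClosure R,
        aeval c (monicPoly (q a)) = 0 ↔
          aeval c (monicPoly (p a)) = 0 ∧ evalCoeffs D c (h a) ≠ 0 := by
  have hs : ∀ k, IsRegularOn S fun a => weightedPowerSum (h a) (p a) k := fun k =>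
    .sum _ fun l _ => .sum _ fun l' _ => ((hh l).mul (hh l')).mul (.eval_comp _ hp)
  let M : (ι → R) → Matrix (Fin m) (Fin m) R := fun a =>
    Matrix.of fun i j : Fin m => weightedPowerSum (h a) (p a) (i + j)
  have hMreg : ∀ i j, IsRegularOn S fun a => M a i j := fun i j => hs (i + j)
  have hMdet : ∀ a ∈ S, (M a).det ≠ 0 := fun a ha => by
    obtain ⟨z, μ, hz, hμ, -, hzs⟩ := exists_nodes_weights (h a) (p a) (hm a ha)
    exact (hankel_det_ne_zero_and_map_eq_prod hz hμ hzs).1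
  refine ⟨fun a => hankelSolution m (weightedPowerSum (h a) (p a)), fun j => ?_, fun a ha => ?_⟩
  · have hsum : IsRegularOn S fun a => -∑ i, (M a)⁻¹ j i * weightedPowerSum (h a) (p a) (i + m) :=
      .neg (.sum _ fun i _ => .mul (.inv_apply hMreg hMdet j i) (hs (i + m)))
    exact hsum
  · obtain ⟨z, μ, hz, hμ, hrange, hzs⟩ := exists_nodes_weights (h a) (p a) (hm a ha)
    have hprod := (hankel_det_ne_zero_and_map_eq_prod hz hμ hzs).2
    refine ⟨?_, fun c => ?_⟩
    · rw [← separable_map (algebraMap R (AlgebraicClosure R)), hprod, separable_prod_X_sub_C_iff]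
      exact hz
    · rw [aeval_eq_zero_iff_of_prod hprod]
      exact Set.ext_iff.1 hrange c

end Hankel

/-! ### The points of `X` over a rational point of `D(w)` -/

section Fibre

variable {R A B : Type*} [Field R] [CommRing A] [CommRing B] [Algebra R A] [Algebra R B]
  [Algebra A B] [IsScalarTower R A B] {n : ℕ} {iX : MvPolynomial (Fin (n + 1)) R →ₐ[R] B}
  {iY : MvPolynomial (Fin n) R →ₐ[R] A}

theorem RationalPoint.apply_eq_eval_coords (y : RationalPoint R A) (f : MvPolynomial (Fin n) R) :
    y (iY f) = MvPolynomial.eval (y.coords iY) f := by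
  have : (y.comp iY) = MvPolynomial.aeval (y.coords iY) := by
    ext i
    simp [RationalPoint.coords]
  exact congrArg (fun φ => φ f) this

/-- The point of affine `(n + 1)`-space over `C` with first coordinates `a`, defined over `R`, and
last coordinate `c`. -/
def snocPoint (C : Type*) [CommRing C] [Algebra R C] (a : Fin n → R) (c : C) : Fin (n + 1) → C :=
  Fin.snoc (α := fun _ => C) (fun i => algebraMap R C (a i)) c

/-- The `C`-points of `X` over the `R`-point `y` of `Y`. -/
def IsOver {C : Type*} [CommRing C] [Algebra R C] (ψ : B →ₐ[R] C) (y : RationalPoint R A) : Prop :=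
  ∀ α : A, ψ (algebraMap A B α) = algebraMap R C (y α)

section

variable {C : Type*} [CommRing C] [Algebra R C]

theorem IsProjectionOfRelDimOne.iX_castSucc (hπ : IsProjectionOfRelDimOne iX iY) (i : Fin n) :
    iX (MvPolynomial.X i.castSucc) = algebraMap A B (iY (MvPolynomial.X i)) := by
  have := congrArg (fun φ => φ (MvPolynomial.X i)) hπ.comm
  simpa using this

theorem IsOver.apply_iX (hπ : IsProjectionOfRelDimOne iX iY) {ψ : B →ₐ[R] C}
    {y : RationalPoint R A} (hψ : IsOver ψ y) (f : MvPolynomial (Fin (n + 1)) R) :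
    ψ (iX f) = MvPolynomial.aeval
      (snocPoint C (y.coords iY) (ψ (iX (MvPolynomial.X (Fin.last n))))) f := by
  have : ψ.comp iX = MvPolynomial.aeval
      (snocPoint C (y.coords iY) (ψ (iX (MvPolynomial.X (Fin.last n))))) := by
    ext i
    induction i using Fin.lastCases with
    | last => simp [snocPoint]
    | cast i =>
      rw [AlgHom.comp_apply, hπ.iX_castSucc, hψ]
      simp [snocPoint, RationalPoint.coords]
  exact congrArg (fun φ => φ f) this

/-- The `C`-points of `X` over `y`, in terms of their last coordinate. -/
theorem exists_isOver_iff (hπ : IsProjectionOfRelDimOne iX iY) (y : RationalPoint R A) (c : C) :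
    (∃ ψ : B →ₐ[R] C, IsOver ψ y ∧ ψ (iX (MvPolynomial.X (Fin.last n))) = c) ↔
      ∀ f ∈ RingHom.ker iX, MvPolynomial.aeval (snocPoint C (y.coords iY) c) f = 0 := by
  constructor
  · rintro ⟨ψ, hψ, rfl⟩ f hf
    rw [← hψ.apply_iX hπ, RingHom.mem_ker.1 hf, map_zero]
  · intro h
    let ψ₀ : (MvPolynomial (Fin (n + 1)) R ⧸ RingHom.ker iX) →ₐ[R] C :=
      Ideal.Quotient.liftₐ (RingHom.ker iX) (MvPolynomial.aeval (snocPoint C (y.coords iY) c)) h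
    let ψ : B →ₐ[R] C :=
      ψ₀.comp (Ideal.quotientKerAlgEquivOfSurjective hπ.surjective_iX).symm.toAlgHom
    have hψ : ∀ f, ψ (iX f) = MvPolynomial.aeval (snocPoint C (y.coords iY) c) f := fun f => by
      have : (Ideal.quotientKerAlgEquivOfSurjective hπ.surjective_iX).symm (iX f) =
          Ideal.Quotient.mk _ f := by
        rw [AlgEquiv.symm_apply_eq]
        rfl
      change ψ₀ ((Ideal.quotientKerAlgEquivOfSurjective hπ.surjective_iX).symm (iX f)) = _
      rw [this]
      rfl
    refine ⟨ψ, fun α => ?_, ?_⟩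
    · obtain ⟨g, rfl⟩ := hπ.surjective_iY α
      have h1 : algebraMap A B (iY g) = iX (MvPolynomial.rename Fin.castSucc g) :=
        (congrArg (fun φ => φ g) hπ.comm).symm
      have h2 : snocPoint C (y.coords iY) c ∘ Fin.castSucc =
          fun i => algebraMap R C (y.coords iY i) := by
        ext i
        simp [snocPoint]
      rw [h1, hψ, MvPolynomial.aeval_rename, h2, y.apply_eq_eval_coords,
        ← MvPolynomial.coe_aeval_eq_eval]
      exact MvPolynomial.aeval_algebraMap_apply (A := R) C (y.coords iY) g
    · rw [hψ]
      simp [snocPoint]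

end

theorem one_tmul_algebraMap {A B : Type*} [CommRing A] [CommRing B] [Algebra A B] (A' : Type*)
    [CommRing A'] [Algebra A A'] (α : A) :
    (1 : A') ⊗ₜ[A] algebraMap A B α = algebraMap A' (A' ⊗[A] B) (algebraMap A A' α) := by
  rw [← IsScalarTower.algebraMap_apply]
  exact (Algebra.TensorProduct.includeRight : B →ₐ[A] A' ⊗[A] B).commutes α

/-- `B` is generated over `A` by the last coordinate, and this persists after base change. -/
theorem adjoin_last_eq_top (hπ : IsProjectionOfRelDimOne iX iY) (A' : Type*) [CommRing A']
    [Algebra A A'] :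
    Algebra.adjoin A' {(1 : A') ⊗ₜ[A] iX (MvPolynomial.X (Fin.last n))} = ⊤ := by
  rw [eq_top_iff]
  set T := Algebra.adjoin A' {(1 : A') ⊗ₜ[A] iX (MvPolynomial.X (Fin.last n))}
  have halg : ∀ α : A, (1 : A') ⊗ₜ[A] algebraMap A B α ∈ T := fun α => by
    rw [one_tmul_algebraMap]
    exact T.algebraMap_mem _
  have hB : ∀ b : B, (1 : A') ⊗ₜ[A] b ∈ T := by
    intro b
    obtain ⟨f, rfl⟩ := hπ.surjective_iX b
    induction f using MvPolynomial.induction_on with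
    | C r =>
      have : iX (MvPolynomial.C r) = algebraMap A B (algebraMap R A r) := by
        rw [← IsScalarTower.algebraMap_apply]
        exact iX.commutes r
      rw [this]
      exact halg _
    | add f g hf hg =>
      rw [map_add, TensorProduct.tmul_add]
      exact T.add_mem hf hg
    | mul_X f i hf =>
      have : (1 : A') ⊗ₜ[A] iX (f * MvPolynomial.X i) =
          ((1 : A') ⊗ₜ[A] iX f) * ((1 : A') ⊗ₜ[A] iX (MvPolynomial.X i)) := by
        rw [Algebra.TensorProduct.tmul_mul_tmul, one_mul, map_mul]
      rw [this]
      refine T.mul_mem hf ?_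
      induction i using Fin.lastCases with
      | last => exact Algebra.subset_adjoin rfl
      | cast i =>
        rw [hπ.iX_castSucc]
        exact halg _
  rintro t -
  induction t using TensorProduct.induction_on with
  | zero => exact T.zero_mem
  | tmul a b =>
    have : a ⊗ₜ[A] b = algebraMap A' (A' ⊗[A] B) a * ((1 : A') ⊗ₜ[A] b) := by
      rw [Algebra.TensorProduct.algebraMap_apply, Algebra.TensorProduct.tmul_mul_tmul, one_mul]
      simp
    rw [this]
    exact T.mul_mem (T.algebraMap_mem _) (hB b)
  | add s t hs ht => exact T.add_mem hs ht

/-- The evaluation at a point of `D(w)`, extended to the localization. -/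
noncomputable def RationalPoint.away {w : A} (y : RationalPoint R A) (hy : y w ≠ 0) :
    Localization.Away w →+* R :=
  IsLocalization.Away.lift (g := (y : A →+* R)) w (isUnit_iff_ne_zero.2 hy)

theorem RationalPoint.away_algebraMap {w : A} (y : RationalPoint R A) (hy : y w ≠ 0) (α : A) :
    y.away hy (algebraMap A _ α) = y α :=
  IsLocalization.Away.lift_eq (g := (y : A →+* R)) w (isUnit_iff_ne_zero.2 hy) α

open Polynomial in
/-- Over `D(w)` the variety `X` is the zero set of one monic polynomial in the last coordinate `x`:
as a finite free algebra generated by `x`, the coordinate ring is the quotient of the polynomial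
ring by the minimal polynomial of `x`. -/
theorem exists_isOver_iff_aeval_minpoly (hπ : IsProjectionOfRelDimOne iX iY) {w : A}
    (hfinite : Module.Finite (Localization.Away w) (Localization.Away w ⊗[A] B))
    (hfree : Module.Free (Localization.Away w) (Localization.Away w ⊗[A] B))
    {C : Type*} [CommRing C] [Algebra R C] {y : RationalPoint R A} (hy : y w ≠ 0) (c : C) :
    (∃ ψ : B →ₐ[R] C, IsOver ψ y ∧ ψ (iX (MvPolynomial.X (Fin.last n))) = c) ↔
      aeval c ((minpoly (Localization.Away w)
        ((1 : Localization.Away w) ⊗ₜ[A] iX (MvPolynomial.X (Fin.last n)))).map (y.away hy)) =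
        0 := by
  set x := (1 : Localization.Away w) ⊗ₜ[A] iX (MvPolynomial.X (Fin.last n))
  let η : Localization.Away w →+* C := (algebraMap R C).comp (y.away hy)
  have hη : ∀ P : (Localization.Away w)[X], aeval c (P.map (y.away hy)) = eval₂ η c P := fun P => by
    rw [aeval_def, eval₂_map]
  rw [hη]
  constructor
  · rintro ⟨ψ, hψ, rfl⟩
    let Aw := Localization.Away w
    let : Algebra Aw C := η.toAlgebra
    let : Algebra A C := ((algebraMap R C).comp (y : A →+* R)).toAlgebra
    have : IsScalarTower A Aw C := .of_algebraMap_eq fun α => by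
      change algebraMap R C (y α) = algebraMap R C (y.away hy (algebraMap A Aw α))
      rw [y.away_algebraMap]
    let ψ' : B →ₐ[A] C := { (ψ : B →+* C) with commutes' := hψ }
    let θ : Aw ⊗[A] B →ₐ[Aw] C := Algebra.TensorProduct.lift (Algebra.ofId Aw C) ψ'
      fun _ _ => Commute.all _ _
    have hθ : θ x = ψ (iX (MvPolynomial.X (Fin.last n))) := by
      simp only [θ, x, Algebra.TensorProduct.lift_tmul, map_one, one_mul]
      rfl
    have h1 := congrArg θ (minpoly.aeval Aw x)
    rw [map_zero, ← aeval_algHom_apply, hθ] at h1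
    exact h1
  · intro hc
    let ρ := (IsAdjoinRootMonic.mkOfAdjoinEqTop' (adjoin_last_eq_top hπ (Localization.Away w)))
    let θ : Localization.Away w ⊗[A] B →+* C := ρ.toIsAdjoinRoot.lift η c hc
    have hθa : ∀ a, θ (algebraMap _ _ a) = η a := fun a =>
      ρ.toIsAdjoinRoot.lift_algebraMap hc a
    have hθx : θ x = c := by
      have := ρ.toIsAdjoinRoot.lift_root (i := η) (x := c) hc
      rwa [IsAdjoinRootMonic.mkOfAdjoinEqTop'_root] at this
    have hα : ∀ α : A, θ ((1 : Localization.Away w) ⊗ₜ[A] algebraMap A B α) =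
        algebraMap R C (y α) := fun α => by
      rw [one_tmul_algebraMap, hθa]
      change algebraMap R C (y.away hy _) = _
      rw [y.away_algebraMap]
    let ψ : B →ₐ[R] C :=
      { θ.comp (Algebra.TensorProduct.includeRight : B →ₐ[A] _).toRingHom with
        commutes' := fun r => by
          change θ ((1 : Localization.Away w) ⊗ₜ[A] algebraMap R B r) = algebraMap R C r
          rw [IsScalarTower.algebraMap_apply R A B, hα]
          congr 1
          exact y.commutes r }
    exact ⟨ψ, hα, hθx⟩

end Fibre

section Family

open Polynomial

variable {R A B : Type*} [Field R] [CommRing A] [CommRing B] [Algebra R A] [Algebra R B]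
  [Algebra A B] [IsScalarTower R A B] {n : ℕ} {iX : MvPolynomial (Fin (n + 1)) R →ₐ[R] B}
  {iY : MvPolynomial (Fin n) R →ₐ[R] A}

/-- The specializations of a monic polynomial over `A_w` at the rational points of `D(w)` form a
regular family. -/
theorem exists_regular_family {w : A} (hiY : Function.Surjective iY)
    {P : (Localization.Away w)[X]} (hP : P.Monic) :
    ∃ p : (Fin n → R) → Fin P.natDegree → R,
      (∀ j, IsRegularOn {a | ∃ y : RationalPoint R A, y w ≠ 0 ∧ y.coords iY = a} fun a => p a j) ∧
      ∀ (y : RationalPoint R A) (hy : y w ≠ 0),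
        monicPoly (p (y.coords iY)) = P.map (y.away hy) := by
  choose k α hα using fun j : Fin P.natDegree =>
    IsLocalization.Away.surj (S := Localization.Away w) w (P.coeff j)
  choose N hN using fun j => hiY (α j)
  obtain ⟨ω, hω⟩ := hiY w
  have hωy : ∀ y : RationalPoint R A, MvPolynomial.eval (y.coords iY) ω = y w := fun y => by
    rw [← y.apply_eq_eval_coords, hω]
  refine ⟨fun a j => MvPolynomial.eval a (N j) / MvPolynomial.eval a ω ^ k j, fun j => ?_,
    fun y hy => ?_⟩
  · refine (IsRegularOn.eval _).div ((IsRegularOn.eval _).pow _) ?_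
    rintro _ ⟨y, hy, rfl⟩
    rw [hωy]
    exact pow_ne_zero _ hy
  · rw [(hP.map (y.away hy)).eq_monicPoly (hP.natDegree_map _)]
    congr 1
    ext j
    have h1 := congrArg (y.away hy) (hα j)
    rw [map_mul, map_pow, y.away_algebraMap, y.away_algebraMap, ← hN,
      y.apply_eq_eval_coords] at h1
    simp only [coeff_map, hωy]
    rw [← h1, mul_div_cancel_right₀ _ (pow_ne_zero _ hy)]

/-- A polynomial in `n + 1` variables as a polynomial in the last one. -/
theorem exists_aeval_snocPoint_eq_evalCoeffs (C : Type*) [Field C] [Algebra R C]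
    (f : MvPolynomial (Fin (n + 1)) R) :
    ∃ (D : ℕ) (g : Fin D → MvPolynomial (Fin n) R), ∀ (a : Fin n → R) (c : C),
      MvPolynomial.aeval (snocPoint C a c) f =
        evalCoeffs D c fun l => MvPolynomial.eval a (g l) := by
  let Ψ : MvPolynomial (Fin (n + 1)) R →ₐ[R] (MvPolynomial (Fin n) R)[X] :=
    MvPolynomial.aeval (Fin.snoc (α := fun _ => (MvPolynomial (Fin n) R)[X])
      (fun i => Polynomial.C (MvPolynomial.X i)) X)
  refine ⟨(Ψ f).natDegree + 1, fun l => (Ψ f).coeff l, fun a c => ?_⟩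
  have h1 : MvPolynomial.aeval (snocPoint C a c) f =
      eval₂ ((algebraMap R C).comp (MvPolynomial.eval a)) c (Ψ f) := by
    induction f using MvPolynomial.induction_on with
    | C r =>
      have : Ψ (MvPolynomial.C r) = Polynomial.C (MvPolynomial.C r) := Ψ.commutes r
      simp [this]
    | add f g hf hg => rw [map_add, map_add, eval₂_add, hf, hg]
    | mul_X f i hf =>
      rw [map_mul, map_mul, eval₂_mul, hf]
      congr 1
      induction i using Fin.lastCases <;> simp [Ψ, snocPoint]
  rw [h1, eval₂_eq_sum_range, evalCoeffs_apply, Finset.sum_range]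
  rfl

end Family

/-! ### Geometric fibres -/

section GeometricFibre

variable {R A B : Type*} [Field R] [CommRing A] [CommRing B] [Algebra R A] [Algebra R B]
  [Algebra A B] [IsScalarTower R A B]

theorem finite_tensorProduct_of_isUnit (w : A)
    [Module.Finite (Localization.Away w) (Localization.Away w ⊗[A] B)] (K : Type*) [Field K]
    [Algebra A K] (hw : IsUnit (algebraMap A K w)) : Module.Finite K (K ⊗[A] B) := by
  let Aw := Localization.Away w
  let : Algebra Aw K := (IsLocalization.Away.lift (S := Aw) w hw).toAlgebra
  have : IsScalarTower A Aw K := .of_algebraMap_eq fun α =>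
    (IsLocalization.Away.lift_eq (S := Aw) w hw α).symm
  exact Module.Finite.equiv
    (Algebra.TensorProduct.cancelBaseChange A Aw K K B).toLinearEquiv

/-- The algebraic closure of the residue field at a rational point, as the algebraic closure of the
base field. -/
theorem RationalPoint.exists_ringEquiv (y : RationalPoint R A) :
    ∃ e : AlgebraicClosure y.toPrime.asIdeal.ResidueField ≃+* AlgebraicClosure R,
      ∀ α : A, e (algebraMap A _ α) = algebraMap R _ (y α) := by
  let f : y.toPrime.asIdeal.ResidueField →+* R :=
    Ideal.ResidueField.lift y.toPrime.asIdeal (y : A →+* R) le_rfl fun α hα =>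
      isUnit_iff_ne_zero.2 hα
  have hf : ∀ α, f (algebraMap A _ α) = y α := fun α => Ideal.ResidueField.lift_algebraMap _ _ _ _ α
  have hbij : Function.Bijective f :=
    ⟨f.injective, fun r => ⟨algebraMap A _ (algebraMap R A r), by rw [hf]; exact y.commutes r⟩⟩
  let ε := RingEquiv.ofBijective f hbij
  refine ⟨IsAlgClosure.equivOfEquiv _ _ ε, fun α => ?_⟩
  rw [IsScalarTower.algebraMap_apply A y.toPrime.asIdeal.ResidueField,
    IsAlgClosure.equivOfEquiv_algebraMap]
  exact congrArg _ (hf α)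

/-- The points of the geometric fibre of `D(h)` over a rational point `y` in `D(w)` correspond to
the points of `X` over `y` with coordinates in the algebraic closure at which `h` does not vanish:
the fibre is finite, so its points are closed and have residue field the algebraic closure. -/
theorem encard_geometricFiber {w : A}
    (hfinite : Module.Finite (Localization.Away w) (Localization.Away w ⊗[A] B)) (h : B)
    {y : RationalPoint R A} (hy : y w ≠ 0) :
    (geometricFiber h y.toPrime).encard =
      {ψ : B →ₐ[R] AlgebraicClosure R | IsOver ψ y ∧ ψ h ≠ 0}.encard := by
  obtain ⟨e, he⟩ := y.exists_ringEquiv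
  set K := AlgebraicClosure y.toPrime.asIdeal.ResidueField with hK
  have he' : ∀ α, e.symm (algebraMap R _ (y α)) = algebraMap A K α := fun α => by
    rw [← he, e.symm_apply_apply]
  set Ψ := {ψ : B →ₐ[R] AlgebraicClosure R | IsOver ψ y ∧ ψ h ≠ 0} with hΨ
  let ψK : Ψ → B →ₐ[A] K := fun ψ =>
    { (e.symm : AlgebraicClosure R →+* K).comp (ψ.1 : B →+* AlgebraicClosure R) with
      commutes' := fun α => by
        change e.symm (ψ.1 (algebraMap A B α)) = _
        rw [ψ.2.1, he'] }
  let Θ : Ψ → K ⊗[A] B →ₐ[K] K := fun ψ =>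
    Algebra.TensorProduct.lift (AlgHom.id K K) (ψK ψ) fun _ _ => Commute.all _ _
  have hΘ : ∀ ψ b, Θ ψ ((1 : K) ⊗ₜ[A] b) = e.symm (ψ.1 b) := fun ψ b => by
    simp only [Θ, Algebra.TensorProduct.lift_tmul, map_one, one_mul]
    rfl
  let F : Ψ → PrimeSpectrum (K ⊗[A] B) := fun ψ => ⟨RingHom.ker (Θ ψ), RingHom.ker_isPrime _⟩
  have hFinj : Function.Injective F := by
    intro ψ ψ' hψ
    have hker : RingHom.ker (Θ ψ) = RingHom.ker (Θ ψ') := congrArg PrimeSpectrum.asIdeal hψ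
    refine Subtype.ext (AlgHom.ext fun b => e.symm.injective ?_)
    rw [← hΘ, ← hΘ]
    set t := (1 : K) ⊗ₜ[A] b
    have h1 : t - algebraMap K _ (Θ ψ t) ∈ RingHom.ker (Θ ψ) := by
      rw [RingHom.mem_ker, map_sub, AlgHom.commutes]
      exact sub_self _
    rw [hker, RingHom.mem_ker, map_sub, AlgHom.commutes] at h1
    exact (sub_eq_zero.1 h1).symm
  have hrange : Set.range F = geometricFiber h y.toPrime := by
    ext 𝔮
    constructor
    · rintro ⟨ψ, rfl⟩
      change ¬ (Θ ψ ((1 : K) ⊗ₜ[A] h) = 0)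
      rw [hΘ]
      exact (map_ne_zero_iff _ e.symm.injective).2 ψ.2.2
    · intro h𝔮
      have hw : IsUnit (algebraMap A K w) := by
        rw [isUnit_iff_ne_zero, ← he']
        exact (map_ne_zero_iff _ e.symm.injective).2
          ((map_ne_zero_iff _ (algebraMap R _).injective).2 hy)
      have := finite_tensorProduct_of_isUnit (B := B) w K hw
      have : 𝔮.asIdeal.IsPrime := 𝔮.isPrime
      have hbij : Function.Bijective (algebraMap K ((K ⊗[A] B) ⧸ 𝔮.asIdeal)) :=
        IsAlgClosed.algebraMap_bijective_of_isIntegral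
      let τ : ((K ⊗[A] B) ⧸ 𝔮.asIdeal) ≃ₐ[K] K :=
        (AlgEquiv.ofBijective (Algebra.ofId K ((K ⊗[A] B) ⧸ 𝔮.asIdeal)) hbij).symm
      let Φ : K ⊗[A] B →ₐ[K] K := τ.toAlgHom.comp (Ideal.Quotient.mkₐ K 𝔮.asIdeal)
      have hΦ : ∀ t, Φ t = 0 ↔ t ∈ 𝔮.asIdeal := fun t => by
        change τ (Ideal.Quotient.mk _ t) = 0 ↔ _
        rw [map_eq_zero_iff _ τ.injective, Ideal.Quotient.eq_zero_iff_mem]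
      have hover : ∀ α, e (Φ ((1 : K) ⊗ₜ[A] algebraMap A B α)) = algebraMap R _ (y α) := fun α => by
        rw [one_tmul_algebraMap, AlgHom.commutes]
        exact he α
      let ψ : B →ₐ[R] AlgebraicClosure R :=
        { (e : K →+* AlgebraicClosure R).comp ((Φ : K ⊗[A] B →+* K).comp
            (Algebra.TensorProduct.includeRight : B →ₐ[A] K ⊗[A] B).toRingHom) with
          commutes' := fun r => by
            change e (Φ ((1 : K) ⊗ₜ[A] algebraMap R B r)) = _
            rw [IsScalarTower.algebraMap_apply R A B, hover]
            congr 1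
            exact y.commutes r }
      have hψ : ψ ∈ Ψ := by
        refine ⟨hover, ?_⟩
        change e (Φ ((1 : K) ⊗ₜ[A] h)) ≠ 0
        rw [map_ne_zero_iff _ e.injective, ne_eq, hΦ]
        exact h𝔮
      refine ⟨⟨ψ, hψ⟩, PrimeSpectrum.ext ?_⟩
      have hΘΦ : Θ ⟨ψ, hψ⟩ = Φ := by
        refine Algebra.TensorProduct.ext (Subsingleton.elim _ _) ?_
        ext b
        change Θ ⟨ψ, hψ⟩ ((1 : K) ⊗ₜ[A] b) = Φ ((1 : K) ⊗ₜ[A] b)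
        rw [hΘ]
        exact e.symm_apply_apply _
      ext t
      change Θ ⟨ψ, hψ⟩ t = 0 ↔ _
      rw [hΘΦ, hΦ]
  rw [← hrange, ← Set.image_univ, hFinj.encard_image, Set.encard_univ]
  rfl

end GeometricFibre

/-! ### Delineability -/

section Delineability

variable {R : Type*} [Field R] {n : ℕ}

theorem aeval_snocPoint_algebraMap (C : Type*) [Field C] [Algebra R C] (a : Fin n → R) (c : R)
    (f : MvPolynomial (Fin (n + 1)) R) :
    MvPolynomial.aeval (snocPoint C a (algebraMap R C c)) f =
      algebraMap R C (MvPolynomial.eval (Fin.snoc (α := fun _ => R) a c) f) := by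
  have h : snocPoint C a (algebraMap R C c) =
      fun i => algebraMap R C (Fin.snoc (α := fun _ => R) a c i) := by
    ext i
    induction i using Fin.lastCases <;> simp [snocPoint]
  rw [h, ← MvPolynomial.coe_aeval_eq_eval]
  exact MvPolynomial.aeval_algebraMap_apply (A := R) C (Fin.snoc (α := fun _ => R) a c) f

/-- A constructible set whose fibres over `S` are the zero sets of a regular family of separable
monic polynomials of fixed degree is geometrically delineable over `S`. -/
theorem geometricallyDelineable_of_separable_family [LinearOrder R] [IsStrictOrderedRing R]
    [IsRealClosed R] {S : Set (Fin n → R)} (hS : IsSemialgebraic S)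
    (hconn : IsSemialgebraicallyConnected S) {I : Ideal (MvPolynomial (Fin (n + 1)) R)}
    {h : MvPolynomial (Fin (n + 1)) R} {m : ℕ} {q : (Fin n → R) → Fin m → R}
    (hq : ∀ j, IsRegularOn S fun a => q a j) (hsep : ∀ a ∈ S, (monicPoly (q a)).Separable)
    (hqI : ∀ a ∈ S, ∀ c : AlgebraicClosure R, Polynomial.aeval c (monicPoly (q a)) = 0 ↔
      (∀ f ∈ I, MvPolynomial.aeval (snocPoint (AlgebraicClosure R) a c) f = 0) ∧
        MvPolynomial.aeval (snocPoint (AlgebraicClosure R) a c) h ≠ 0) :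
    GeometricallyDelineable I h S := by
  obtain ⟨k, hk⟩ := exists_card_roots_eq hS hconn hq hsep
  have hreal : ∀ a ∈ S, ∀ c : R,
      ((∀ f ∈ I, MvPolynomial.eval (Fin.snoc (α := fun _ => R) a c) f = 0) ∧
      MvPolynomial.eval (Fin.snoc (α := fun _ => R) a c) h ≠ 0) ↔
        c ∈ Set.range (orderedRoots k (q a)) := fun a ha c => by
    rw [← eval_eq_zero_iff_mem_range_orderedRoots (hk a ha)]
    have h1 := hqI a ha (algebraMap R _ c)
    simp only [aeval_snocPoint_algebraMap, Polynomial.aeval_algebraMap_apply_eq_algebraMap_eval,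
      map_eq_zero, ne_eq] at h1
    exact h1.symm
  refine ⟨⟨m, fun a ha => ?_⟩, k,
    fun i a => Fin.snoc (α := fun _ => R) a.1 (orderedRoots k (q a) i),
    isSemialgebraicContinuous_orderedRoots hS hq hsep hk,
    fun i a => (hreal a a.2 _).2 ⟨i, rfl⟩, fun i a => Fin.init_snoc _ _, fun a i j hij => ?_,
    fun a t hta htI hth => ?_⟩
  · have h1 : {c : AlgebraicClosure R |
        (∀ f ∈ I, MvPolynomial.aeval (snocPoint (AlgebraicClosure R) a c) f = 0) ∧
          MvPolynomial.aeval (snocPoint (AlgebraicClosure R) a c) h ≠ 0} =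
        (monicPoly (q a)).rootSet (AlgebraicClosure R) := by
      ext c
      rw [Polynomial.mem_rootSet_of_ne (monicPoly_monic _).ne_zero, hqI a ha]
      rfl
    refine (congrArg Set.encard h1).trans ?_
    rw [← Set.coe_fintypeCard, Polynomial.card_rootSet_eq_natDegree (hsep a ha)
      (IsAlgClosed.splits _), natDegree_monicPoly]
  · simpa using orderedRoots_strictMono (hk a a.2) hij
  · have ht : t = Fin.snoc (α := fun _ => R) a.1 (t (Fin.last n)) := by
      rw [← hta]
      exact (Fin.snoc_init_self t).symm
    rw [ht] at htI hth
    obtain ⟨i, hi⟩ := (hreal a a.2 _).1 ⟨htI, hth⟩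
    refine ⟨i, by rw [ht, ← hi], fun j hj => (orderedRoots_strictMono (hk a a.2)).injective ?_⟩
    simpa [hi] using (congrFun hj (Fin.last n)).symm

end Delineability

section Main

variable {R A B : Type*} [Field R] [CommRing A] [CommRing B] [Algebra R A] [Algebra R B]
  [Algebra A B] [IsScalarTower R A B] {n : ℕ} {iX : MvPolynomial (Fin (n + 1)) R →ₐ[R] B}
  {iY : MvPolynomial (Fin n) R →ₐ[R] A}

theorem RationalPoint.coords_injective {ι : Type*} {φ : MvPolynomial ι R →ₐ[R] A}
    (hφ : Function.Surjective φ) :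
    Function.Injective (RationalPoint.coords φ : RationalPoint R A → ι → R) := fun y y' hy => by
  have h : y.comp φ = y'.comp φ := MvPolynomial.algHom_ext fun i => congrFun hy i
  exact AlgHom.ext fun α => by
    obtain ⟨f, rfl⟩ := hφ α
    exact congrArg (fun g => g f) h

/-- The solutions over the algebraic closure above a rational point of `D(w)` are as many as the
points of its geometric fibre. -/
theorem encard_setOf_aeval_snocPoint (hπ : IsProjectionOfRelDimOne iX iY) {w : A}
    (hfinite : Module.Finite (Localization.Away w) (Localization.Away w ⊗[A] B))
    {y : RationalPoint R A} (hy : y w ≠ 0) (h : MvPolynomial (Fin (n + 1)) R) :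
    {c : AlgebraicClosure R |
      (∀ f ∈ RingHom.ker iX,
        MvPolynomial.aeval (snocPoint (AlgebraicClosure R) (y.coords iY) c) f = 0) ∧
      MvPolynomial.aeval (snocPoint (AlgebraicClosure R) (y.coords iY) c) h ≠ 0}.encard =
    (geometricFiber (iX h) y.toPrime).encard := by
  rw [encard_geometricFiber hfinite _ hy]
  set Ψ := {ψ : B →ₐ[R] AlgebraicClosure R | IsOver ψ y ∧ ψ (iX h) ≠ 0}
  have hinj : Set.InjOn (fun ψ : B →ₐ[R] AlgebraicClosure R =>
      ψ (iX (MvPolynomial.X (Fin.last n)))) Ψ := fun ψ hψ ψ' hψ' heq => AlgHom.ext fun b => by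
    obtain ⟨f, rfl⟩ := hπ.surjective_iX b
    rw [hψ.1.apply_iX hπ, hψ'.1.apply_iX hπ]
    exact congrArg (fun c => MvPolynomial.aeval (snocPoint _ (y.coords iY) c) f) heq
  rw [← hinj.encard_image]
  congr 1
  ext c
  simp only [Set.mem_ofPred_eq, ← exists_isOver_iff hπ]
  constructor
  · rintro ⟨⟨ψ, hψ, rfl⟩, hc⟩
    exact ⟨ψ, ⟨hψ, by rwa [hψ.apply_iX hπ]⟩, rfl⟩
  · rintro ⟨ψ, ⟨hψ, hc⟩, rfl⟩
    exact ⟨⟨ψ, hψ, rfl⟩, by rwa [← hψ.apply_iX hπ]⟩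

/-- The roots of the minimal polynomial of the last coordinate at which `h` does not vanish are
constant in number, hence the roots of a regular family of separable polynomials. -/
theorem geometricallyDelineable_of_geometricFiber [LinearOrder R] [IsStrictOrderedRing R]
    [IsRealClosed R] (hπ : IsProjectionOfRelDimOne iX iY) {w : A}
    (hfinite : Module.Finite (Localization.Away w) (Localization.Away w ⊗[A] B))
    (hfree : Module.Free (Localization.Away w) (Localization.Away w ⊗[A] B))
    (h : MvPolynomial (Fin (n + 1)) R) {S : Set (RationalPoint R A)}
    (hSW : ∀ y ∈ S, y w ≠ 0) (hS : IsSemialgebraic (RationalPoint.coords iY '' S))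
    (hSconn : IsSemialgebraicallyConnected (RationalPoint.coords iY '' S))
    (hinv : ∀ y ∈ S, ∀ y' ∈ S,
      (geometricFiber (iX h) y.toPrime).encard = (geometricFiber (iX h) y'.toPrime).encard) :
    GeometricallyDelineable (RingHom.ker iX) h (RationalPoint.coords iY '' S) := by
  set P := minpoly (Localization.Away w)
    ((1 : Localization.Away w) ⊗ₜ[A] iX (MvPolynomial.X (Fin.last n))) with hPdef
  have hP : P.Monic := minpoly.monic (Algebra.IsIntegral.isIntegral _)
  obtain ⟨p, hp, hpP⟩ := exists_regular_family hπ.surjective_iY hP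
  obtain ⟨D, g, hg⟩ := exists_aeval_snocPoint_eq_evalCoeffs (AlgebraicClosure R) h
  have hpI : ∀ y ∈ S, ∀ c : AlgebraicClosure R,
      Polynomial.aeval c (monicPoly (p (y.coords iY))) = 0 ↔ ∀ f ∈ RingHom.ker iX,
        MvPolynomial.aeval (snocPoint (AlgebraicClosure R) (y.coords iY) c) f = 0 :=
    fun y hy c => by
      rw [hpP y (hSW y hy), ← exists_isOver_iff_aeval_minpoly hπ hfinite hfree,
        exists_isOver_iff hπ]
  have hset : ∀ y ∈ S, {c : AlgebraicClosure R |
      Polynomial.aeval c (monicPoly (p (y.coords iY))) = 0 ∧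
        evalCoeffs D c (fun l => MvPolynomial.eval (y.coords iY) (g l)) ≠ 0}.encard =
      (geometricFiber (iX h) y.toPrime).encard := fun y hy => by
    rw [← encard_setOf_aeval_snocPoint hπ hfinite (hSW y hy) h]
    simp only [hpI y hy, hg]
  obtain ⟨m, hm⟩ : ∃ m : ℕ, ∀ y ∈ S, (geometricFiber (iX h) y.toPrime).encard = m := by
    rcases S.eq_empty_or_nonempty with rfl | ⟨y, hy⟩
    · exact ⟨0, by simp⟩
    · have hfin : {c : AlgebraicClosure R |
          Polynomial.aeval c (monicPoly (p (y.coords iY))) = 0 ∧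
            evalCoeffs D c (fun l => MvPolynomial.eval (y.coords iY) (g l)) ≠ 0}.Finite :=
        ((monicPoly (p (y.coords iY))).rootSet_finite (AlgebraicClosure R)).subset fun c hc =>
          (Polynomial.mem_rootSet_of_ne (monicPoly_monic _).ne_zero).2 hc.1
      refine ⟨hfin.toFinset.card, fun y' hy' => ?_⟩
      rw [hinv y' hy' y hy, ← hset y hy, hfin.encard_eq_coe_toFinset_card]
  obtain ⟨q, hq, hqsep⟩ := exists_separable_family (S := RationalPoint.coords iY '' S)
    (h := fun a l => MvPolynomial.eval a (g l)) (p := p) (m := m) (fun l => IsRegularOn.eval _)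
    (fun j => (hp j).mono (by rintro _ ⟨y, hy, rfl⟩; exact ⟨y, hSW y hy, rfl⟩))
    (by rintro _ ⟨y, hy, rfl⟩; rw [hset y hy, hm y hy])
  refine geometricallyDelineable_of_separable_family hS hSconn hq (fun a ha => (hqsep a ha).1) ?_
  rintro _ ⟨y, hy, rfl⟩ c
  rw [(hqsep _ ⟨y, hy, rfl⟩).2, hpI y hy, ← hg]

theorem IsProjectionOfRelDimOne.coords_map (hπ : IsProjectionOfRelDimOne iX iY)
    (x : RationalPoint R B) : x.map.coords iY = Fin.init (x.coords iX) := by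
  ext i
  exact congrArg x (hπ.iX_castSucc i).symm

/-- A real zero of the ideal of `X` over `y` is a rational point of `X` over `y`. -/
theorem IsProjectionOfRelDimOne.exists_coords_eq (hπ : IsProjectionOfRelDimOne iX iY)
    {y : RationalPoint R A} {t : Fin (n + 1) → R} (hty : Fin.init t = y.coords iY)
    (ht : ∀ f ∈ RingHom.ker iX, MvPolynomial.eval t f = 0) :
    ∃ x : RationalPoint R B, x.map = y ∧ x.coords iX = t := by
  have hsnoc : snocPoint R (y.coords iY) (t (Fin.last n)) = t := by
    rw [← hty]
    exact Fin.snoc_init_self t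
  obtain ⟨x, hx, hxt⟩ := (exists_isOver_iff hπ y (t (Fin.last n))).2 fun f hf => by
    rw [hsnoc]
    exact ht f hf
  have hxy : RationalPoint.map x = y := AlgHom.ext hx
  refine ⟨x, hxy, ?_⟩
  rw [← Fin.snoc_init_self t, hty, ← hxy, hπ.coords_map, ← hxt]
  exact (Fin.snoc_init_self _).symm

end Main

/-- `X = Spec B`, `Y = Spec A`, `W = D(w) = Spec A_w`, so that `X_W = Spec (A_w ⊗ B)`. -/
theorem mainTheorem4 {R A B : Type*} [Field R] [LinearOrder R] [IsStrictOrderedRing R]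
    [IsRealClosed R] [CommRing A] [CommRing B] [Algebra R A] [Algebra R B] [Algebra A B]
    [IsScalarTower R A B] {n : ℕ}
    (iX : MvPolynomial (Fin (n + 1)) R →ₐ[R] B) (iY : MvPolynomial (Fin n) R →ₐ[R] A)
    (hπ : IsProjectionOfRelDimOne iX iY)
    (w : A)
    (hfinite : Module.Finite (Localization.Away w) (Localization.Away w ⊗[A] B))
    (hfree : Module.Free (Localization.Away w) (Localization.Away w ⊗[A] B))
    (h : B) (S : Set (RationalPoint R A))
    (hSW : ∀ y ∈ S, y.toPrime ∈ PrimeSpectrum.basicOpen w)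
    (hS : IsSemialgebraic (RationalPoint.coords iY '' S))
    (hSconn : IsSemialgebraicallyConnected (RationalPoint.coords iY '' S))
    (hinv : ∀ y ∈ S, ∀ y' ∈ S,
      (geometricFiber h y.toPrime).encard = (geometricFiber h y'.toPrime).encard) :
    (∃ (l : ℕ) (ξ : Fin l → S → RationalPoint R B),
      (∀ i, IsSemialgebraicContinuous (fun y : S => y.1.coords iY) (RationalPoint.coords iX)
        (ξ i)) ∧
      (∀ i y, (ξ i y).map = y.1) ∧
      (∀ y : S, Set.range (fun i => ξ i y) =
        {x : RationalPoint R B | x.map = y.1 ∧ x.toPrime ∈ PrimeSpectrum.basicOpen h})) ∧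
    ∀ h' : MvPolynomial (Fin (n + 1)) R, iX h' = h →
      GeometricallyDelineable (RingHom.ker iX) h' (RationalPoint.coords iY '' S) := by
  have hdel : ∀ h' : MvPolynomial (Fin (n + 1)) R, iX h' = h →
      GeometricallyDelineable (RingHom.ker iX) h' (RationalPoint.coords iY '' S) := by
    rintro h' rfl
    exact geometricallyDelineable_of_geometricFiber hπ hfinite hfree h' hSW hS hSconn hinv
  refine ⟨?_, hdel⟩
  obtain ⟨h', rfl⟩ := hπ.surjective_iX h
  obtain ⟨-, k, ζ, hζ, hζI, hζinit, -, hζex⟩ := hdel h' rfl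
  let b : S → (RationalPoint.coords iY '' S : Set (Fin n → R)) := fun y =>
    ⟨y.1.coords iY, y, y.2, rfl⟩
  have hb : Function.Surjective b := by
    rintro ⟨_, y, hy, rfl⟩
    exact ⟨⟨y, hy⟩, rfl⟩
  choose ξ hξmap hξ using fun i y => hπ.exists_coords_eq (hζinit i (b y)) (hζI i (b y)).1
  refine ⟨k, ξ, fun i => ⟨?_, ?_⟩, hξmap, fun y => Set.Subset.antisymm ?_ ?_⟩
  · have h1 := (hζ i).1
    rw [← hb.range_comp] at h1
    simp only [hξ]
    exact h1
  · refine (@continuous_induced_rng _ _ _ _ (_) (_) _).2 ?_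
    have h1 : RationalPoint.coords iX ∘ ξ i = ζ i ∘ b := funext fun y => hξ i y
    rw [h1]
    have h2 := (@continuous_induced_rng _ _ _ _ (_) (_) _).1 (@Continuous.comp _ _ _
      (_) (_) (_) b (ζ i) (hζ i).2 ((@continuous_induced_rng _ _ _ _ (_) (_) _).2
        (@continuous_induced_dom _ _ (fun y : S => y.1.coords iY) (euclideanTopology R _))))
    exact h2
  · rintro _ ⟨i, rfl⟩
    refine ⟨hξmap i y, ?_⟩
    change ¬ (ξ i y (iX h') = 0)
    rw [(ξ i y).apply_eq_eval_coords, hξ]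
    exact (hζI i (b y)).2
  · rintro x ⟨hxy, hx⟩
    obtain ⟨i, hi, -⟩ := hζex (b y) (x.coords iX) (by rw [← hπ.coords_map, hxy])
      (fun f hf => by rw [← x.apply_eq_eval_coords, RingHom.mem_ker.1 hf, map_zero])
      (by rw [← x.apply_eq_eval_coords]; exact hx)
    exact ⟨i, RationalPoint.coords_injective hπ.surjective_iX (by rw [hξ, hi])⟩
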